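/- **Setting (quiver side).** Let $R$ be a commutative ring in which $2$ is invertible, $Q$ a finite quiver and $\overline Q$ its double: each arrow $a$ of $Q$ gets a double $\overline a$ with $s(\overline a)=t(a)$, $t(\overline a)=s(a)$. Let $\langle a,\overline a\rangle=1$ and $\langle \overline a,a\rangle=-1$ for arrows $a$ of $Q$, and $\langle -,-\rangle=0$ on all other pairs of arrows of $\overline Q$. Paths $a_1\cdots a_n$ are read from left to right, $t(a_k)=s(a_{k+1})$. Let $\mathcal N$ be the free $R$-module on the cyclic paths of $\overline Q$, i.e. closed paths up to cyclic permutation, including the constant paths $e_i$ at the vertices. With indices read cyclically, define $$\mathrm{br}^-(a_1\cdots a_m\otimes b_1\cdots b_n)=\sum_{i,j}\langle a_i,b_j\rangle\, e_{t(a_i)}a_{i+1}\cdots a_{i-1}b_{j+1}\cdots b_{j-1},$$ $$\mathrm{br}^+(a_1\cdots a_m\otimes b_1\cdots b_n)=\sum_{i,j}\langle a_i,b_j\rangle\, a_ia_{i+1}\cdots a_{i-1}a_i\,b_jb_{j+1}\cdots b_{j-1}b_j,$$ $$\delta^-(a_1\cdots a_n)=\tfrac12\sum_{i,j}\langle a_i,a_j\rangle\,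 e_{t(a_i)}a_{i+1}\cdots a_{j-1}\otimes e_{t(a_j)}a_{j+1}\cdots a_{i-1},$$ $$\delta^+(a_1\cdots a_n)=\tfrac12\sum_{i,j}\langle a_i,a_j\rangle\, a_ia_{i+1}\cdots a_{j-1}a_j\otimes a_ja_{j+1}\cdots a_{i-1}a_i,$$ all vanishing when an argument is a constant path. Let $S\Pi\mathcal N\cong\bigwedge\mathcal N$ be the free supercommutative algebra on the module $\mathcal N$ placed in odd degree. The necklace BV operator $\Delta^\pm=2\,\mathrm{br}^\pm-\delta^\pm$ on $S\Pi\mathcal N$ is given, for $x_1,\dots,x_n\in\Pi\mathcal N$, by $$\Delta^\pm(x_1\cdots x_n)=\sum_{i<j}(-1)^{i+j+1}\,2\,\mathrm{br}^\pm(x_i\otimes x_j)\,x_1\cdots\hat x_i\cdots\hat x_j\cdots x_n-\sum_i(-1)^{i+1}\delta^\pm(x_i)\,x_1\cdots\hat x_i\cdots x_n,$$ where $\delta^\pm(x)$ is regarded as an element of $S^2\Pi\mathcal N$ through the multiplication $\Pi\mathcal N\otimes\Pi\mathcal N\to S^2\Pi\mathcal N$. **Setting (representation side).** Let $\mathcal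 C$ be an $R$-linear symmetric monoidal category that is $\otimes$-cocomplete (it is cocomplete and $\otimes$ preserves colimits in each variable), with a parity structure: an object $\pi$ whose self-symmetry is $\sigma_{\pi,\pi}=-\mathrm{id}$ and an isomorphism $\xi:\pi\otimes\pi\to 1$. (So $\mathcal C$ is a symmetric monoidal $\Pi$-category.) Let $\underline{\mathcal C}(x,y)$ be the $R$-supermodule with even part $\mathcal C(x,y)$ and odd part $\mathcal C(\pi\otimes x,y)$; these compose by way of $\xi^{-1}$, the composite of two odd maps $f$, $g$ being $x\cong\pi\otimes\pi\otimes x\xrightarrow{\mathrm{id}\otimes f}\pi\otimes y\xrightarrow{g}z$. For a commutative monoid $A$ in $\mathcal C$, $\underline{\mathcal C}(1,A)$ is a superalgebra, with product the composite of $\pi^{|f|+|g|}\cong\pi^{|f|}\otimes\pi^{|g|}$, $f\otimes g$ and the multiplication of $A$. For every vertex $i$ fix an object $c_i$ of $\mathcal C$ with dual $c_i^\vee$ and an odd involution $\iota_i:\pi\otimes c_i\to c_i$ (that is, $\iota_i^2=\mathrm{id}$ in $\underline{\mathcal C}(c_i,c_i)$). Let $\iota_i^\vee:\pi\otimes c_i^\vee\to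 c_i^\vee$ be the dual map, in which $\pi$ is kept fixed: move $\pi$ past $c_i^\vee$, insert the coevaluation $1\to c_i\otimes c_i^\vee$ on the right, apply $\iota_i$, and evaluate $c_i^\vee\otimes c_i\to1$. For an arrow $a$ of $\overline Q$ put $h_a^\vee=c_{s(a)}\otimes c_{t(a)}^\vee$. Let $\widetilde h_a^\vee$ be the coequaliser of the two maps $\pi\otimes h_a^\vee\to h_a^\vee$ given by $\iota_{s(a)}$ on the factor $c_{s(a)}$ and by $\iota_{t(a)}^\vee$ on the factor $c_{t(a)}^\vee$ (after moving $\pi$ past $c_{s(a)}$), and let $\kappa_a:\pi\otimes h_a^\vee\to h_a^\vee$ (the *odd chord*) be the first of these maps minus the second. Put $\widetilde h^\vee=\bigoplus_a\widetilde h_a^\vee$, the sum being over the arrows of $\overline Q$, and let $S\widetilde h^\vee$ be the free commutative monoid on $\widetilde h^\vee$. For a path $w=a_1\cdots a_n$ from $i$ to $k$ let $\theta_w:c_i\otimes c_k^\vee\to S\widetilde h^\vee$ be the composite $$c_i\otimes c_k^\vee\to h_{a_1}^\vee\otimes\cdots\otimes h_{a_n}^\vee\to S\widetilde h^\vee,$$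 where the first map inserts a (symmetrised) coevaluation $1\to c_v^\vee\otimes c_v$ at each inner vertex $v$ of the path and the second one is induced by $h_a^\vee\to\widetilde h_a^\vee\to S\widetilde h^\vee$ and multiplication; for the constant path $e_i$ it is the evaluation $c_i\otimes c_i^\vee\cong c_i^\vee\otimes c_i\to1$ followed by the unit of $S\widetilde h^\vee$. The *odd trace* of a closed path $w$ at $i$ is the odd element $$\mathrm{otr}(w):\ \pi\to\pi\otimes c_i\otimes c_i^\vee\xrightarrow{\ \iota_i\otimes\mathrm{id}\ }c_i\otimes c_i^\vee\xrightarrow{\ \theta_w\ }S\widetilde h^\vee$$ of $\underline{\mathcal C}(1,S\widetilde h^\vee)$, the first map being the coevaluation. For arrows $a,b$ of $\overline Q$ let $\phi^\pm_{ab}:\pi\otimes h_a^\vee\otimes h_b^\vee\to S\widetilde h^\vee$ be $0$ if $\langle a,b\rangle=0$. Otherwise, $s(a)=t(b)$ and $s(b)=t(a)$, and $\phi^\pm_{ab}$ is $\langle a,b\rangle$ times the composite of: $\kappa_a\otimes\mathrm{id}_{h_b^\vee}$; the symmetry that exchanges the factors $c_{t(a)}^\vee$ and $c_{t(b)}^\vee$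 and so leads to $(c_{s(a)}\otimes c_{t(b)}^\vee)\otimes(c_{s(b)}\otimes c_{t(a)}^\vee)$; and the product in $S\widetilde h^\vee$ of the two maps $\theta_{e_{s(a)}}$ and $\theta_{e_{s(b)}}$ in the case of $\phi^-$, and of the two maps $\theta_{ab}$ and $\theta_{ba}$ in the case of $\phi^+$. For $f:b\otimes A\to A$, with $A$ a commutative monoid, let $Tf:(b\otimes A)\otimes A\to A$ be given in terms of elements by $(Tf)(\beta,x,y)=f(\beta,xy)-x\,f(\beta,y)$, where the symmetry is used to move $x$ past $\beta$ in the last term. An odd map $D:\pi\otimes A\to A$ is an odd differential operator of order at most $k$ on $A$ if $T^{k+1}D=0$. **Theorem.** 1. There is a unique $R$-algebra map $\mathrm{otr}:S\Pi\mathcal N\to\underline{\mathcal C}(1,S\widetilde h^\vee)$ whose value on every cyclic path is the odd trace of any closed path representing it (which does not depend on the representative), and it preserves parity; that is, $\mathrm{otr}$ is a well-defined map of superalgebras. 2. For each sign $\pm$ there is a unique odd differential operator $\widetilde\Delta^\pm:\pi\otimes S\widetilde h^\vee\to S\widetilde h^\vee$ of order at most $2$ which vanishes on $S^{\le1}\widetilde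 h^\vee$ (that is, on the unit and on $\widetilde h^\vee$) and whose value on products of two elements of $h^\vee=\bigoplus_a h_a^\vee$ is $\phi^\pm$ (that is, its composite with $\pi\otimes h_a^\vee\otimes h_b^\vee\to\pi\otimes S\widetilde h^\vee$ is $\phi^\pm_{ab}$ for all arrows $a,b$). 3. The map $\mathrm{otr}$ intertwines the necklace operators $\Delta^\pm$ with the representation-side operators $\widetilde\Delta^\pm$: for both signs and all $x\in S\Pi\mathcal N$, $$\mathrm{otr}(\Delta^\pm x)=\widetilde\Delta^\pm\circ\mathrm{otr}(x)\quad\text{in }\underline{\mathcal C}(1,S\widetilde h^\vee).$$ -/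

import Mathlib

open CategoryTheory MonoidalCategory Limits
open scoped TensorProduct

universe v u

namespace Necklace

/-! ## Double quivers and cyclic paths

A quiver is given by its source and target maps `s t : E → V`. An arrow of the double quiver is a
pair `(e, false)`, standing for the arrow `e` itself, or `(e, true)`, standing for its double. -/

section Quiver

variable {V E : Type*}

/-- Source of an arrow of the double quiver. -/
def src (s t : E → V) : E × Bool → V
  | (e, false) => s e
  | (e, true) => t e

/-- Target of an arrow of the double quiver. -/
def tgt (s t : E → V) : E × Bool → V
  | (e, false) => t e
  | (e, true) => s e

open Classical in
/-- The antisymmetric pairing on arrows of the double quiver: `⟨e, ē⟩ = 1`, `⟨ē, e⟩ = -1`, and `0`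
for all other pairs. -/
noncomputable def pairing : E × Bool → E × Bool → ℤ
  | (e, false), (e', true) => if e = e' then 1 else 0
  | (e, true), (e', false) => if e = e' then -1 else 0
  | _, _ => 0

theorem pairing_swap (a b : E × Bool) : pairing b a = -pairing a b := by
  rcases a with ⟨e, _ | _⟩ <;> rcases b with ⟨e', _ | _⟩ <;> simp only [pairing, neg_zero] <;>
    by_cases h : e = e' <;> simp [h, eq_comm]

/-- `IsPath s t i w j`: the word `w`, read from left to right, is a path from `i` to `j` in the
double quiver. The empty word is the constant path. -/
def IsPath (s t : E → V) : V → List (E × Bool) → V → Prop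
  | i, [], j => i = j
  | i, a :: w, j => i = src s t a ∧ IsPath s t (tgt s t a) w j

/-- A cyclic path in the double quiver is either the constant path at a vertex, or a nonempty
closed path up to cyclic permutation. -/
inductive CyclicPath (s t : E → V) : Type _
  | const (i : V) : CyclicPath s t
  | loop (w : Cycle (E × Bool)) (ne : w ≠ Cycle.nil)
      (closed : w.Chain fun a b => tgt s t a = src s t b) : CyclicPath s t

/-- The cyclic word underlying a cyclic path; it is empty for constant paths. -/
def CyclicPath.word {s t : E → V} : CyclicPath s t → Cycle (E × Bool)
  | .const _ => Cycle.nil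
  | .loop w _ _ => w

variable (R : Type*) [CommRing R] (s t : E → V)

/-- The module `𝒩`: the free `R`-module on the cyclic paths of the double quiver. -/
abbrev NecklaceModule := CyclicPath s t →₀ R

open Classical in
/-- The element of `𝒩` given by the closed path with word `w` based at the vertex `i`. (The base
point matters only for the constant path. Words that are not cyclically composable are given the
value `0`; they only ever occur below with coefficient `0`.) -/
noncomputable def cyc (i : V) (w : List (E × Bool)) : NecklaceModule R s t :=
  if ne : (w : Cycle (E × Bool)) = Cycle.nil then Finsupp.single (.const i) 1
  else if closed : (w : Cycle (E × Bool)).Chain fun a b => tgt s t a = src s t b then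
    Finsupp.single (.loop w ne closed) 1
  else 0

/-- The two versions of the necklace structure: the classical one (`minus`), which removes pairs
of arrows in involution, and the augmented one (`plus`), which inserts such pairs. -/
inductive Variant
  | minus
  | plus

/-- The contribution to `br^±(a₁⋯aₘ ⊗ b₁⋯bₙ)` of the pair of positions `(i, j)`. The arguments are
the rotated words `aᵢ aᵢ₊₁ ⋯ aᵢ₋₁` and `bⱼ bⱼ₊₁ ⋯ bⱼ₋₁`. The values are
`⟨aᵢ, bⱼ⟩ e_{t(aᵢ)} aᵢ₊₁ ⋯ aᵢ₋₁ bⱼ₊₁ ⋯ bⱼ₋₁` and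
`⟨aᵢ, bⱼ⟩ aᵢ aᵢ₊₁ ⋯ aᵢ₋₁ aᵢ bⱼ bⱼ₊₁ ⋯ bⱼ₋₁ bⱼ`. -/
noncomputable def brWord : Variant → List (E × Bool) → List (E × Bool) → NecklaceModule R s t
  | .minus, a :: u, b :: v => pairing a b • cyc R s t (tgt s t a) (u ++ v)
  | .plus, a :: u, b :: v =>
      pairing a b • cyc R s t (src s t a) (a :: u ++ [a] ++ (b :: v ++ [b]))
  | _, _, _ => 0

/-- `br^±` on a pair of cyclic paths: the sum over all pairs of positions. (`Cycle.lists` is the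
multiset of the `n` rotations of a cyclic word of length `n ≥ 1`, with multiplicities; constant
paths contribute `0`.) -/
noncomputable def brCyclic (σ : Variant) (p q : CyclicPath s t) : NecklaceModule R s t :=
  (p.word.lists.map fun l => (q.word.lists.map fun l' => brWord R s t σ l l').sum).sum

/-- The (augmented) necklace bracket `br^± : 𝒩 ⊗ 𝒩 → 𝒩`, as a bilinear map. -/
noncomputable def br (σ : Variant) :
    NecklaceModule R s t →ₗ[R] NecklaceModule R s t →ₗ[R] NecklaceModule R s t :=
  Finsupp.linearCombination R fun p => Finsupp.linearCombination R fun q => brCyclic R s t σ p q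

/-- The contribution to `2 δ^±(a₁⋯aₙ)` of a fixed position `i`. The argument is the rotated word
`aᵢ aᵢ₊₁ ⋯ aᵢ₋₁`, and the sum is over the remaining positions `j`. The summands are
`⟨aᵢ, aⱼ⟩ e_{t(aᵢ)} aᵢ₊₁ ⋯ aⱼ₋₁ ⊗ e_{t(aⱼ)} aⱼ₊₁ ⋯ aᵢ₋₁` and
`⟨aᵢ, aⱼ⟩ aᵢ aᵢ₊₁ ⋯ aⱼ₋₁ aⱼ ⊗ aⱼ aⱼ₊₁ ⋯ aᵢ₋₁ aᵢ`. (The summand `j = i` vanishes.) -/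
noncomputable def cobrWord :
    Variant → List (E × Bool) → NecklaceModule R s t ⊗[R] NecklaceModule R s t
  | _, [] => 0
  | .minus, a :: u => ∑ k : Fin u.length, pairing a u[k] •
      (cyc R s t (tgt s t a) (u.take k) ⊗ₜ[R] cyc R s t (tgt s t u[k]) (u.drop (k + 1)))
  | .plus, a :: u => ∑ k : Fin u.length, pairing a u[k] •
      (cyc R s t (src s t a) (a :: u.take k ++ [u[k]]) ⊗ₜ[R]
        cyc R s t (src s t u[k]) (u[k] :: u.drop (k + 1) ++ [a]))

/-- The (augmented) necklace cobracket `δ^± : 𝒩 → 𝒩 ⊗ 𝒩`. -/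
noncomputable def cobr [Invertible (2 : R)] (σ : Variant) :
    NecklaceModule R s t →ₗ[R] NecklaceModule R s t ⊗[R] NecklaceModule R s t :=
  Finsupp.linearCombination R fun p => ⅟(2 : R) • (p.word.lists.map (cobrWord R s t σ)).sum

theorem src_eq_tgt_of_pairing_ne_zero {a b : E × Bool} (h : pairing a b ≠ 0) :
    src s t a = tgt s t b := by
  rcases a with ⟨e, _ | _⟩ <;> rcases b with ⟨e', _ | _⟩ <;> simp only [pairing] at h <;>
    by_cases he : e = e' <;> simp_all [src, tgt]

theorem cyc_congr {i j : V} {w w' : List (E × Bool)} (h : (w : Cycle (E × Bool)) = w')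
    (hij : w = [] → i = j) : cyc R s t i w = cyc R s t j w' := by
  unfold cyc
  by_cases ne : (w : Cycle (E × Bool)) = Cycle.nil
  · have hw : w = [] := List.isRotated_nil_iff.mp (Cycle.coe_eq_coe.mp ne)
    rw [dif_pos ne, dif_pos (h ▸ ne), hij hw]
  · generalize (w : Cycle (E × Bool)) = x at h ne ⊢
    subst h
    simp only [dif_neg ne]

theorem brWord_swap (σ : Variant) (w w' : List (E × Bool))
    (h : (w : Cycle (E × Bool)).Chain fun a b => tgt s t a = src s t b) :
    brWord R s t σ w' w = -brWord R s t σ w w' := by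
  rcases w with _ | ⟨a, u⟩ <;> rcases w' with _ | ⟨b, v⟩ <;> rcases σ <;>
    simp only [brWord, neg_zero]
  · by_cases hp : pairing a b = 0
    · simp [pairing_swap a b, hp]
    · rw [pairing_swap a b, neg_smul]
      congr 2
      apply cyc_congr
      · exact Cycle.coe_eq_coe.mpr List.isRotated_append
      · intro huv
        obtain ⟨rfl, rfl⟩ := List.append_eq_nil_iff.mp huv
        rw [Cycle.chain_coe_cons] at h
        have h1 : tgt s t a = src s t a := by simpa using h
        rw [h1, src_eq_tgt_of_pairing_ne_zero s t hp]
  · rw [pairing_swap a b, neg_smul]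
    by_cases hp : pairing a b = 0
    · simp [hp]
    congr 2
    apply cyc_congr
    · exact Cycle.coe_eq_coe.mpr List.isRotated_append
    · intro h0
      simp at h0

theorem brCyclic_swap (σ : Variant) (p q : CyclicPath s t) :
    brCyclic R s t σ q p = -brCyclic R s t σ p q := by
  have key : ∀ l ∈ p.word.lists, ∀ l' : List (E × Bool),
      brWord R s t σ l' l = -brWord R s t σ l l' := by
    intro l hl l'
    apply brWord_swap
    rw [Cycle.mem_lists_iff_coe_eq] at hl
    rw [hl]
    cases p with
    | const i => exact Cycle.Chain.nil _
    | loop w ne closed => exact closed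
  unfold brCyclic
  rw [Multiset.sum_map_sum_map, ← Multiset.sum_map_neg]
  refine congrArg Multiset.sum (Multiset.map_congr rfl fun l hl => ?_)
  rw [← Multiset.sum_map_neg]
  exact congrArg Multiset.sum (Multiset.map_congr rfl fun l' _ => key l hl l')

theorem br_self [Invertible (2 : R)] (σ : Variant) (x : NecklaceModule R s t) :
    br R s t σ x x = 0 := by
  have h : br R s t σ + (br R s t σ).flip = 0 := by
    ext p q : 4
    simp [br, brCyclic_swap R s t σ p q]
  have h2 : (2 : R) • br R s t σ x x = 0 := by
    simpa [two_smul] using LinearMap.congr_fun₂ h x x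
  simpa using congrArg (fun z => ⅟(2 : R) • z) h2

end Quiver

/-! ## The necklace BV operators

As `2` is invertible, the free supercommutative algebra `S Π 𝒩` on the odd module `Π 𝒩` is the
exterior algebra `⋀ 𝒩`, with its `ℤ/2`-grading `CliffordAlgebra.evenOdd`. -/

section Exterior

variable {R M : Type*} [CommRing R] [AddCommGroup M] [Module R M]

/-- The shifted cobracket `Π M → S² Π M`, `x ↦ ∑ x' x''` for `δ x = ∑ x' ⊗ x''`. -/
noncomputable def shiftedCobr (δ : M →ₗ[R] M ⊗[R] M) : M →ₗ[R] ExteriorAlgebra R M :=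
  TensorProduct.lift ((LinearMap.mul R (ExteriorAlgebra R M)).compl₁₂
    (ExteriorAlgebra.ι R) (ExteriorAlgebra.ι R)) ∘ₗ δ

theorem shiftedCobr_mul_ι (δ : M →ₗ[R] M ⊗[R] M) (m n : M) :
    shiftedCobr δ m * ExteriorAlgebra.ι R n = ExteriorAlgebra.ι R n * shiftedCobr δ m := by
  unfold shiftedCobr
  rw [LinearMap.comp_apply]
  induction δ m using TensorProduct.induction_on with
  | zero => simp
  | add x y hx hy => rw [map_add, add_mul, mul_add, hx, hy]
  | tmul x y =>
    have h : ∀ a b : M, ExteriorAlgebra.ι R a * ExteriorAlgebra.ι R b =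
        -(ExteriorAlgebra.ι R b * ExteriorAlgebra.ι R a) := fun a b =>
      eq_neg_of_add_eq_zero_left (ExteriorAlgebra.ι_add_mul_swap a b)
    simp only [TensorProduct.lift.tmul, LinearMap.compl₁₂_apply, LinearMap.mul_apply']
    rw [mul_assoc, h y n, mul_neg, ← mul_assoc, h x n, neg_mul, neg_neg, mul_assoc]

theorem foldr_one {N : Type*} [AddCommGroup N] [Module R N]
    (f : M →ₗ[R] CliffordAlgebra (0 : QuadraticForm R M) × N →ₗ[R] N)
    (hf : ∀ m x fx, f m (CliffordAlgebra.ι 0 m * x, f m (x, fx)) =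
      (0 : QuadraticForm R M) m • fx) (n : N) : CliffordAlgebra.foldr' 0 f hf n 1 = n := by
  have h := CliffordAlgebra.foldr'_algebraMap 0 f hf n 1
  rwa [map_one, one_smul] at h

/-- The extension of an odd map `δ : Π M → S² Π M` to an odd derivation of `S Π M` (an odd first
order differential operator vanishing on `1`), determined by `cobrOp_one` and `cobrOp_ι_mul`. -/
noncomputable def cobrOp (δ : M →ₗ[R] M ⊗[R] M) : ExteriorAlgebra R M →ₗ[R] ExteriorAlgebra R M :=
  CliffordAlgebra.foldr' 0
    (LinearMap.mk₂ R
      (fun (m : M) (p : ExteriorAlgebra R M × ExteriorAlgebra R M) =>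
        shiftedCobr δ m * p.1 - ExteriorAlgebra.ι R m * p.2)
      (fun m m' p => by simp only [map_add, add_mul]; abel)
      (fun r m p => by simp only [map_smul, smul_mul_assoc, smul_sub])
      (fun m p p' => by simp only [Prod.fst_add, Prod.snd_add, mul_add]; abel)
      (fun r m p => by simp only [Prod.smul_fst, Prod.smul_snd, mul_smul_comm, smul_sub]))
    (fun m x fx => by
      simp only [LinearMap.mk₂_apply, mul_sub, ← mul_assoc, shiftedCobr_mul_ι,
        ExteriorAlgebra.ι_sq_zero]
      simp)
    0

theorem cobrOp_one (δ : M →ₗ[R] M ⊗[R] M) : cobrOp δ 1 = 0 :=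
  foldr_one _ _ _

theorem cobrOp_ι_mul (δ : M →ₗ[R] M ⊗[R] M) (m : M) (x : ExteriorAlgebra R M) :
    cobrOp δ (ExteriorAlgebra.ι R m * x) =
      shiftedCobr δ m * x - ExteriorAlgebra.ι R m * cobrOp δ x :=
  CliffordAlgebra.foldr'_ι_mul _ _ _ _ _ _

/-- For `β : M ⊗ M → M` and `m : M`, the derivation of `S Π M` extending `β(m ⊗ -)`, determined
by `adOp_one` and `adOp_ι_mul`. (As an operator on `S Π M` it is even.) -/
noncomputable def adOp (β : M →ₗ[R] M →ₗ[R] M) :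
    M →ₗ[R] ExteriorAlgebra R M →ₗ[R] ExteriorAlgebra R M :=
  LinearMap.flip <| CliffordAlgebra.foldr' 0
    (LinearMap.mk₂ R
      (fun (n : M) (p : ExteriorAlgebra R M × (M →ₗ[R] ExteriorAlgebra R M)) =>
        LinearMap.mulRight R p.1 ∘ₗ ExteriorAlgebra.ι R ∘ₗ β.flip n +
          LinearMap.mulLeft R (ExteriorAlgebra.ι R n) ∘ₗ p.2)
      (fun n n' p => by ext m; simp [add_mul]; abel)
      (fun r n p => by ext m; simp)
      (fun n p p' => by ext m; simp [mul_add]; abel)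
      (fun r n p => by ext m; simp))
    (fun n x fx => by
      ext m
      have h := ExteriorAlgebra.ι_add_mul_swap (R := R) (β m n) n
      simp only [LinearMap.mk₂_apply, LinearMap.add_apply, LinearMap.comp_apply,
        LinearMap.mulRight_apply, LinearMap.mulLeft_apply, LinearMap.flip_apply, mul_add,
        ← mul_assoc, ExteriorAlgebra.ι_sq_zero, zero_mul, add_zero, ← add_mul, h]
      simp)
    0

theorem adOp_one (β : M →ₗ[R] M →ₗ[R] M) (m : M) : adOp β m 1 = 0 :=
  LinearMap.congr_fun (foldr_one _ _ _) m

theorem adOp_ι_mul (β : M →ₗ[R] M →ₗ[R] M) (m n : M) (x : ExteriorAlgebra R M) :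
    adOp β m (ExteriorAlgebra.ι R n * x) =
      ExteriorAlgebra.ι R (β m n) * x + ExteriorAlgebra.ι R n * adOp β m x :=
  LinearMap.congr_fun (CliffordAlgebra.foldr'_ι_mul _ _ _ _ _ _) m

/-- The extension of an alternating map `β : M ⊗ M → M`, viewed as an odd map `S² Π M → Π M`, to an
odd second order differential operator of `S Π M` vanishing on `1` and on `Π M`. It is determined
by `brOp_one` and `brOp_ι_mul`, which amount to the explicit formula
`x₁ ⋯ xₙ ↦ ∑_{i < j} (-1)^{i + j + 1} β(xᵢ, xⱼ) x₁ ⋯ x̂ᵢ ⋯ x̂ⱼ ⋯ xₙ`. -/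
noncomputable def brOp (β : M →ₗ[R] M →ₗ[R] M) (hβ : ∀ m, β m m = 0) :
    ExteriorAlgebra R M →ₗ[R] ExteriorAlgebra R M :=
  CliffordAlgebra.foldr' 0
    (LinearMap.mk₂ R
      (fun (m : M) (p : ExteriorAlgebra R M × ExteriorAlgebra R M) =>
        adOp β m p.1 - ExteriorAlgebra.ι R m * p.2)
      (fun m m' p => by simp only [map_add, add_mul, LinearMap.add_apply]; abel)
      (fun r m p => by simp only [map_smul, smul_mul_assoc, smul_sub, LinearMap.smul_apply])
      (fun m p p' => by simp only [Prod.fst_add, Prod.snd_add, mul_add, map_add]; abel)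
      (fun r m p => by
        simp only [Prod.smul_fst, Prod.smul_snd, mul_smul_comm, smul_sub, map_smul]))
    (fun m x fx => by
      simp only [LinearMap.mk₂_apply, adOp_ι_mul, hβ, mul_sub, ← mul_assoc,
        ExteriorAlgebra.ι_sq_zero]
      simp)
    0

theorem brOp_one (β : M →ₗ[R] M →ₗ[R] M) (hβ : ∀ m, β m m = 0) : brOp β hβ 1 = 0 :=
  foldr_one _ _ _

theorem brOp_ι_mul (β : M →ₗ[R] M →ₗ[R] M) (hβ : ∀ m, β m m = 0) (m : M)
    (x : ExteriorAlgebra R M) :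
    brOp β hβ (ExteriorAlgebra.ι R m * x) = adOp β m x - ExteriorAlgebra.ι R m * brOp β hβ x :=
  CliffordAlgebra.foldr'_ι_mul _ _ _ _ _ _

theorem brOp_ι_mul_ι (β : M →ₗ[R] M →ₗ[R] M) (hβ : ∀ m, β m m = 0) (m n : M) :
    brOp β hβ (ExteriorAlgebra.ι R m * ExteriorAlgebra.ι R n) = ExteriorAlgebra.ι R (β m n) := by
  have h1 := brOp_ι_mul β hβ n 1
  have h2 := adOp_ι_mul β m n 1
  simp only [mul_one, adOp_one, brOp_one, mul_zero, sub_zero, add_zero] at h1 h2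
  rw [brOp_ι_mul, h1, h2, mul_zero, sub_zero]

end Exterior

/-- The necklace BV operator `Δ^± = 2 br^± - δ^±` on `S Π 𝒩 = ⋀ 𝒩`. -/
noncomputable def necklaceBV {V E : Type*} (R : Type*) [CommRing R] [Invertible (2 : R)]
    (s t : E → V) (σ : Variant) :
    ExteriorAlgebra R (NecklaceModule R s t) →ₗ[R] ExteriorAlgebra R (NecklaceModule R s t) :=
  (2 : R) • brOp (br R s t σ) (br_self R s t σ) - cobrOp (cobr R s t σ)

/-! ## Symmetric monoidal `Π`-categories -/

section Category

variable {C : Type u} [Category.{v} C] [Preadditive C] [MonoidalCategory C] [SymmetricCategory C]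

variable (C) in
/-- A parity structure on a linear symmetric monoidal category: an object `π` whose
self-symmetry is `-id`, with an isomorphism `ξ : π ⊗ π ≅ 1`. -/
structure ParityStructure where
  /-- the object `π` -/
  pi : C
  /-- the self-symmetry of `π` is `-id` -/
  braiding_eq : (β_ pi pi).hom = -𝟙 (pi ⊗ pi)
  /-- the isomorphism `ξ` -/
  xi : pi ⊗ pi ≅ 𝟙_ C

namespace ParityStructure

variable (P : ParityStructure C)

/-- The supermodule of morphisms `X → Y` in the supercategory `C̲`: an even morphism is a morphism
`X ⟶ Y` of `C` (first component), an odd one is a morphism `π ⊗ X ⟶ Y` of `C` (second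
component). -/
abbrev SHom (X Y : C) : Type v := (X ⟶ Y) × (P.pi ⊗ X ⟶ Y)

/-- Composition `g ∘ f` in `C̲`. On homogeneous morphisms it is
`π^(|g| + |f|) ⊗ X ≅ π^|g| ⊗ π^|f| ⊗ X ⟶ π^|g| ⊗ Y ⟶ Z`. -/
def scomp {X Y Z : C} (g : P.SHom Y Z) (f : P.SHom X Y) : P.SHom X Z :=
  (f.1 ≫ g.1 +
      (λ_ X).inv ≫ P.xi.inv ▷ X ≫ (α_ P.pi P.pi X).hom ≫ P.pi ◁ f.2 ≫ g.2,
    P.pi ◁ f.1 ≫ g.2 + f.2 ≫ g.1)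

/-- The superalgebra `C̲(1, A)` of points of a commutative monoid `A`. -/
def Points (A : C) : Type v := P.SHom (𝟙_ C) A

namespace Points

variable {P} {A : C}

instance : AddCommGroup (P.Points A) := inferInstanceAs (AddCommGroup (_ × _))

instance {R : Type*} [CommRing R] [Linear R C] : Module R (P.Points A) :=
  inferInstanceAs (Module R (_ × _))

/-- The even part of a point. -/
def even (f : P.Points A) : 𝟙_ C ⟶ A := f.1

/-- The odd part of a point. -/
def odd (f : P.Points A) : P.pi ⊗ 𝟙_ C ⟶ A := f.2

@[ext]
theorem ext {f g : P.Points A} (h0 : f.even = g.even) (h1 : f.odd = g.odd) : f = g :=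
  Prod.ext h0 h1

theorem even_add (f g : P.Points A) : (f + g).even = f.even + g.even := rfl

theorem odd_add (f g : P.Points A) : (f + g).odd = f.odd + g.odd := rfl

theorem even_zero : (0 : P.Points A).even = 0 := rfl

theorem odd_zero : (0 : P.Points A).odd = 0 := rfl

theorem even_smul {R : Type*} [CommRing R] [Linear R C] (r : R) (f : P.Points A) :
    (r • f).even = r • f.even := rfl

theorem odd_smul {R : Type*} [CommRing R] [Linear R C] (r : R) (f : P.Points A) :
    (r • f).odd = r • f.odd := rfl

variable [MonObj A]

instance : One (P.Points A) := ⟨((MonObj.one : 𝟙_ C ⟶ A), 0)⟩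

/-- The product of two points `f` and `g` is `π^(|f| + |g|) ⊗ 1 ≅ (π^|f| ⊗ 1) ⊗ (π^|g| ⊗ 1) ⟶ A ⊗ A ⟶ A`. -/
instance : Mul (P.Points A) :=
  ⟨fun f g =>
    ((λ_ (𝟙_ C)).inv ≫ (f.even ⊗ₘ g.even) ≫ MonObj.mul +
        P.xi.inv ≫ ((ρ_ P.pi).inv ⊗ₘ (ρ_ P.pi).inv) ≫ (f.odd ⊗ₘ g.odd) ≫ MonObj.mul,
      (λ_ (P.pi ⊗ 𝟙_ C)).inv ≫ (f.even ⊗ₘ g.odd) ≫ MonObj.mul +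
        (ρ_ (P.pi ⊗ 𝟙_ C)).inv ≫ (f.odd ⊗ₘ g.even) ≫ MonObj.mul)⟩

theorem even_mul (f g : P.Points A) : (f * g).even =
    (λ_ (𝟙_ C)).inv ≫ (f.even ⊗ₘ g.even) ≫ MonObj.mul +
      P.xi.inv ≫ ((ρ_ P.pi).inv ⊗ₘ (ρ_ P.pi).inv) ≫ (f.odd ⊗ₘ g.odd) ≫ MonObj.mul := rfl

theorem odd_mul (f g : P.Points A) : (f * g).odd =
    (λ_ (P.pi ⊗ 𝟙_ C)).inv ≫ (f.even ⊗ₘ g.odd) ≫ MonObj.mul +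
      (ρ_ (P.pi ⊗ 𝟙_ C)).inv ≫ (f.odd ⊗ₘ g.even) ≫ MonObj.mul := rfl

theorem even_one : (1 : P.Points A).even = MonObj.one := rfl

theorem odd_one : (1 : P.Points A).odd = 0 := rfl

theorem assoc_aux {W X Y Z U U' : C} (f : X ⟶ A) (g : Y ⟶ A) (h : Z ⟶ A)
    (a : W ⟶ U ⊗ Z) (b : U ⟶ X ⊗ Y) (a' : W ⟶ X ⊗ U') (b' : U' ⟶ Y ⊗ Z)
    (H : a ≫ b ▷ Z ≫ (α_ X Y Z).hom = a' ≫ X ◁ b') :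
    a ≫ ((b ≫ (f ⊗ₘ g) ≫ MonObj.mul) ⊗ₘ h) ≫ MonObj.mul =
      a' ≫ (f ⊗ₘ (b' ≫ (g ⊗ₘ h) ≫ MonObj.mul)) ≫ MonObj.mul := by
  have e1 : ((b ≫ (f ⊗ₘ g) ≫ (MonObj.mul : A ⊗ A ⟶ A)) ⊗ₘ h) =
      b ▷ Z ≫ ((f ⊗ₘ g) ⊗ₘ h) ≫ MonObj.mul ▷ A := by
    simp only [← MonoidalCategory.tensorHom_id, tensorHom_comp_tensorHom, Category.comp_id,
      Category.id_comp]
  have e2 : (f ⊗ₘ (b' ≫ (g ⊗ₘ h) ≫ (MonObj.mul : A ⊗ A ⟶ A))) =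
      X ◁ b' ≫ (f ⊗ₘ (g ⊗ₘ h)) ≫ A ◁ MonObj.mul := by
    simp only [← MonoidalCategory.id_tensorHom, tensorHom_comp_tensorHom, Category.comp_id,
      Category.id_comp]
  rw [e1, e2]
  simp only [Category.assoc, MonObj.mul_assoc]
  rw [associator_naturality_assoc, reassoc_of% H]

variable [MonoidalPreadditive C]

theorem xi_assoc :
    P.xi.hom ▷ P.pi ≫ (λ_ P.pi).hom =
      (α_ P.pi P.pi P.pi).hom ≫ P.pi ◁ P.xi.hom ≫ (ρ_ P.pi).hom := by
  have h1 : P.pi ◁ P.xi.hom ≫ (ρ_ P.pi).hom =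
      (β_ P.pi (P.pi ⊗ P.pi)).hom ≫ P.xi.hom ▷ P.pi ≫ (λ_ P.pi).hom := by
    rw [← BraidedCategory.braiding_naturality_right_assoc, braiding_leftUnitor]
  rw [h1, BraidedCategory.braiding_tensor_right_hom, P.braiding_eq]
  have h2 : (-𝟙 (P.pi ⊗ P.pi)) ▷ P.pi = -𝟙 _ := by
    rw [eq_neg_iff_add_eq_zero, ← id_whiskerRight (P.pi ⊗ P.pi) P.pi, ← MonoidalPreadditive.add_whiskerRight]
    simp
  have h3 : P.pi ◁ (-𝟙 (P.pi ⊗ P.pi)) = -𝟙 _ := by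
    rw [eq_neg_iff_add_eq_zero, ← whiskerLeft_id P.pi (P.pi ⊗ P.pi), ← MonoidalPreadditive.whiskerLeft_add]
    simp
  rw [h2, h3]
  simp

theorem xi_inv_assoc :
    (λ_ (P.pi ⊗ 𝟙_ C)).inv ≫ (P.xi.inv ≫ ((ρ_ P.pi).inv ⊗ₘ (ρ_ P.pi).inv)) ▷ (P.pi ⊗ 𝟙_ C) ≫
        (α_ (P.pi ⊗ 𝟙_ C) (P.pi ⊗ 𝟙_ C) (P.pi ⊗ 𝟙_ C)).hom =
      (ρ_ (P.pi ⊗ 𝟙_ C)).inv ≫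
        (P.pi ⊗ 𝟙_ C) ◁ (P.xi.inv ≫ ((ρ_ P.pi).inv ⊗ₘ (ρ_ P.pi).inv)) := by
  have h : (λ_ P.pi).inv ≫ P.xi.inv ▷ P.pi ≫ (α_ P.pi P.pi P.pi).hom =
      (ρ_ P.pi).inv ≫ P.pi ◁ P.xi.inv := by
    have h1 := xi_assoc (P := P)
    rw [← cancel_epi (P.xi.hom ▷ P.pi ≫ (λ_ P.pi).hom)]
    nth_rewrite 2 [h1]
    simp [← MonoidalCategory.whiskerLeft_comp]
  have e1 : (λ_ (P.pi ⊗ 𝟙_ C)).inv ≫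
      (P.xi.inv ≫ ((ρ_ P.pi).inv ⊗ₘ (ρ_ P.pi).inv)) ▷ (P.pi ⊗ 𝟙_ C) ≫
        (α_ (P.pi ⊗ 𝟙_ C) (P.pi ⊗ 𝟙_ C) (P.pi ⊗ 𝟙_ C)).hom =
      (ρ_ P.pi).hom ≫ ((λ_ P.pi).inv ≫ P.xi.inv ▷ P.pi ≫ (α_ P.pi P.pi P.pi).hom) ≫
        ((ρ_ P.pi).inv ⊗ₘ ((ρ_ P.pi).inv ⊗ₘ (ρ_ P.pi).inv)) := by
    monoidal
  rw [e1, h]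
  monoidal

instance : Ring (P.Points A) :=
  { (inferInstance : AddCommGroup (P.Points A)) with
    mul := (· * ·)
    one := 1
    left_distrib := fun f g h => by
      ext <;>
        simp only [even_mul, odd_mul, even_add, odd_add, MonoidalPreadditive.tensor_add,
          Preadditive.comp_add, Preadditive.add_comp] <;> abel
    right_distrib := fun f g h => by
      ext <;>
        simp only [even_mul, odd_mul, even_add, odd_add, MonoidalPreadditive.add_tensor,
          Preadditive.comp_add, Preadditive.add_comp] <;> abel
    zero_mul := fun f => by
      ext <;> simp [even_mul, odd_mul, even_zero, odd_zero]
    mul_zero := fun f => by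
      ext <;> simp [even_mul, odd_mul, even_zero, odd_zero]
    one_mul := fun f => by
      ext <;> simp [even_mul, odd_mul, even_one, odd_one, MonoidalCategory.tensorHom_def']
    mul_one := fun f => by
      ext <;> simp [even_mul, odd_mul, even_one, odd_one, MonoidalCategory.tensorHom_def,
        ← unitors_equal]
    mul_assoc := fun f g h => by
      have h000 := assoc_aux f.even g.even h.even (λ_ (𝟙_ C)).inv (λ_ (𝟙_ C)).inv
        (λ_ (𝟙_ C)).inv (λ_ (𝟙_ C)).inv (by monoidal)
      have h110 := assoc_aux f.odd g.odd h.even (λ_ (𝟙_ C)).inv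
        (P.xi.inv ≫ ((ρ_ P.pi).inv ⊗ₘ (ρ_ P.pi).inv))
        (P.xi.inv ≫ ((ρ_ P.pi).inv ⊗ₘ (ρ_ P.pi).inv)) (ρ_ (P.pi ⊗ 𝟙_ C)).inv (by monoidal)
      have h101 := assoc_aux f.odd g.even h.odd
        (P.xi.inv ≫ ((ρ_ P.pi).inv ⊗ₘ (ρ_ P.pi).inv)) (ρ_ (P.pi ⊗ 𝟙_ C)).inv
        (P.xi.inv ≫ ((ρ_ P.pi).inv ⊗ₘ (ρ_ P.pi).inv)) (λ_ (P.pi ⊗ 𝟙_ C)).inv (by monoidal)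
      have h011 := assoc_aux f.even g.odd h.odd
        (P.xi.inv ≫ ((ρ_ P.pi).inv ⊗ₘ (ρ_ P.pi).inv)) (λ_ (P.pi ⊗ 𝟙_ C)).inv
        (λ_ (𝟙_ C)).inv (P.xi.inv ≫ ((ρ_ P.pi).inv ⊗ₘ (ρ_ P.pi).inv)) (by monoidal)
      have h001 := assoc_aux f.even g.even h.odd
        (λ_ (P.pi ⊗ 𝟙_ C)).inv (λ_ (𝟙_ C)).inv
        (λ_ (P.pi ⊗ 𝟙_ C)).inv (λ_ (P.pi ⊗ 𝟙_ C)).inv (by monoidal)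
      have h010 := assoc_aux f.even g.odd h.even
        (ρ_ (P.pi ⊗ 𝟙_ C)).inv (λ_ (P.pi ⊗ 𝟙_ C)).inv
        (λ_ (P.pi ⊗ 𝟙_ C)).inv (ρ_ (P.pi ⊗ 𝟙_ C)).inv (by monoidal)
      have h100 := assoc_aux f.odd g.even h.even
        (ρ_ (P.pi ⊗ 𝟙_ C)).inv (ρ_ (P.pi ⊗ 𝟙_ C)).inv
        (ρ_ (P.pi ⊗ 𝟙_ C)).inv (λ_ (𝟙_ C)).inv (by monoidal)
      have h111 := assoc_aux f.odd g.odd h.odd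
        (λ_ (P.pi ⊗ 𝟙_ C)).inv (P.xi.inv ≫ ((ρ_ P.pi).inv ⊗ₘ (ρ_ P.pi).inv))
        (ρ_ (P.pi ⊗ 𝟙_ C)).inv (P.xi.inv ≫ ((ρ_ P.pi).inv ⊗ₘ (ρ_ P.pi).inv))
        xi_inv_assoc
      simp only [Category.assoc] at h000 h110 h101 h011 h001 h010 h100 h111
      ext <;>
        simp only [even_mul, odd_mul, MonoidalPreadditive.tensor_add,
          MonoidalPreadditive.add_tensor, Preadditive.comp_add, Preadditive.add_comp,
          h000, h110, h101, h011, h001, h010, h100, h111] <;> abel }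

instance {R : Type*} [CommRing R] [Linear R C] [MonoidalLinear R C] : Algebra R (P.Points A) :=
  Algebra.ofModule
    (fun r f g => by
      ext <;> simp [even_mul, odd_mul, even_smul, odd_smul, MonoidalCategory.tensorHom_def])
    (fun r f g => by
      ext <;> simp [even_mul, odd_mul, even_smul, odd_smul, MonoidalCategory.tensorHom_def])

end Points

end ParityStructure

/-! ## Free commutative monoids and differential operators -/

/-- `j : x ⟶ S` exhibits the commutative monoid `S` as the free commutative monoid on `x`: it is
initial among morphisms from `x` to commutative monoids. -/
def IsFreeCommMon {x S : C} [MonObj S] [IsCommMonObj S] (j : x ⟶ S) : Prop :=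
  ∀ (B : C) [MonObj B] [IsCommMonObj B] (f : x ⟶ B), ∃! g : S ⟶ B, IsMonHom g ∧ j ≫ g = f

/-- The (graded) commutator with multiplication by a new variable: on elements,
`(T f)(b, x, y) = f(b, x y) - x f(b, y)`, where in the last term the symmetry is used to move `x`
past the parameters `b`. -/
def diffT {A B : C} [MonObj A] (f : B ⊗ A ⟶ A) : (B ⊗ A) ⊗ A ⟶ A :=
  (α_ B A A).hom ≫ B ◁ MonObj.mul ≫ f -
    (β_ B A).hom ▷ A ≫ (α_ A B A).hom ≫ A ◁ f ≫ MonObj.mul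

/-- `T^(k+1) f = 0`. For `B = π`, this says that the odd morphism `f : A → A` is a differential
operator of order (at most) `k` on the commutative monoid `A`. -/
def IsDiffOp {A : C} [MonObj A] : ℕ → ∀ {B : C}, (B ⊗ A ⟶ A) → Prop
  | 0, _, f => diffT f = 0
  | k + 1, _, f => IsDiffOp k (diffT f)

/-! ## The representation side -/

/-- A dualisable object together with an odd involution. -/
structure DualisableWithInvolution (P : ParityStructure C) where
  /-- the object `c` -/
  obj : C
  /-- its dual `c^∨` -/
  dual : C
  /-- the duality data `1 ⟶ c ⊗ c^∨` and `c^∨ ⊗ c ⟶ 1` -/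
  pairing : ExactPairing obj dual
  /-- the odd involution `ι : π ⊗ c ⟶ c` -/
  inv : P.pi ⊗ obj ⟶ obj
  /-- `ι² = id` in `C̲` -/
  inv_sq : P.scomp ((0, inv) : P.SHom obj obj) ((0, inv) : P.SHom obj obj) = (𝟙 obj, 0)

namespace DualisableWithInvolution

variable {P : ParityStructure C}

/-- The coevaluation `1 ⟶ c ⊗ c^∨`. -/
def coev (x : DualisableWithInvolution P) : 𝟙_ C ⟶ x.obj ⊗ x.dual :=
  x.pairing.coevaluation'

/-- The evaluation `c^∨ ⊗ c ⟶ 1`. -/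
def ev (x : DualisableWithInvolution P) : x.dual ⊗ x.obj ⟶ 𝟙_ C :=
  x.pairing.evaluation'

/-- The dual `ι^∨ : π ⊗ c^∨ ⟶ c^∨` of the odd involution:
`π ⊗ c^∨ ≅ c^∨ ⊗ π ⟶ c^∨ ⊗ π ⊗ c ⊗ c^∨ ⟶ c^∨ ⊗ c ⊗ c^∨ ⟶ c^∨`. -/
def dualInv (x : DualisableWithInvolution P) : P.pi ⊗ x.dual ⟶ x.dual :=
  (β_ P.pi x.dual).hom ≫ (ρ_ (x.dual ⊗ P.pi)).inv ≫ (x.dual ⊗ P.pi) ◁ x.coev ≫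
    (α_ x.dual P.pi (x.obj ⊗ x.dual)).hom ≫ x.dual ◁ (α_ P.pi x.obj x.dual).inv ≫
      x.dual ◁ (x.inv ▷ x.dual) ≫ (α_ x.dual x.obj x.dual).inv ≫ x.ev ▷ x.dual ≫ (λ_ x.dual).hom

/-- The object `x ⊗ y^∨`. -/
abbrev hom (x y : DualisableWithInvolution P) : C := x.obj ⊗ y.dual

/-- `ι` inserted on the first strand of `x ⊗ y^∨`. -/
def invLeft (x y : DualisableWithInvolution P) : P.pi ⊗ hom x y ⟶ hom x y :=
  (α_ P.pi x.obj y.dual).inv ≫ x.inv ▷ y.dual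

/-- `ι^∨` inserted on the second strand of `x ⊗ y^∨`. -/
def invRight (x y : DualisableWithInvolution P) : P.pi ⊗ hom x y ⟶ hom x y :=
  (α_ P.pi x.obj y.dual).inv ≫ (β_ P.pi x.obj).hom ▷ y.dual ≫ (α_ x.obj P.pi y.dual).hom ≫
    x.obj ◁ y.dualInv

/-- The odd chord on `x ⊗ y^∨` directed from the second strand to the first one: `ι` inserted on
the first strand minus `ι^∨` inserted on the second strand. -/
def chord (x y : DualisableWithInvolution P) : P.pi ⊗ hom x y ⟶ hom x y :=
  invLeft x y - invRight x y

/-- Insertion of the strand `1 ⟶ z ⊗ z^∨ ≅ z^∨ ⊗ z` in the middle of `x ⊗ y^∨`. -/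
def split (x z y : DualisableWithInvolution P) : hom x y ⟶ hom x z ⊗ hom z y :=
  x.obj ◁ ((λ_ y.dual).inv ≫ (z.coev ≫ (β_ z.obj z.dual).hom) ▷ y.dual ≫
    (α_ z.dual z.obj y.dual).hom) ≫ (α_ x.obj z.dual (z.obj ⊗ y.dual)).inv

end DualisableWithInvolution

open DualisableWithInvolution

variable [HasColimits C] {P : ParityStructure C} {V E : Type*} (s t : E → V)
  (c : V → DualisableWithInvolution P)

/-- `h̃_a^∨`, the coequaliser of the two actions of `π` on `h_a^∨ = c_{s(a)} ⊗ c_{t(a)}^∨`. -/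
noncomputable def hTildeArrow (a : E × Bool) : C :=
  coequalizer (invLeft (c (src s t a)) (c (tgt s t a))) (invRight (c (src s t a)) (c (tgt s t a)))

/-- `h̃^∨`, the direct sum of the `h̃_a^∨` over all arrows `a` of the double quiver. -/
noncomputable def hTilde [Finite E] : C := ∐ fun a : E × Bool => hTildeArrow s t c a

variable [Finite E] {S : C} (j : hTilde s t c ⟶ S)

/-- The morphism `h_a^∨ ⟶ h̃_a^∨ ⟶ h̃^∨ ⟶ S`. -/
noncomputable def coord (a : E × Bool) : hom (c (src s t a)) (c (tgt s t a)) ⟶ S :=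
  coequalizer.π (invLeft (c (src s t a)) (c (tgt s t a)))
      (invRight (c (src s t a)) (c (tgt s t a))) ≫
    Sigma.ι (fun a : E × Bool => hTildeArrow s t c a) a ≫ j

variable [MonObj S]

open Classical in
/-- The morphism `c_i ⊗ c_k^∨ ⟶ S` attached to a path `a₁ ⋯ aₙ` from `i` to `k`:
`c_i ⊗ c_k^∨ ⟶ h_{a₁}^∨ ⊗ ⋯ ⊗ h_{aₙ}^∨ ⟶ S`, where the first morphism inserts coevaluations
`1 ⟶ c^∨ ⊗ c` at the inner vertices of the path. For the constant path it is the evaluation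
`c_i ⊗ c_i^∨ ≅ c_i^∨ ⊗ c_i ⟶ 1` followed by the unit of `S`. (The value is `0` if the word is not
a path from `i` to `k`.) -/
noncomputable def pathMap : ∀ (i : V) (_ : List (E × Bool)) (k : V), hom (c i) (c k) ⟶ S
  | i, [], k =>
      if h : i = k then
        eqToHom (by rw [h]) ≫ (β_ (c k).obj (c k).dual).hom ≫ (c k).ev ≫ MonObj.one
      else 0
  | i, a :: w, k =>
      if h : i = src s t a then
        eqToHom (by rw [h]) ≫ split (c (src s t a)) (c (tgt s t a)) (c k) ≫
          (coord s t c j a ⊗ₘ pathMap (tgt s t a) w k) ≫ MonObj.mul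
      else 0

/-- The odd trace of a closed path `w` based at the vertex `i`, an odd element of `C̲(1, S)`:
`π ⟶ π ⊗ c_i ⊗ c_i^∨ ⟶ c_i ⊗ c_i^∨ ⟶ S`, where the second morphism is `ι_i ⊗ id`. -/
noncomputable def oddTrace (i : V) (w : List (E × Bool)) : P.Points S :=
  ((0, P.pi ◁ (c i).coev ≫ invLeft (c i) (c i) ≫ pathMap s t c j i w i) : P.SHom (𝟙_ C) S)

/-- The symmetry exchanging the second and the fourth factor of a fourfold tensor product. -/
def swap₂₄ (X Y Z W : C) : (X ⊗ Y) ⊗ (Z ⊗ W) ⟶ (X ⊗ W) ⊗ (Z ⊗ Y) :=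
  (α_ X Y (Z ⊗ W)).hom ≫ X ◁ (β_ Y (Z ⊗ W)).hom ≫ X ◁ ((β_ Z W).hom ▷ Y) ≫
    X ◁ (α_ W Z Y).hom ≫ (α_ X W (Z ⊗ Y)).inv

/-- The `ab`-component `π ⊗ h_a^∨ ⊗ h_b^∨ ⟶ S` of `φ^±`. Up to the factor `⟨a, b⟩` and the chord,
for `a` and `b` in involution,
`φ^-` connects the strands `c_{s(a)}`, `c_{t(b)}^∨` and the strands `c_{s(b)}`, `c_{t(a)}^∨` by
evaluations, while `φ^+` maps to `h_a^∨ ⊗ h_b^∨ ⊗ h_b^∨ ⊗ h_a^∨` by inserting coevaluations,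
`c_{s(a)} ⊗ c_{t(b)}^∨ ⟶ h_a^∨ ⊗ h_b^∨` and `c_{s(b)} ⊗ c_{t(a)}^∨ ⟶ h_b^∨ ⊗ h_a^∨`. -/
noncomputable def phi : Variant → ∀ a b : E × Bool,
    P.pi ⊗ (hom (c (src s t a)) (c (tgt s t a)) ⊗ hom (c (src s t b)) (c (tgt s t b))) ⟶ S
  | .minus, a, b => pairing a b • ((α_ _ _ _).inv ≫
      chord (c (src s t a)) (c (tgt s t a)) ▷ hom (c (src s t b)) (c (tgt s t b)) ≫
      swap₂₄ _ _ _ _ ≫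
      (pathMap s t c j (src s t a) [] (tgt s t b) ⊗ₘ
        pathMap s t c j (src s t b) [] (tgt s t a)) ≫ MonObj.mul)
  | .plus, a, b => pairing a b • ((α_ _ _ _).inv ≫
      chord (c (src s t a)) (c (tgt s t a)) ▷ hom (c (src s t b)) (c (tgt s t b)) ≫
      swap₂₄ _ _ _ _ ≫
      (pathMap s t c j (src s t a) [a, b] (tgt s t b) ⊗ₘ
        pathMap s t c j (src s t b) [b, a] (tgt s t a)) ≫ MonObj.mul)

/-- `D : π ⊗ S ⟶ S` is the odd second order differential operator on `S` which vanishes on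
`S^{≤ 1} h̃^∨` and restricts to `φ^±` on `S² h̃^∨`. -/
structure IsRepresentationBV (σ : Variant) (D : P.pi ⊗ S ⟶ S) : Prop where
  order : IsDiffOp 2 D
  unit : P.pi ◁ MonObj.one ≫ D = 0
  linear : P.pi ◁ j ≫ D = 0
  quadratic : ∀ a b : E × Bool,
    P.pi ◁ ((coord s t c j a ⊗ₘ coord s t c j b) ≫ MonObj.mul) ≫ D = phi s t c j σ a b

end Category

end Necklace

/-!
The proof computes with generalised elements. For a cocommutative comonoid `Γ` of the category, the
elements `El Γ X` of an object `X` are the morphisms `Γ ⟶ X`. The comultiplication of `Γ` pairs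
elements, so that the elements of a commutative monoid form a commutative ring. The comonoid
`1 ⊞ Z` with `Z` primitive carries a generic element of `Z`, and tensor products of such comonoids
carry generic tuples; hence a morphism out of a tensor product is determined by its values on tuples
of elements (`hom_ext₂` and its variants), and identities of morphisms can be checked like
identities of multilinear maps. Signs enter only through `pr b c = -pr c b` for elements of `π`.
A coevaluation `1 ⟶ x ⊗ x^∨` becomes a contraction `contr` over a pair of variables.

Odd traces. By its definition, `h̃^∨` makes the coordinate functions of the arrows invariant under
the odd involutions, and an involution slides through a contraction (`contr_slide`). Therefore the
function of a path is invariant (`pathEl_oddInv`), and the odd trace of a closed path does not change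
under rotation (`otrEl_append_comm`). By the same argument the trace without an involution vanishes:
write it with two odd parameters and slide one involution around the loop; the parameters are
exchanged, and the trace equals its negative (`contr_pathEl_eq_zero`).

Existence and uniqueness of the operators. A derivation of the free commutative monoid `S` into a
module `M`, up to a symmetric 2-cocycle with values in `M`, is the same as a section `S ⟶ S ⊞ M` of
the extension of `S` by `M` given by the cocycle, so the universal property of `S` gives existence
and uniqueness for prescribed values on the generators (`ModuleCocycle.existsUnique_isTwisted`). With
the zero cocycle this yields biderivations with prescribed values (`exists_biderivation`). A second
order operator `D` vanishing on `1` has a biderivation as its bracket `D(xy) - x D(y) - D(x) y`;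
conversely a biderivation is itself a cocycle, and the derivations up to it are the operators sought
(`exists_isDiffOp_two`, `eq_of_isDiffOp_two`). It remains to see that the maps `φ_{ab}` descend to a
symmetric map on `h̃^∨ ⊗ h̃^∨` (`exists_phi_desc`).

The intertwining relation. The bracket of `D` is a derivation in each argument, and on coordinate
functions it is `φ`. Expanding along a path and around a closed path, the difference of two terms in
`φ` becomes twice one term, since both arise from the same opened path with two odd involutions that
occur in opposite order. So the bracket of two odd traces is twice the odd trace of their necklace
bracket (`IsRepresentationBV.bracket_otrEl`). The value of `D` on an odd trace is computed by peeling
off one arrow after the other; the terms in which an even trace splits off vanish, and the other ones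
add up to the necklace cobracket (`IsRepresentationBV.ap_otrEl`). On the side of the quiver the sums
over positions of cyclic words are rewritten as sums over decompositions of words (`sum_map_lists`,
`decSum_decSum_append`). Finally `D` on a product of odd elements is determined by the bracket and by
its values on the factors, in the same way as the necklace operator, and an induction on the number
of factors finishes the proof (`IsRepresentationBV.otrHom_necklaceBV`).
-/

namespace Necklace

/-! ### Generalised elements -/

section Elements

open scoped ComonObj MonObj
open DualisableWithInvolution

set_option linter.unusedSectionVars false

variable {C : Type u} [Category.{v} C] [MonoidalCategory C] [SymmetricCategory C]

/-- The generalised elements of an object `X`, parametrised by a cocommutative comonoid `Γ`. -/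
def El (Γ : CommComon C) (X : C) : Type v := Γ.X ⟶ X

variable {Γ Θ Ξ : CommComon C} {V W X Y Z X' Y' A B : C}

/-- The morphism underlying a generalised element. -/
def El.hom (x : El Γ X) : Γ.X ⟶ X := x

/-- A morphism out of the context, regarded as a generalised element. -/
def El.mk (x : Γ.X ⟶ X) : El Γ X := x

@[simp] theorem El.hom_mk (x : Γ.X ⟶ X) : (El.mk x : El Γ X).hom = x := rfl

theorem El.ext {x y : El Γ X} (h : x.hom = y.hom) : x = y := h

/-- The image of a generalised element under a morphism. -/
def ap (f : X ⟶ Y) (x : El Γ X) : El Γ Y := El.mk (x.hom ≫ f)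

/-- The pair of two generalised elements, an element of the tensor product. -/
def pr (x : El Γ X) (y : El Γ Y) : El Γ (X ⊗ Y) := El.mk (Δ[Γ.X] ≫ (x.hom ⊗ₘ y.hom))

@[simp] theorem ap_id (x : El Γ X) : ap (𝟙 X) x = x := Category.comp_id _

theorem ap_comp (f : X ⟶ Y) (g : Y ⟶ Z) (x : El Γ X) : ap (f ≫ g) x = ap g (ap f x) :=
  (Category.assoc _ _ _).symm

@[simp] theorem ap_hom_inv (e : X ≅ Y) (x : El Γ X) : ap e.inv (ap e.hom x) = x := by
  rw [← ap_comp, e.hom_inv_id, ap_id]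

@[simp] theorem ap_inv_hom (e : X ≅ Y) (y : El Γ Y) : ap e.hom (ap e.inv y) = y := by
  rw [← ap_comp, e.inv_hom_id, ap_id]

@[simp] theorem ap_tensorHom (f : X ⟶ X') (g : Y ⟶ Y') (x : El Γ X) (y : El Γ Y) :
    ap (f ⊗ₘ g) (pr x y) = pr (ap f x) (ap g y) := by
  simp [ap, pr, tensorHom_comp_tensorHom]

@[simp] theorem ap_whiskerLeft (g : Y ⟶ Y') (x : El Γ X) (y : El Γ Y) :
    ap (X ◁ g) (pr x y) = pr x (ap g y) := by
  simp [ap, pr, ← id_tensorHom, tensorHom_comp_tensorHom]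

@[simp] theorem ap_whiskerRight (f : X ⟶ X') (x : El Γ X) (y : El Γ Y) :
    ap (f ▷ Y) (pr x y) = pr (ap f x) y := by
  simp [ap, pr, ← tensorHom_id, tensorHom_comp_tensorHom]

@[simp] theorem ap_assoc_hom (x : El Γ X) (y : El Γ Y) (z : El Γ Z) :
    ap (α_ X Y Z).hom (pr (pr x y) z) = pr x (pr y z) := by
  have e1 : ((Δ[Γ.X] ≫ (x.hom ⊗ₘ y.hom)) ⊗ₘ z.hom) =
      Δ[Γ.X] ▷ Γ.X ≫ ((x.hom ⊗ₘ y.hom) ⊗ₘ z.hom) := by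
    rw [← tensorHom_id, tensorHom_comp_tensorHom, Category.id_comp]
  have e2 : (x.hom ⊗ₘ (Δ[Γ.X] ≫ (y.hom ⊗ₘ z.hom))) =
      Γ.X ◁ Δ[Γ.X] ≫ (x.hom ⊗ₘ (y.hom ⊗ₘ z.hom)) := by
    rw [← id_tensorHom, tensorHom_comp_tensorHom, Category.id_comp]
  apply El.ext
  simp only [ap, pr, El.hom_mk, e1, e2, Category.assoc, associator_naturality,
    ComonObj.comul_assoc_assoc]

@[simp] theorem ap_assoc_inv (x : El Γ X) (y : El Γ Y) (z : El Γ Z) :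
    ap (α_ X Y Z).inv (pr x (pr y z)) = pr (pr x y) z := by
  rw [← ap_assoc_hom, ap_hom_inv]

@[simp] theorem ap_braiding (x : El Γ X) (y : El Γ Y) :
    ap (β_ X Y).hom (pr x y) = pr y x := by
  simp [ap, pr, BraidedCategory.braiding_naturality]

instance : One (El Γ (𝟙_ C)) := ⟨ε[Γ.X]⟩

@[simp] theorem ap_leftUnitor_inv (x : El Γ X) : ap (λ_ X).inv x = pr 1 x :=
  (ComonObj.counit_comul_hom _).symm

@[simp] theorem ap_rightUnitor_inv (x : El Γ X) : ap (ρ_ X).inv x = pr x 1 :=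
  (ComonObj.comul_counit_hom _).symm

instance : SMul (El Γ (𝟙_ C)) (El Γ X) := ⟨fun s x => ap (λ_ X).hom (pr s x)⟩

@[simp] theorem ap_leftUnitor (s : El Γ (𝟙_ C)) (x : El Γ X) :
    ap (λ_ X).hom (pr s x) = s • x := rfl

@[simp] theorem ap_rightUnitor (s : El Γ (𝟙_ C)) (x : El Γ X) :
    ap (ρ_ X).hom (pr x s) = s • x := by
  rw [← ap_leftUnitor, ← ap_braiding x s, ← ap_comp, braiding_leftUnitor]

theorem ap_smul (f : X ⟶ Y) (s : El Γ (𝟙_ C)) (x : El Γ X) : ap f (s • x) = s • ap f x := by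
  rw [← ap_leftUnitor, ← ap_leftUnitor, ← ap_comp, ← leftUnitor_naturality, ap_comp,
    ap_whiskerLeft]

theorem pr_smul_left (s : El Γ (𝟙_ C)) (x : El Γ X) (y : El Γ Y) :
    pr (s • x) y = s • pr x y := by
  rw [← ap_leftUnitor, ← ap_whiskerRight, ← ap_assoc_inv, ← ap_leftUnitor, ← ap_comp,
    leftUnitor_tensor_hom]

theorem pr_smul_right (s : El Γ (𝟙_ C)) (x : El Γ X) (y : El Γ Y) :
    pr x (s • y) = s • pr x y := by
  rw [← ap_braiding, pr_smul_left, ap_smul, ap_braiding]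

section Additive

variable [Preadditive C]

instance : AddCommGroup (El Γ X) := inferInstanceAs (AddCommGroup (Γ.X ⟶ X))

theorem ap_add (f : X ⟶ Y) (x y : El Γ X) : ap f (x + y) = ap f x + ap f y :=
  Preadditive.add_comp _ _ _ _ _ _

@[simp] theorem ap_zero (f : X ⟶ Y) : ap f (0 : El Γ X) = 0 := zero_comp

/-- `ap` as a homomorphism in the element. -/
def apHom (f : X ⟶ Y) : El Γ X →+ El Γ Y := AddMonoidHom.mk' (ap f) (ap_add f)

theorem ap_neg (f : X ⟶ Y) (x : El Γ X) : ap f (-x) = -ap f x := map_neg (apHom f) x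

theorem ap_sub (f : X ⟶ Y) (x y : El Γ X) : ap f (x - y) = ap f x - ap f y :=
  map_sub (apHom f) x y

theorem ap_zsmul (f : X ⟶ Y) (n : ℤ) (x : El Γ X) : ap f (n • x) = n • ap f x :=
  map_zsmul (apHom f) n x

theorem add_ap (f g : X ⟶ Y) (x : El Γ X) : ap (f + g) x = ap f x + ap g x :=
  Preadditive.comp_add _ _ _ _ _ _

theorem sub_ap (f g : X ⟶ Y) (x : El Γ X) : ap (f - g) x = ap f x - ap g x :=
  Preadditive.comp_sub _ _ _

theorem neg_ap (f : X ⟶ Y) (x : El Γ X) : ap (-f) x = -ap f x :=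
  Preadditive.comp_neg _ _

@[simp] theorem zero_ap (x : El Γ X) : ap (0 : X ⟶ Y) x = 0 := comp_zero

theorem zsmul_ap (n : ℤ) (f : X ⟶ Y) (x : El Γ X) : ap (n • f) x = n • ap f x :=
  Preadditive.comp_zsmul _ _ _

variable [MonoidalPreadditive C]

theorem pr_add_left (x x' : El Γ X) (y : El Γ Y) : pr (x + x') y = pr x y + pr x' y :=
  (congrArg (Δ[Γ.X] ≫ ·) (MonoidalPreadditive.add_tensor _ _ _)).trans
    (Preadditive.comp_add _ _ _ _ _ _)

theorem pr_add_right (x : El Γ X) (y y' : El Γ Y) : pr x (y + y') = pr x y + pr x y' :=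
  (congrArg (Δ[Γ.X] ≫ ·) (MonoidalPreadditive.tensor_add _ _ _)).trans
    (Preadditive.comp_add _ _ _ _ _ _)

/-- `pr` as a homomorphism in the first argument. -/
def prHomLeft (y : El Γ Y) : El Γ X →+ El Γ (X ⊗ Y) :=
  AddMonoidHom.mk' (fun x => pr x y) fun x x' => pr_add_left x x' y

/-- `pr` as a homomorphism in the second argument. -/
def prHomRight (x : El Γ X) : El Γ Y →+ El Γ (X ⊗ Y) :=
  AddMonoidHom.mk' (fun y => pr x y) fun y y' => pr_add_right x y y'

@[simp] theorem pr_zero_left (y : El Γ Y) : pr (0 : El Γ X) y = 0 := map_zero (prHomLeft y)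

@[simp] theorem pr_zero_right (x : El Γ X) : pr x (0 : El Γ Y) = 0 := map_zero (prHomRight x)

theorem pr_neg_left (x : El Γ X) (y : El Γ Y) : pr (-x) y = -pr x y := map_neg (prHomLeft y) x

theorem pr_neg_right (x : El Γ X) (y : El Γ Y) : pr x (-y) = -pr x y := map_neg (prHomRight x) y

theorem pr_sub_left (x x' : El Γ X) (y : El Γ Y) : pr (x - x') y = pr x y - pr x' y :=
  map_sub (prHomLeft y) x x'

theorem pr_sub_right (x : El Γ X) (y y' : El Γ Y) : pr x (y - y') = pr x y - pr x y' :=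
  map_sub (prHomRight x) y y'

theorem pr_zsmul_right (n : ℤ) (x : El Γ X) (y : El Γ Y) : pr x (n • y) = n • pr x y :=
  map_zsmul (prHomRight x) n y

/-- The generalised elements of a commutative monoid form a commutative ring. -/
instance (S : C) [MonObj S] [IsCommMonObj S] : CommRing (El Γ S) :=
  { (inferInstance : AddCommGroup (El Γ S)) with
    mul := fun x y => ap μ[S] (pr x y)
    one := ap η[S] 1
    left_distrib := fun x y z => (congrArg (ap μ[S]) (pr_add_right x y z)).trans (ap_add _ _ _)
    right_distrib := fun x y z => (congrArg (ap μ[S]) (pr_add_left x y z)).trans (ap_add _ _ _)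
    zero_mul := fun x => (congrArg (ap μ[S]) (pr_zero_left x)).trans (ap_zero _)
    mul_zero := fun x => (congrArg (ap μ[S]) (pr_zero_right x)).trans (ap_zero _)
    mul_assoc := fun x y z => by
      change ap μ[S] (pr (ap μ[S] (pr x y)) z) = ap μ[S] (pr x (ap μ[S] (pr y z)))
      rw [← ap_whiskerRight, ← ap_whiskerLeft, ← ap_comp, ← ap_comp, MonObj.mul_assoc, ap_comp,
        ap_assoc_hom, ap_comp]
    one_mul := fun x => by
      change ap μ[S] (pr (ap η[S] 1) x) = x
      rw [← ap_whiskerRight, ← ap_comp, MonObj.one_mul, ← ap_leftUnitor_inv, ap_inv_hom]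
    mul_one := fun x => by
      change ap μ[S] (pr x (ap η[S] 1)) = x
      rw [← ap_whiskerLeft, ← ap_comp, MonObj.mul_one, ← ap_rightUnitor_inv, ap_inv_hom]
    mul_comm := fun x y => by
      change ap μ[S] (pr x y) = ap μ[S] (pr y x)
      rw [← ap_braiding y x, ← ap_comp, IsCommMonObj.mul_comm] }

section Ring

variable {S : C} [MonObj S] [IsCommMonObj S]

@[simp] theorem ap_mul (x y : El Γ S) : ap μ[S] (pr x y) = x * y := rfl

@[simp] theorem ap_one : ap η[S] (1 : El Γ (𝟙_ C)) = 1 := rfl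

theorem ap_unit (s : El Γ (𝟙_ C)) : ap η[S] s = s • (1 : El Γ S) := by
  rw [← ap_one, ← ap_smul]
  congr 1
  rw [← ap_rightUnitor, ← ap_leftUnitor_inv, unitors_equal.symm, ap_inv_hom]

@[simp] theorem smul_mul_el (s : El Γ (𝟙_ C)) (x y : El Γ S) : s • x * y = s • (x * y) := by
  rw [← ap_mul, pr_smul_left, ap_smul, ap_mul]

@[simp] theorem mul_smul_el (s : El Γ (𝟙_ C)) (x y : El Γ S) : x * s • y = s • (x * y) := by
  rw [← ap_mul, pr_smul_right, ap_smul, ap_mul]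

end Ring

@[simp] theorem one_smul_el (x : El Γ X) : (1 : El Γ (𝟙_ C)) • x = x := by
  rw [← ap_leftUnitor, ← ap_leftUnitor_inv, ap_inv_hom]

theorem smul_smul_comm (s t : El Γ (𝟙_ C)) (x : El Γ X) : s • t • x = t • s • x := by
  rw [← ap_leftUnitor t x, ← ap_smul, ← pr_smul_right, ap_leftUnitor]

theorem smul_smul_el (s t : El Γ (𝟙_ C)) (x : El Γ X) : s • t • x = (s • t) • x := by
  rw [← ap_leftUnitor t x, ← ap_smul, ← pr_smul_left, ap_leftUnitor]

theorem smul_add_el (s : El Γ (𝟙_ C)) (x y : El Γ X) : s • (x + y) = s • x + s • y := by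
  simp only [← ap_leftUnitor, pr_add_right, ap_add]

theorem smul_neg_el (s : El Γ (𝟙_ C)) (x : El Γ X) : s • (-x) = -(s • x) := by
  simp only [← ap_leftUnitor, pr_neg_right, ap_neg]

theorem smul_sub_el (s : El Γ (𝟙_ C)) (x y : El Γ X) : s • (x - y) = s • x - s • y := by
  simp only [← ap_leftUnitor, pr_sub_right, ap_sub]

theorem smul_zero_el (s : El Γ (𝟙_ C)) : s • (0 : El Γ X) = 0 := by
  simp only [← ap_leftUnitor, pr_zero_right, ap_zero]

theorem neg_smul_el (s : El Γ (𝟙_ C)) (x : El Γ X) : (-s) • x = -(s • x) := by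
  simp only [← ap_leftUnitor, pr_neg_left, ap_neg]

theorem smul_zsmul_el (n : ℤ) (s : El Γ (𝟙_ C)) (x : El Γ X) : s • n • x = n • s • x := by
  simp only [← ap_leftUnitor, pr_zsmul_right, ap_zsmul]

end Additive

/-! ### Substitutions and generic elements -/

/-- A morphism of contexts. -/
structure Sub (Γ Θ : CommComon C) where
  /-- the underlying morphism of comonoids -/
  hom : Γ.X ⟶ Θ.X
  hom_counit : hom ≫ ε[Θ.X] = ε[Γ.X]
  hom_comul : hom ≫ Δ[Θ.X] = Δ[Γ.X] ≫ (hom ⊗ₘ hom)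

/-- Substitution in a generalised element. -/
def sb (σ : Sub Γ Θ) (x : El Θ X) : El Γ X := El.mk (σ.hom ≫ x.hom)

@[simp] theorem sb_ap (σ : Sub Γ Θ) (f : X ⟶ Y) (x : El Θ X) :
    sb σ (ap f x) = ap f (sb σ x) := (Category.assoc _ _ _).symm

@[simp] theorem sb_pr (σ : Sub Γ Θ) (x : El Θ X) (y : El Θ Y) :
    sb σ (pr x y) = pr (sb σ x) (sb σ y) := by
  simp [sb, pr, reassoc_of% σ.hom_comul, tensorHom_comp_tensorHom]

@[simp] theorem sb_unit (σ : Sub Γ Θ) : sb σ (1 : El Θ (𝟙_ C)) = 1 := σ.hom_counit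

@[simp] theorem sb_smul (σ : Sub Γ Θ) (s : El Θ (𝟙_ C)) (x : El Θ X) :
    sb σ (s • x) = sb σ s • sb σ x := by
  rw [← ap_leftUnitor, sb_ap, sb_pr, ap_leftUnitor]

/-- The product of two contexts. -/
abbrev prodCtx (Γ Θ : CommComon C) : CommComon C := ⟨Γ.X ⊗ Θ.X⟩

/-- Morphisms of comonoids are morphisms of contexts. -/
def Sub.ofComon (f : Γ.toComon ⟶ Θ.toComon) : Sub Γ Θ where
  hom := f.hom
  hom_counit := IsComonHom.hom_counit f.hom
  hom_comul := IsComonHom.hom_comul f.hom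

/-- The counit of a comonoid, as a morphism to the unit of the category of comonoids. -/
def counitHom (Θ : CommComon C) : Θ.toComon ⟶ 𝟙_ (Comon C) where
  hom := ε[Θ.X]
  isComonHom_hom := (default : Θ.toComon ⟶ Comon.trivial C).isComonHom_hom

/-- The first projection of a product of contexts. -/
def fstSub (Γ Θ : CommComon C) : Sub (prodCtx Γ Θ) Γ :=
  Sub.ofComon (Γ.toComon ◁ counitHom Θ ≫ (ρ_ Γ.toComon).hom :
    Γ.toComon ⊗ Θ.toComon ⟶ Γ.toComon)

theorem fstSub_hom (Γ Θ : CommComon C) :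
    (fstSub Γ Θ).hom = Γ.X ◁ ε[Θ.X] ≫ (ρ_ Γ.X).hom := by
  simp only [fstSub, Sub.ofComon, counitHom, Comon.comp_hom', Comon.monoidal_whiskerLeft_hom,
    Comon.monoidal_rightUnitor_hom_hom]
  change Γ.X ◁ ε[Θ.X] ≫ Γ.X ◁ 𝟙 (𝟙_ C) ≫ (ρ_ Γ.X).hom = _
  simp

/-- The second projection of a product of contexts. -/
def sndSub (Γ Θ : CommComon C) : Sub (prodCtx Γ Θ) Θ :=
  Sub.ofComon (counitHom Γ ▷ Θ.toComon ≫ (λ_ Θ.toComon).hom :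
    Γ.toComon ⊗ Θ.toComon ⟶ Θ.toComon)

theorem sndSub_hom (Γ Θ : CommComon C) :
    (sndSub Γ Θ).hom = ε[Γ.X] ▷ Θ.X ≫ (λ_ Θ.X).hom := by
  simp only [sndSub, Sub.ofComon, counitHom, Comon.comp_hom', Comon.monoidal_whiskerRight_hom,
    Comon.monoidal_leftUnitor_hom_hom]
  change ε[Γ.X] ▷ Θ.X ≫ 𝟙 (𝟙_ C) ▷ Θ.X ≫ (λ_ Θ.X).hom = _
  simp

theorem pr_fst_snd (x : El Γ X) (y : El Θ Y) :
    pr (sb (fstSub Γ Θ) x) (sb (sndSub Γ Θ) y) = El.mk (x.hom ⊗ₘ y.hom) := by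
  apply El.ext
  have h : Δ[Γ.X ⊗ Θ.X] ≫ ((Γ.X ◁ ε[Θ.X] ≫ (ρ_ Γ.X).hom) ⊗ₘ (ε[Γ.X] ▷ Θ.X ≫ (λ_ Θ.X).hom)) =
      𝟙 _ := by
    have e : (β_ (𝟙_ C) (𝟙_ C)).hom = 𝟙 _ := by
      rw [braiding_tensorUnit_left, unitors_equal, Iso.hom_inv_id]
    have e' : tensorμ Γ.X (𝟙_ C) (𝟙_ C) Θ.X ≫ ((ρ_ Γ.X).hom ⊗ₘ (λ_ Θ.X).hom) =
        (ρ_ Γ.X).hom ⊗ₘ (λ_ Θ.X).hom := by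
      simp only [tensorμ, e]
      monoidal
    rw [Comon.tensorObj_comul, ← tensorHom_comp_tensorHom, ← id_tensorHom, ← tensorHom_id,
      Category.assoc, ← tensorμ_natural_assoc, e', tensorHom_comp_tensorHom_assoc,
      id_tensorHom, tensorHom_id, ComonObj.comul_counit, ComonObj.counit_comul,
      tensorHom_comp_tensorHom]
    simp
  simp only [pr, sb, El.hom_mk, fstSub_hom, sndSub_hom]
  rw [← tensorHom_comp_tensorHom, reassoc_of% h]

section Generic

variable [Preadditive C] [MonoidalPreadditive C] [HasBinaryBiproducts C]

/-- The comonoid `1 ⊕ Z` in which `Z` is primitive. -/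
@[reducible]
noncomputable def varComon (Z : C) : ComonObj (𝟙_ C ⊞ Z) where
  counit := biprod.fst
  comul := biprod.desc ((λ_ (𝟙_ C)).inv ≫ (biprod.inl ⊗ₘ biprod.inl))
    ((λ_ Z).inv ≫ (biprod.inl ⊗ₘ biprod.inr) + (ρ_ Z).inv ≫ (biprod.inr ⊗ₘ biprod.inl))
  counit_comul := by
    ext <;> simp [← tensorHom_id, tensorHom_comp_tensorHom]
  comul_counit := by
    ext <;> simp [← id_tensorHom, tensorHom_comp_tensorHom, unitors_inv_equal]
  comul_assoc := by
    ext
    · simp only [← id_tensorHom, ← tensorHom_id, tensorHom_comp_tensorHom, Category.assoc,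
        biprod.inl_desc_assoc, biprod.inl_desc, tensorHom_comp_tensorHom_assoc, Category.comp_id]
      monoidal
    · simp only [← id_tensorHom, ← tensorHom_id, tensorHom_comp_tensorHom, Category.assoc,
        biprod.inl_desc, tensorHom_comp_tensorHom_assoc, Category.comp_id, biprod.inr_desc,
        biprod.inr_desc_assoc, Preadditive.add_comp, MonoidalPreadditive.tensor_add,
        MonoidalPreadditive.add_tensor, Preadditive.comp_add]
      rw [add_assoc]
      congr 1
      · monoidal
      · congr 1 <;> monoidal

/-- The context of a variable in the object `Z`. -/
noncomputable abbrev varCtx (Z : C) : CommComon C :=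
  letI := varComon Z
  { X := 𝟙_ C ⊞ Z
    comon := varComon Z
    comm := ⟨by
      change biprod.desc _ _ ≫ _ = biprod.desc _ _
      ext
      · simp [BraidedCategory.braiding_naturality, unitors_inv_equal]
      · simp [BraidedCategory.braiding_naturality, braiding_tensorUnit_left,
          braiding_tensorUnit_right, add_comm]⟩ }

/-- The generic element of `Z` in the context of a variable in `Z`. -/
noncomputable def var (Z : C) : El (varCtx Z) Z := El.mk biprod.snd

theorem inr_var (Z : C) : (biprod.inr : Z ⟶ 𝟙_ C ⊞ Z) ≫ (var Z).hom = 𝟙 Z := by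
  simp [var]

/-- An element with a section is generic: morphisms with the same value on it are equal. -/
theorem El.eq_of_section {i : X ⟶ Γ.X} {x : El Γ X} (h : i ≫ x.hom = 𝟙 X) {F G : X ⟶ A}
    (e : ap F x = ap G x) : F = G := by
  have := congrArg (fun y => i ≫ y.hom) e
  simpa [ap, reassoc_of% h] using this

/-- Morphisms agreeing on all generalised elements of the form `(x, y)` are equal. -/
theorem hom_ext₂ {F G : X ⊗ Y ⟶ A} (h : ∀ (Γ : CommComon C) (x : El Γ X) (y : El Γ Y),
    ap F (pr x y) = ap G (pr x y)) : F = G := by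
  refine El.eq_of_section (i := biprod.inr ⊗ₘ biprod.inr)
    (x := pr (sb (fstSub _ _) (var X)) (sb (sndSub _ _) (var Y))) ?_ (h _ _ _)
  simp [pr_fst_snd, tensorHom_comp_tensorHom, inr_var]

theorem hom_ext₃ {F G : X ⊗ (Y ⊗ Z) ⟶ A}
    (h : ∀ (Γ : CommComon C) (x : El Γ X) (y : El Γ Y) (z : El Γ Z),
      ap F (pr x (pr y z)) = ap G (pr x (pr y z))) : F = G := by
  refine El.eq_of_section (i := biprod.inr ⊗ₘ (biprod.inr ⊗ₘ biprod.inr))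
    (x := pr (sb (fstSub _ _) (var X)) (sb (sndSub _ _)
      (pr (sb (fstSub _ _) (var Y)) (sb (sndSub _ _) (var Z))))) ?_
      (by simpa only [sb_pr] using h _ _ _ _)
  simp [pr_fst_snd, tensorHom_comp_tensorHom, inr_var]

theorem hom_ext₄ {F G : W ⊗ (X ⊗ (Y ⊗ Z)) ⟶ A}
    (h : ∀ (Γ : CommComon C) (w : El Γ W) (x : El Γ X) (y : El Γ Y) (z : El Γ Z),
      ap F (pr w (pr x (pr y z))) = ap G (pr w (pr x (pr y z)))) : F = G := by
  refine El.eq_of_section (i := biprod.inr ⊗ₘ (biprod.inr ⊗ₘ (biprod.inr ⊗ₘ biprod.inr)))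
    (x := pr (sb (fstSub _ _) (var W)) (sb (sndSub _ _) (pr (sb (fstSub _ _) (var X))
      (sb (sndSub _ _) (pr (sb (fstSub _ _) (var Y)) (sb (sndSub _ _) (var Z))))))) ?_
      (by simpa only [sb_pr] using h _ _ _ _ _)
  simp [pr_fst_snd, tensorHom_comp_tensorHom, inr_var]

theorem hom_ext₃' {F G : (X ⊗ Y) ⊗ Z ⟶ A}
    (h : ∀ (Γ : CommComon C) (x : El Γ X) (y : El Γ Y) (z : El Γ Z),
      ap F (pr (pr x y) z) = ap G (pr (pr x y) z)) : F = G := by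
  rw [← cancel_epi (α_ X Y Z).inv]
  exact hom_ext₃ fun Γ x y z => by simpa [ap_comp] using h Γ x y z

theorem hom_ext₄' {F G : ((W ⊗ X) ⊗ Y) ⊗ Z ⟶ A}
    (h : ∀ (Γ : CommComon C) (w : El Γ W) (x : El Γ X) (y : El Γ Y) (z : El Γ Z),
      ap F (pr (pr (pr w x) y) z) = ap G (pr (pr (pr w x) y) z)) : F = G := by
  rw [← cancel_epi (α_ (W ⊗ X) Y Z).inv, ← cancel_epi (α_ W X (Y ⊗ Z)).inv]
  exact hom_ext₄ fun Γ w x y z => by simpa [ap_comp] using h Γ w x y z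

theorem hom_ext₅ {F G : (((V ⊗ W) ⊗ X) ⊗ Y) ⊗ Z ⟶ A}
    (h : ∀ (Γ : CommComon C) (v : El Γ V) (w : El Γ W) (x : El Γ X) (y : El Γ Y) (z : El Γ Z),
      ap F (pr (pr (pr (pr v w) x) y) z) = ap G (pr (pr (pr (pr v w) x) y) z)) : F = G := by
  refine El.eq_of_section
    (i := (((biprod.inr ⊗ₘ biprod.inr) ⊗ₘ biprod.inr) ⊗ₘ biprod.inr) ⊗ₘ biprod.inr)
    (x := pr (sb (fstSub _ _) (pr (sb (fstSub _ _) (pr (sb (fstSub _ _) (pr (sb (fstSub _ _) (var V))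
      (sb (sndSub _ _) (var W)))) (sb (sndSub _ _) (var X)))) (sb (sndSub _ _) (var Y))))
        (sb (sndSub _ _) (var Z))) ?_ (by simpa only [sb_pr] using h _ _ _ _ _ _)
  simp [pr_fst_snd, tensorHom_comp_tensorHom, inr_var]

theorem hom_ext₂₂ {F G : (X ⊗ Y) ⊗ (Z ⊗ W) ⟶ A}
    (h : ∀ (Γ : CommComon C) (x : El Γ X) (y : El Γ Y) (z : El Γ Z) (w : El Γ W),
      ap F (pr (pr x y) (pr z w)) = ap G (pr (pr x y) (pr z w))) : F = G := by
  rw [← cancel_epi (α_ X Y (Z ⊗ W)).inv]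
  exact hom_ext₄ fun Γ x y z w => by simpa [ap_comp] using h Γ x y z w

theorem hom_ext₁₂₂ {F G : V ⊗ ((W ⊗ X) ⊗ (Y ⊗ Z)) ⟶ A}
    (h : ∀ (Γ : CommComon C) (v : El Γ V) (w : El Γ W) (x : El Γ X) (y : El Γ Y) (z : El Γ Z),
      ap F (pr v (pr (pr w x) (pr y z))) = ap G (pr v (pr (pr w x) (pr y z)))) : F = G := by
  rw [← cancel_epi (α_ V (W ⊗ X) (Y ⊗ Z)).hom, ← cancel_epi ((α_ V W X).hom ▷ (Y ⊗ Z)),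
    ← cancel_epi (α_ ((V ⊗ W) ⊗ X) Y Z).hom]
  exact hom_ext₅ fun Γ v w x y z => by simpa [ap_comp] using h Γ v w x y z

theorem hom_ext₃₃ {U : C} {F G : (U ⊗ (V ⊗ W)) ⊗ (X ⊗ (Y ⊗ Z)) ⟶ A}
    (h : ∀ (Γ : CommComon C) (u : El Γ U) (v : El Γ V) (w : El Γ W) (x : El Γ X) (y : El Γ Y)
      (z : El Γ Z), ap F (pr (pr u (pr v w)) (pr x (pr y z))) =
        ap G (pr (pr u (pr v w)) (pr x (pr y z)))) : F = G := by
  refine El.eq_of_section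
    (i := (biprod.inr ⊗ₘ (biprod.inr ⊗ₘ biprod.inr)) ⊗ₘ (biprod.inr ⊗ₘ (biprod.inr ⊗ₘ biprod.inr)))
    (x := pr (sb (fstSub _ _) (pr (sb (fstSub _ _) (var U)) (sb (sndSub _ _)
        (pr (sb (fstSub _ _) (var V)) (sb (sndSub _ _) (var W))))))
      (sb (sndSub _ _) (pr (sb (fstSub _ _) (var X)) (sb (sndSub _ _)
        (pr (sb (fstSub _ _) (var Y)) (sb (sndSub _ _) (var Z))))))) ?_
    (by simpa only [sb_pr] using h _ _ _ _ _ _ _)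
  simp [pr_fst_snd, tensorHom_comp_tensorHom, inr_var]

end Generic

/-! ### Integration over a variable -/

section Integral

variable [Preadditive C] [MonoidalPreadditive C]

/-- The context `Γ`, extended by the variables of the context `Λ`, is integrated to `Γ` along a
functional `k : 1 ⟶ Λ`. -/
noncomputable def integ {Λ : CommComon C} (k : 𝟙_ C ⟶ Λ.X) (Φ : El (prodCtx Γ Λ) X) : El Γ X :=
  El.mk ((ρ_ Γ.X).inv ≫ Γ.X ◁ k ≫ Φ.hom)

section

variable {Λ : CommComon C} (k : 𝟙_ C ⟶ Λ.X)

theorem integ_ap (f : X ⟶ Y) (Φ : El (prodCtx Γ Λ) X) :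
    integ k (ap f Φ) = ap f (integ k Φ) := by
  simp [integ, ap]

/-- Integration as a homomorphism. -/
noncomputable def integHom : El (prodCtx Γ Λ) X →+ El Γ X :=
  AddMonoidHom.mk' (integ k) fun Φ Ψ => by
    apply El.ext
    change (ρ_ Γ.X).inv ≫ Γ.X ◁ k ≫ (Φ.hom + Ψ.hom) =
      (ρ_ Γ.X).inv ≫ Γ.X ◁ k ≫ Φ.hom + (ρ_ Γ.X).inv ≫ Γ.X ◁ k ≫ Ψ.hom
    simp

theorem integ_add (Φ Ψ : El (prodCtx Γ Λ) X) : integ k (Φ + Ψ) = integ k Φ + integ k Ψ :=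
  map_add (integHom k) Φ Ψ

theorem integ_sub (Φ Ψ : El (prodCtx Γ Λ) X) : integ k (Φ - Ψ) = integ k Φ - integ k Ψ :=
  map_sub (integHom k) Φ Ψ

theorem integ_neg (Φ : El (prodCtx Γ Λ) X) : integ k (-Φ) = -integ k Φ :=
  map_neg (integHom k) Φ

theorem integ_zero : integ k (0 : El (prodCtx Γ Λ) X) = 0 :=
  map_zero (integHom k)

theorem integ_zsmul (n : ℤ) (Φ : El (prodCtx Γ Λ) X) : integ k (n • Φ) = n • integ k Φ :=
  map_zsmul (integHom k) n Φ

theorem integ_pr_left (x : El Γ X) (Φ : El (prodCtx Γ Λ) Y) :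
    integ k (pr (sb (fstSub Γ Λ) x) Φ) = pr x (integ k Φ) := by
  have e : pr (sb (fstSub Γ Λ) x) Φ = ap (X ◁ Φ.hom) (ap (α_ _ _ _).hom
      (El.mk ((Δ[Γ.X] ≫ (x.hom ⊗ₘ 𝟙 _)) ⊗ₘ 𝟙 _))) := by
    have e0 : Φ = ap Φ.hom (pr (sb (fstSub Γ Λ) (El.mk (𝟙 _)))
        (sb (sndSub Γ Λ) (El.mk (𝟙 _)))) := by
      rw [pr_fst_snd]
      apply El.ext
      simp [ap]
    have e1 := pr_fst_snd (pr x (El.mk (𝟙 _) : El Γ Γ.X)) (El.mk (𝟙 _) : El Λ Λ.X)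
    rw [sb_pr] at e1
    conv_lhs => rw [e0]
    rw [← ap_whiskerLeft, ← ap_assoc_hom, e1]
    rfl
  rw [e]
  apply El.ext
  simp only [integ, ap, pr, El.hom_mk, Category.assoc]
  simp only [← id_tensorHom, tensorHom_comp_tensorHom_assoc, Category.comp_id,
    Category.id_comp]
  have h1 : (Δ[Γ.X] ≫ (x.hom ⊗ₘ 𝟙 Γ.X)) ⊗ₘ k =
    (Δ[Γ.X] ≫ (x.hom ⊗ₘ 𝟙 Γ.X)) ▷ 𝟙_ C ≫ (X ⊗ Γ.X) ◁ k := by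
    rw [← id_tensorHom, ← tensorHom_id, tensorHom_comp_tensorHom]; simp
  have h2 : x.hom ⊗ₘ ((ρ_ Γ.X).inv ≫ (𝟙 Γ.X ⊗ₘ k) ≫ Φ.hom) =
    (x.hom ⊗ₘ 𝟙 _) ≫ X ◁ (ρ_ Γ.X).inv ≫ X ◁ (Γ.X ◁ k) ≫ X ◁ Φ.hom := by
    simp only [← id_tensorHom, tensorHom_comp_tensorHom, Category.comp_id, Category.id_comp]
  rw [h1, h2]
  simp

theorem integ_pr_right (x : El Γ X) (Φ : El (prodCtx Γ Λ) Y) :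
    integ k (pr Φ (sb (fstSub Γ Λ) x)) = pr (integ k Φ) x := by
  rw [← ap_braiding, integ_ap, integ_pr_left, ap_braiding]

theorem integ_smul_left (x : El Γ (𝟙_ C)) (Φ : El (prodCtx Γ Λ) Y) :
    integ k (sb (fstSub Γ Λ) x • Φ) = x • integ k Φ := by
  rw [← ap_leftUnitor, integ_ap, integ_pr_left, ap_leftUnitor]

theorem integ_snd (x : El Λ X) :
    integ k (sb (sndSub Γ Λ) x) = ap (k ≫ x.hom) 1 := by
  apply El.ext
  simp only [integ, sb, ap, sndSub_hom, El.hom_mk]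
  change _ = ε[Γ.X] ≫ _
  rw [Category.assoc, whisker_exchange_assoc]
  rw [← rightUnitor_inv_naturality_assoc, ← unitors_inv_equal, leftUnitor_naturality_assoc,
    Iso.inv_hom_id_assoc]

variable {S : C} [MonObj S] [IsCommMonObj S]

theorem integ_mul_left (x : El Γ S) (Φ : El (prodCtx Γ Λ) S) :
    integ k (sb (fstSub Γ Λ) x * Φ) = x * integ k Φ := by
  rw [← ap_mul, integ_ap, integ_pr_left, ap_mul]

theorem integ_mul_right (x : El Γ S) (Φ : El (prodCtx Γ Λ) S) :
    integ k (Φ * sb (fstSub Γ Λ) x) = integ k Φ * x := by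
  rw [← ap_mul, integ_ap, integ_pr_right, ap_mul]

@[simp] theorem sb_mul (σ : Sub Γ Θ) (x y : El Θ S) : sb σ (x * y) = sb σ x * sb σ y := by
  rw [← ap_mul, sb_ap, sb_pr, ap_mul]

end

variable [HasBinaryBiproducts C]

theorem tensorμ_braiding (X Y Z W : C) :
    tensorμ X Y Z W ≫ ((β_ X Z).hom ⊗ₘ (β_ Y W).hom) =
      (β_ (X ⊗ Y) (Z ⊗ W)).hom ≫ tensorμ Z W X Y :=
  hom_ext₂₂ fun Γ x y z w => by simp [tensorμ, ap_comp]

/-- The symmetry of two comonoids. -/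
def braidHom (Λ Λ' : CommComon C) : Λ.toComon ⊗ Λ'.toComon ⟶ Λ'.toComon ⊗ Λ.toComon :=
  have h1 : (β_ Λ.X Λ'.X).hom ≫ (ε[Λ'.X] ⊗ₘ ε[Λ.X]) ≫ (λ_ (𝟙_ C)).hom =
      (ε[Λ.X] ⊗ₘ ε[Λ'.X]) ≫ (λ_ (𝟙_ C)).hom := by
    rw [← BraidedCategory.braiding_naturality_assoc, braiding_leftUnitor, unitors_equal]
  have h2 : (β_ Λ.X Λ'.X).hom ≫ Δ[Λ'.X ⊗ Λ.X] =
      Δ[Λ.X ⊗ Λ'.X] ≫ ((β_ Λ.X Λ'.X).hom ⊗ₘ (β_ Λ.X Λ'.X).hom) := by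
    rw [Comon.tensorObj_comul, Comon.tensorObj_comul, ← BraidedCategory.braiding_naturality_assoc,
      Category.assoc, tensorμ_braiding]
  { hom := (β_ Λ.X Λ'.X).hom
    isComonHom_hom := { hom_counit := h1, hom_comul := h2 } }

/-- The exchange of two context extensions. -/
def swapSub (Γ Λ Λ' : CommComon C) :
    Sub (prodCtx (prodCtx Γ Λ') Λ) (prodCtx (prodCtx Γ Λ) Λ') :=
  Sub.ofComon ((α_ Γ.toComon Λ'.toComon Λ.toComon).hom ≫ Γ.toComon ◁ braidHom Λ' Λ ≫
    (α_ Γ.toComon Λ.toComon Λ'.toComon).inv :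
      (Γ.toComon ⊗ Λ'.toComon) ⊗ Λ.toComon ⟶ (Γ.toComon ⊗ Λ.toComon) ⊗ Λ'.toComon)

theorem swapSub_hom (Γ Λ Λ' : CommComon C) : (swapSub Γ Λ Λ').hom =
    (α_ Γ.X Λ'.X Λ.X).hom ≫ Γ.X ◁ (β_ Λ'.X Λ.X).hom ≫ (α_ Γ.X Λ.X Λ'.X).inv := by
  simp only [swapSub, Sub.ofComon, braidHom, Comon.comp_hom', Comon.monoidal_whiskerLeft_hom,
    Comon.monoidal_associator_hom_hom, Comon.monoidal_associator_inv_hom]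
  change (𝟙 _ ▷ _ ≫ _ ≫ _ ◁ 𝟙 _) ≫ _ ≫ _ ◁ 𝟙 _ ≫ _ ≫ 𝟙 _ ▷ _ = _
  simp only [id_whiskerRight, MonoidalCategory.whiskerLeft_id, Category.id_comp, Category.assoc]
  exact congrArg (fun f => _ ≫ _ ≫ f) (Category.comp_id _)

@[simp] theorem sb_swapSub_fst_fst (Λ Λ' : CommComon C) (x : El Γ X) :
    sb (swapSub Γ Λ Λ') (sb (fstSub _ _) (sb (fstSub _ _) x)) =
      sb (fstSub _ _) (sb (fstSub _ _) x) := by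
  have h : (α_ Γ.X Λ'.X Λ.X).hom ≫ Γ.X ◁ (β_ Λ'.X Λ.X).hom ≫ (α_ Γ.X Λ.X Λ'.X).inv ≫
      (Γ.X ⊗ Λ.X) ◁ ε[Λ'.X] ≫ (ρ_ (Γ.X ⊗ Λ.X)).hom ≫ Γ.X ◁ ε[Λ.X] ≫ (ρ_ Γ.X).hom =
      (Γ.X ⊗ Λ'.X) ◁ ε[Λ.X] ≫ (ρ_ (Γ.X ⊗ Λ'.X)).hom ≫ Γ.X ◁ ε[Λ'.X] ≫ (ρ_ Γ.X).hom :=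
    hom_ext₃' fun Ξ x y z => by
      simp only [ap_comp, ap_assoc_hom, ap_whiskerLeft, ap_braiding, ap_assoc_inv,
        ap_rightUnitor, ap_smul]
      exact smul_smul_comm _ _ _
  apply El.ext
  simp only [sb, swapSub_hom, fstSub_hom, El.hom_mk, Category.assoc]
  exact (reassoc_of% h) x.hom

@[simp] theorem sb_swapSub_fst_snd (Λ Λ' : CommComon C) (x : El Λ X) :
    sb (swapSub Γ Λ Λ') (sb (fstSub _ _) (sb (sndSub _ _) x)) = sb (sndSub _ _) x := by
  have h : (α_ Γ.X Λ'.X Λ.X).hom ≫ Γ.X ◁ (β_ Λ'.X Λ.X).hom ≫ (α_ Γ.X Λ.X Λ'.X).inv ≫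
      (Γ.X ⊗ Λ.X) ◁ ε[Λ'.X] ≫ (ρ_ (Γ.X ⊗ Λ.X)).hom ≫ ε[Γ.X] ▷ Λ.X ≫ (λ_ Λ.X).hom =
      ((ε[Γ.X] ⊗ₘ ε[Λ'.X]) ≫ (λ_ (𝟙_ C)).hom) ▷ Λ.X ≫ (λ_ Λ.X).hom :=
    hom_ext₃' fun Ξ x y z => by
      simp only [ap_comp, ap_assoc_hom, ap_whiskerLeft, ap_whiskerRight, ap_braiding, ap_assoc_inv,
        ap_rightUnitor, ap_smul, ap_tensorHom, ap_leftUnitor]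
      rw [smul_smul_comm, smul_smul_el]
  apply El.ext
  simp only [sb, swapSub_hom, fstSub_hom, sndSub_hom, El.hom_mk, Category.assoc]
  exact (reassoc_of% h) x.hom

@[simp] theorem sb_swapSub_snd (Λ Λ' : CommComon C) (x : El Λ' X) :
    sb (swapSub Γ Λ Λ') (sb (sndSub _ _) x) = sb (fstSub _ _) (sb (sndSub _ _) x) := by
  have h : (α_ Γ.X Λ'.X Λ.X).hom ≫ Γ.X ◁ (β_ Λ'.X Λ.X).hom ≫ (α_ Γ.X Λ.X Λ'.X).inv ≫
      ((ε[Γ.X] ⊗ₘ ε[Λ.X]) ≫ (λ_ (𝟙_ C)).hom) ▷ Λ'.X ≫ (λ_ Λ'.X).hom =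
      (Γ.X ⊗ Λ'.X) ◁ ε[Λ.X] ≫ (ρ_ (Γ.X ⊗ Λ'.X)).hom ≫ ε[Γ.X] ▷ Λ'.X ≫ (λ_ Λ'.X).hom :=
    hom_ext₃' fun Ξ x y z => by
      simp only [ap_comp, ap_assoc_hom, ap_whiskerLeft, ap_whiskerRight, ap_braiding, ap_assoc_inv,
        ap_rightUnitor, ap_smul, ap_tensorHom, ap_leftUnitor]
      rw [smul_smul_comm, smul_smul_el]
  apply El.ext
  simp only [sb, swapSub_hom, fstSub_hom, sndSub_hom, El.hom_mk, Category.assoc]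
  exact (reassoc_of% h) x.hom

/-- Integrations over independent variables commute. -/
theorem integ_integ {Λ Λ' : CommComon C} (k : 𝟙_ C ⟶ Λ.X) (l : 𝟙_ C ⟶ Λ'.X)
    (Φ : El (prodCtx (prodCtx Γ Λ) Λ') X) :
    integ k (integ l Φ) = integ l (integ k (sb (swapSub Γ Λ Λ') Φ)) := by
  have h : (ρ_ Γ.X).inv ≫ Γ.X ◁ k ≫ (ρ_ (Γ.X ⊗ Λ.X)).inv ≫ (Γ.X ⊗ Λ.X) ◁ l =
      (ρ_ Γ.X).inv ≫ Γ.X ◁ l ≫ (ρ_ (Γ.X ⊗ Λ'.X)).inv ≫ (Γ.X ⊗ Λ'.X) ◁ k ≫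
        (α_ Γ.X Λ'.X Λ.X).hom ≫ Γ.X ◁ (β_ Λ'.X Λ.X).hom ≫ (α_ Γ.X Λ.X Λ'.X).inv := by
    have e := BraidedCategory.braiding_naturality l k
    have e1 : (ρ_ Γ.X).inv ≫ Γ.X ◁ l ≫ (ρ_ (Γ.X ⊗ Λ'.X)).inv ≫ (Γ.X ⊗ Λ'.X) ◁ k ≫
        (α_ Γ.X Λ'.X Λ.X).hom = (ρ_ Γ.X).inv ≫ Γ.X ◁ ((ρ_ (𝟙_ C)).inv ≫ (l ⊗ₘ k)) := by
      rw [MonoidalCategory.tensorHom_def]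
      monoidal
    have e2 : (ρ_ Γ.X).inv ≫ Γ.X ◁ k ≫ (ρ_ (Γ.X ⊗ Λ.X)).inv ≫ (Γ.X ⊗ Λ.X) ◁ l =
        (ρ_ Γ.X).inv ≫ Γ.X ◁ ((ρ_ (𝟙_ C)).inv ≫ (k ⊗ₘ l)) ≫ (α_ Γ.X Λ.X Λ'.X).inv := by
      rw [MonoidalCategory.tensorHom_def]
      monoidal
    have e3 : (β_ (𝟙_ C) (𝟙_ C)).hom = 𝟙 _ := by
      rw [braiding_tensorUnit_left, unitors_equal, Iso.hom_inv_id]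
    rw [e3, Category.id_comp] at e
    have e4 : (ρ_ (𝟙_ C)).inv ≫ (k ⊗ₘ l) = ((ρ_ (𝟙_ C)).inv ≫ (l ⊗ₘ k)) ≫ (β_ Λ'.X Λ.X).hom := by
      rw [Category.assoc, e]
    rw [e2, e4, MonoidalCategory.whiskerLeft_comp, Category.assoc, ← reassoc_of% e1]
  apply El.ext
  simp only [integ, sb, El.hom_mk, swapSub_hom, Category.assoc]
  simpa only [Category.assoc] using congrArg (· ≫ Φ.hom) h

/-! ### Contraction with a coevaluation -/

variable {P : ParityStructure C}

/-- The context `Γ`, extended by two variables running through an object `x` and its dual. -/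
noncomputable abbrev bindCtx (Γ : CommComon C) (x : DualisableWithInvolution P) : CommComon C :=
  prodCtx Γ (prodCtx (varCtx x.obj) (varCtx x.dual))

/-- Weakening: an element is regarded as an element in the extended context. -/
noncomputable abbrev wk (x : DualisableWithInvolution P) (y : El Γ X) : El (bindCtx Γ x) X :=
  sb (fstSub _ _) y

/-- The variable in `x`. -/
noncomputable def gen (x : DualisableWithInvolution P) : El (bindCtx Γ x) x.obj :=
  sb (sndSub _ _) (sb (fstSub _ _) (var x.obj))

/-- The variable in the dual of `x`. -/
noncomputable def genDual (x : DualisableWithInvolution P) : El (bindCtx Γ x) x.dual :=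
  sb (sndSub _ _) (sb (sndSub _ _) (var x.dual))

/-- Contraction: the variables in `x` and its dual are replaced by the two halves of the
coevaluation `1 ⟶ x ⊗ x^∨`. -/
noncomputable def contr (x : DualisableWithInvolution P) (Φ : El (bindCtx Γ x) X) : El Γ X :=
  integ (x.coev ≫ (biprod.inr ⊗ₘ biprod.inr)) Φ

/-- The exchange of two contractions. -/
noncomputable abbrev exch (Γ : CommComon C) (x y : DualisableWithInvolution P) :
    Sub (bindCtx (bindCtx Γ y) x) (bindCtx (bindCtx Γ x) y) := swapSub _ _ _

section

variable (x y : DualisableWithInvolution P)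

theorem contr_ap (f : X ⟶ Y) (Φ : El (bindCtx Γ x) X) :
    contr x (ap f Φ) = ap f (contr x Φ) := integ_ap _ _ _

/-- Contraction as a homomorphism. -/
noncomputable def contrHom : El (bindCtx Γ x) X →+ El Γ X :=
  integHom (x.coev ≫ (biprod.inr ⊗ₘ biprod.inr))

theorem contr_add (Φ Ψ : El (bindCtx Γ x) X) : contr x (Φ + Ψ) = contr x Φ + contr x Ψ :=
  integ_add _ _ _

theorem contr_sub (Φ Ψ : El (bindCtx Γ x) X) : contr x (Φ - Ψ) = contr x Φ - contr x Ψ :=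
  integ_sub _ _ _

theorem contr_neg (Φ : El (bindCtx Γ x) X) : contr x (-Φ) = -contr x Φ := integ_neg _ _

@[simp] theorem contr_zero : contr x (0 : El (bindCtx Γ x) X) = 0 := integ_zero _

theorem contr_zsmul (n : ℤ) (Φ : El (bindCtx Γ x) X) : contr x (n • Φ) = n • contr x Φ :=
  integ_zsmul _ _ _

theorem contr_pr_left (z : El Γ X) (Φ : El (bindCtx Γ x) Y) :
    contr x (pr (wk x z) Φ) = pr z (contr x Φ) := integ_pr_left _ _ _

theorem contr_pr_right (z : El Γ X) (Φ : El (bindCtx Γ x) Y) :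
    contr x (pr Φ (wk x z)) = pr (contr x Φ) z := integ_pr_right _ _ _

theorem contr_smul_left (z : El Γ (𝟙_ C)) (Φ : El (bindCtx Γ x) Y) :
    contr x (wk x z • Φ) = z • contr x Φ := integ_smul_left _ _ _

theorem contr_mul_left {S : C} [MonObj S] [IsCommMonObj S] (z : El Γ S)
    (Φ : El (bindCtx Γ x) S) : contr x (wk x z * Φ) = z * contr x Φ := integ_mul_left _ _ _

theorem contr_mul_right {S : C} [MonObj S] [IsCommMonObj S] (z : El Γ S)
    (Φ : El (bindCtx Γ x) S) : contr x (Φ * wk x z) = contr x Φ * z := integ_mul_right _ _ _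

theorem contr_comm (Φ : El (bindCtx (bindCtx Γ x) y) X) :
    contr x (contr y Φ) = contr y (contr x (sb (exch Γ x y) Φ)) := integ_integ _ _ _

@[simp] theorem sb_exch_wk_wk (z : El Γ X) :
    sb (exch Γ x y) (wk y (wk x z)) = wk x (wk y z) := sb_swapSub_fst_fst _ _ _

@[simp] theorem sb_exch_wk_gen :
    sb (exch Γ x y) (wk y (gen x)) = gen x := sb_swapSub_fst_snd _ _ _

@[simp] theorem sb_exch_wk_genDual :
    sb (exch Γ x y) (wk y (genDual x)) = genDual x := sb_swapSub_fst_snd _ _ _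

@[simp] theorem sb_exch_gen :
    sb (exch Γ x y) (gen y) = wk x (gen y) := sb_swapSub_snd _ _ _

@[simp] theorem sb_exch_genDual :
    sb (exch Γ x y) (genDual y) = wk x (genDual y) := sb_swapSub_snd _ _ _

theorem contr_gen : contr x (pr (gen x) (genDual x)) = ap x.coev (1 : El Γ (𝟙_ C)) := by
  rw [gen, genDual, ← sb_pr, contr, integ_snd, pr_fst_snd, El.hom_mk, Category.assoc,
    tensorHom_comp_tensorHom, inr_var, inr_var, id_tensorHom_id, Category.comp_id]

theorem contr_gen_dual :
    contr x (pr (genDual x) (gen x)) = ap (x.coev ≫ (β_ _ _).hom) (1 : El Γ (𝟙_ C)) := by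
  rw [← ap_braiding, contr_ap, contr_gen, ap_comp]

/-- The first snake identity. -/
theorem contr_ev_smul_gen (z : El Γ x.obj) :
    contr x (ap x.ev (pr (genDual x) (wk x z)) • gen x) = z := by
  have h := x.pairing.evaluation_coevaluation'
  rw [← ap_rightUnitor, ← ap_whiskerLeft, ← ap_assoc_hom, contr_ap, contr_ap, contr_ap,
    contr_pr_right, contr_gen, ← ap_whiskerRight, ← ap_leftUnitor_inv, ← ap_comp, ← ap_comp,
    ← ap_comp, ← ap_comp]
  have e : (λ_ x.obj).inv ≫ x.coev ▷ x.obj ≫ (α_ x.obj x.dual x.obj).hom ≫ x.obj ◁ x.ev ≫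
      (ρ_ x.obj).hom = 𝟙 _ := by
    rw [Iso.inv_comp_eq, Category.comp_id]
    have h2 := congrArg (· ≫ (ρ_ x.obj).hom) h
    simpa [coev, ev] using h2
  rw [e, ap_id]

end

end Integral

end Elements

/-! ### Extensions by cocycles -/

section Derivations

open scoped ComonObj MonObj

set_option linter.unusedSectionVars false

variable {C : Type u} [Category.{v} C] [MonoidalCategory C] [SymmetricCategory C]
  [Preadditive C] [MonoidalPreadditive C] [HasBinaryBiproducts C]
  {h S M : C} [MonObj S] [IsCommMonObj S] {j : h ⟶ S}

theorem hom_ext₁ {X A : C} {F G : X ⟶ A}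
    (H : ∀ (Γ : CommComon C) (x : El Γ X), ap F x = ap G x) : F = G :=
  El.eq_of_section (Γ := varCtx X) (i := biprod.inr) (x := var X) (inr_var X) (H _ _)

theorem biprod_el_ext {X Y : C} {Γ : CommComon C} {x y : El Γ (X ⊞ Y)}
    (h₁ : ap biprod.fst x = ap biprod.fst y) (h₂ : ap biprod.snd x = ap biprod.snd y) : x = y :=
  biprod.hom_ext x.hom y.hom h₁ h₂

/-- An action `S ⊗ M ⟶ M` of a commutative monoid `S` and a normalised symmetric 2-cocycle
`S ⊗ S ⟶ M` for it. -/
structure ModuleCocycle (S M : C) [MonObj S] [IsCommMonObj S] where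
  /-- the action -/
  act : S ⊗ M ⟶ M
  /-- the cocycle -/
  coc : S ⊗ S ⟶ M
  one_act : ∀ {Γ : CommComon C} (m : El Γ M), ap act (pr 1 m) = m
  mul_act : ∀ {Γ : CommComon C} (x y : El Γ S) (m : El Γ M),
    ap act (pr (x * y) m) = ap act (pr x (ap act (pr y m)))
  coc_symm : ∀ {Γ : CommComon C} (x y : El Γ S), ap coc (pr x y) = ap coc (pr y x)
  one_coc : ∀ {Γ : CommComon C} (x : El Γ S), ap coc (pr 1 x) = 0
  coc_assoc : ∀ {Γ : CommComon C} (x y z : El Γ S),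
    ap act (pr z (ap coc (pr x y))) + ap coc (pr (x * y) z) =
      ap act (pr x (ap coc (pr y z))) + ap coc (pr x (y * z))

namespace ModuleCocycle

variable (K : ModuleCocycle S M)

/-- The multiplication `(a, m) (b, n) = (a b, a n + b m + c(a, b))` of the extension. -/
noncomputable def extMul : (S ⊞ M) ⊗ (S ⊞ M) ⟶ S ⊞ M :=
  biprod.lift ((biprod.fst ⊗ₘ biprod.fst) ≫ μ[S])
    ((biprod.fst ⊗ₘ biprod.snd) ≫ K.act + (β_ _ _).hom ≫ (biprod.fst ⊗ₘ biprod.snd) ≫ K.act +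
      (biprod.fst ⊗ₘ biprod.fst) ≫ K.coc)

theorem fst_extMul {Γ : CommComon C} (x y : El Γ (S ⊞ M)) :
    ap biprod.fst (ap K.extMul (pr x y)) = ap biprod.fst x * ap biprod.fst y := by
  simp [extMul, ← ap_comp _ biprod.fst]
  simp [ap_comp]

theorem snd_extMul {Γ : CommComon C} (x y : El Γ (S ⊞ M)) :
    ap biprod.snd (ap K.extMul (pr x y)) =
      ap K.act (pr (ap biprod.fst x) (ap biprod.snd y)) +
        ap K.act (pr (ap biprod.fst y) (ap biprod.snd x)) +
          ap K.coc (pr (ap biprod.fst x) (ap biprod.fst y)) := by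
  simp [extMul, ← ap_comp _ biprod.snd]
  simp [ap_comp, add_ap]

/-- The extension of `S` by `M` defined by the cocycle, as a commutative monoid on `S ⊞ M`. -/
@[reducible]
noncomputable def extMonObj : MonObj (S ⊞ M) where
  one := η[S] ≫ biprod.inl
  mul := K.extMul
  one_mul := hom_ext₂ fun Γ s x => by
    rw [ap_comp, ap_whiskerRight, ap_leftUnitor, ap_comp, ap_unit, ap_smul, pr_smul_left, ap_smul]
    congr 1
    have h1 : ap biprod.fst (ap biprod.inl (1 : El Γ S) : El Γ (S ⊞ M)) = 1 := by
      rw [← ap_comp]; simp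
    have h2 : ap biprod.snd (ap biprod.inl (1 : El Γ S) : El Γ (S ⊞ M)) = 0 := by
      rw [← ap_comp]; simp
    apply biprod_el_ext
    · rw [fst_extMul, h1, one_mul]
    · rw [snd_extMul, h1, h2]
      simp [K.one_act, K.one_coc]
  mul_one := hom_ext₂ fun Γ x s => by
    rw [ap_comp, ap_whiskerLeft, ap_rightUnitor, ap_comp, ap_unit, ap_smul, pr_smul_right, ap_smul]
    congr 1
    have h1 : ap biprod.fst (ap biprod.inl (1 : El Γ S) : El Γ (S ⊞ M)) = 1 := by
      rw [← ap_comp]; simp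
    have h2 : ap biprod.snd (ap biprod.inl (1 : El Γ S) : El Γ (S ⊞ M)) = 0 := by
      rw [← ap_comp]; simp
    apply biprod_el_ext
    · rw [fst_extMul, h1, mul_one]
    · rw [snd_extMul, h1, h2]
      simp [K.one_act, K.one_coc, K.coc_symm _ 1]
  mul_assoc := hom_ext₃' fun Γ x y z => by
    simp only [ap_comp, ap_whiskerRight, ap_assoc_hom, ap_whiskerLeft]
    apply biprod_el_ext
    · simp only [fst_extMul, mul_assoc]
    · simp only [snd_extMul, fst_extMul, pr_add_right, ap_add, ← K.mul_act]
      have h1 := K.coc_assoc (ap biprod.fst x) (ap biprod.fst y) (ap biprod.fst z)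
      rw [mul_comm (ap biprod.fst z) (ap biprod.fst x),
        mul_comm (ap biprod.fst z) (ap biprod.fst y)]
      rw [← sub_eq_zero] at h1 ⊢
      rw [← h1]
      abel

theorem ext_comm : letI := K.extMonObj; IsCommMonObj (S ⊞ M) :=
  letI := K.extMonObj
  ⟨hom_ext₂ fun Γ x y => by
    change ap ((β_ _ _).hom ≫ K.extMul) _ = ap K.extMul _
    rw [ap_comp, ap_braiding]
    apply biprod_el_ext
    · rw [fst_extMul, fst_extMul, mul_comm]
    · rw [snd_extMul, snd_extMul, K.coc_symm]
      abel⟩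

/-- `g : S ⟶ M` is a derivation up to the cocycle. -/
def IsTwisted (g : S ⟶ M) : Prop :=
  ∀ {Γ : CommComon C} (x y : El Γ S), ap g (x * y) =
    ap K.act (pr x (ap g y)) + ap K.act (pr y (ap g x)) + ap K.coc (pr x y)

/-- Twisted derivations are prescribed freely on the generators of a free commutative monoid: `g` is
twisted if and only if `(𝟙, g) : S ⟶ S ⊞ M` is a morphism of monoids. -/
theorem existsUnique_isTwisted (hj : IsFreeCommMon j) (f : h ⟶ M) :
    ∃! g : S ⟶ M, K.IsTwisted g ∧ j ≫ g = f := by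
  let := K.extMonObj
  have := K.ext_comm
  have hmul : (μ : (S ⊞ M) ⊗ (S ⊞ M) ⟶ S ⊞ M) = K.extMul := rfl
  have hone : (η : 𝟙_ C ⟶ S ⊞ M) = η[S] ≫ biprod.inl := rfl
  obtain ⟨G, ⟨hG, hjG⟩, huniq⟩ := hj (S ⊞ M) (biprod.lift j f)
  -- the first component of `G` is a monoid endomorphism of `S` fixing the generators
  have hfst : G ≫ biprod.fst = 𝟙 S := by
    refine (hj S j).unique ⟨⟨?_, ?_⟩, ?_⟩ ⟨inferInstance, Category.comp_id _⟩
    · rw [← Category.assoc, hG.one_hom, hone, Category.assoc, biprod.inl_fst, Category.comp_id]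
    · rw [← Category.assoc, hG.mul_hom]
      refine hom_ext₂ fun Γ x y => ?_
      simp only [ap_comp, hmul, ap_tensorHom, fst_extMul, ap_mul]
    · rw [reassoc_of% hjG]; simp
  refine ⟨G ≫ biprod.snd, ⟨fun {Γ} x y => ?_, ?_⟩, fun g ⟨hg, hjg⟩ => ?_⟩
  · have hx : ∀ x : El Γ S, ap biprod.fst (ap G x) = x := fun x => by
      rw [← ap_comp, hfst, ap_id]
    rw [← ap_mul, ap_comp, ap_comp, ap_comp, ← ap_comp μ, hG.mul_hom, ap_comp, ap_tensorHom, hmul,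
      snd_extMul, hx, hx]
  · rw [reassoc_of% hjG]; simp
  -- conversely `(𝟙, g)` is a morphism of monoids extending `(j, f)`, hence equal to `G`
  · have hg1 : ap g (1 : El (CommComon.trivial C) S) = 0 := by
      have := hg (1 : El (CommComon.trivial C) S) 1
      simpa [K.one_act, K.one_coc] using this
    have : biprod.lift (𝟙 S) g = G := by
      refine huniq _ ⟨⟨?_, ?_⟩, ?_⟩
      · rw [hone]
        ext
        · simp
        · simp only [Category.assoc, biprod.lift_snd, biprod.inl_snd, comp_zero]
          have e : (η[S] ≫ g) = (ap g (1 : El (CommComon.trivial C) S)).hom :=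
            congrArg (· ≫ g) (Category.id_comp η[S]).symm
          rw [e, hg1]; rfl
      · rw [hmul]
        refine hom_ext₂ fun Γ x y => ?_
        have h1 : ∀ x : El Γ S, ap biprod.fst (ap (biprod.lift (𝟙 S) g) x) = x := fun x => by
          rw [← ap_comp]; simp
        have h2 : ∀ x : El Γ S, ap biprod.snd (ap (biprod.lift (𝟙 S) g) x) = ap g x := fun x => by
          rw [← ap_comp]; simp
        rw [ap_comp, ap_comp, ap_tensorHom, ap_mul]
        apply biprod_el_ext
        · rw [fst_extMul]; simp only [h1]
        · rw [snd_extMul]; simp only [h1, h2, hg x y]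
      · ext <;> simp [hjg]
    rw [← this]; simp

end ModuleCocycle

end Derivations

/-! ### Derivations with parameters -/

section ParamDerivations

open scoped ComonObj MonObj

set_option linter.unusedSectionVars false

variable {C : Type u} [Category.{v} C] [MonoidalCategory C] [SymmetricCategory C]
  [Preadditive C] [MonoidalPreadditive C] [HasBinaryBiproducts C]
  {h S M B X Y Z : C} [MonObj S] [IsCommMonObj S] {j : h ⟶ S}

/-- A family of derivations of `S` with parameters in `B`. -/
def IsParamDer (d : B ⊗ S ⟶ S) : Prop :=
  ∀ {Γ : CommComon C} (b : El Γ B) (x y : El Γ S),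
    ap d (pr b (x * y)) = x * ap d (pr b y) + y * ap d (pr b x)

theorem IsParamDer.comp {B' : C} {d : B ⊗ S ⟶ S} (hd : IsParamDer d) (f : B' ⟶ B) :
    IsParamDer (f ▷ S ≫ d) := fun b x y => by
  simp only [ap_comp, ap_whiskerRight, hd (ap f b) x y]

theorem IsParamDer.sub {d e : B ⊗ S ⟶ S} (hd : IsParamDer d) (he : IsParamDer e) :
    IsParamDer (d - e) := fun b x y => by
  simp only [sub_ap, hd b x y, he b x y]
  ring

theorem IsParamDer.smul {d : B ⊗ S ⟶ S} (hd : IsParamDer d) :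
    IsParamDer ((α_ S B S).hom ≫ S ◁ d ≫ μ) := fun {Γ} b x y => by
  let F := (α_ S B S).hom ≫ S ◁ d ≫ μ
  have hF : ∀ {Γ : CommComon C} (a : El Γ S) (b : El Γ B) (x : El Γ S),
      ap F (pr (pr a b) x) = a * ap d (pr b x) := fun a b x => by simp [F, ap_comp]
  have e : (S ⊗ B) ◁ μ ≫ F = (S ⊗ B) ◁ (β_ S S).hom ≫ (α_ _ _ _).inv ≫ F ▷ S ≫ μ +
      (α_ _ _ _).inv ≫ F ▷ S ≫ μ := hom_ext₂₂ fun Γ a b x y => by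
    simp [ap_comp, add_ap, hF, hd b x y]
    ring
  have := congrArg (fun f => ap f (pr b (pr x y))) e
  simp only [ap_comp, add_ap, ap_whiskerLeft, ap_whiskerRight, ap_braiding, ap_assoc_inv,
    ap_mul] at this
  rw [this, mul_comm x, mul_comm y]

/-- The free module `S ⊗ X`, with the zero cocycle. -/
def freeModule (S X : C) [MonObj S] [IsCommMonObj S] : ModuleCocycle S (S ⊗ X) where
  act := (α_ _ _ _).inv ≫ μ[S] ▷ X
  coc := 0
  one_act := fun {Γ} m => by
    have e : (λ_ (S ⊗ X)).inv ≫ η[S] ▷ (S ⊗ X) ≫ (α_ S S X).inv ≫ μ[S] ▷ X = 𝟙 _ :=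
      hom_ext₂ fun Γ x y => by
        simp only [ap_comp, ap_leftUnitor_inv, ap_whiskerRight, ap_one, ap_assoc_inv, ap_mul,
          one_mul, ap_id]
    have := congrArg (fun f => ap f m) e
    simpa only [ap_comp, ap_leftUnitor_inv, ap_whiskerRight, ap_one, ap_id] using this
  mul_act := fun {Γ} x y m => by
    have e : (α_ S S (S ⊗ X)).inv ≫ μ[S] ▷ (S ⊗ X) ≫ (α_ S S X).inv ≫ μ[S] ▷ X =
        S ◁ ((α_ S S X).inv ≫ μ[S] ▷ X) ≫ (α_ S S X).inv ≫ μ[S] ▷ X :=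
      hom_ext₄ fun Γ x y z w => by simp [ap_comp, mul_assoc]
    have := congrArg (fun f => ap f (pr x (pr y m))) e
    simpa only [ap_comp, ap_assoc_inv, ap_whiskerRight, ap_whiskerLeft, ap_mul] using this
  coc_symm := by simp
  one_coc := by simp
  coc_assoc := by simp

theorem ap_freeModule_act {Γ : CommComon C} (a s : El Γ S) (x : El Γ X) :
    ap (freeModule S X).act (pr a (pr s x)) = pr (a * s) x := by
  simp [freeModule, ap_comp]

/-- The universal derivation `∂ : S ⟶ S ⊗ h` of a free commutative monoid. -/
theorem exists_univDer (hj : IsFreeCommMon j) : ∃ d : S ⟶ S ⊗ h,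
    (∀ {Γ : CommComon C} (x y : El Γ S), ap d (x * y) =
      ap (freeModule S h).act (pr x (ap d y)) + ap (freeModule S h).act (pr y (ap d x))) ∧
    ∀ {Γ : CommComon C} (x : El Γ h), ap d (ap j x) = pr 1 x := by
  obtain ⟨d, ⟨h1, h2⟩, -⟩ :=
    (freeModule S h).existsUnique_isTwisted hj ((λ_ h).inv ≫ η[S] ▷ h)
  refine ⟨d, fun {Γ} x y => ?_, fun {Γ} x => ?_⟩
  · rw [h1 x y]
    simp [freeModule]
  · rw [← ap_comp, h2]
    simp [ap_comp]

section Coequalizer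

variable (u v : X ⟶ Y) [HasCoequalizer u v] (B) [PreservesColimit (parallelPair u v) (tensorLeft B)]

theorem epi_whiskerLeft_coequalizer : Epi (B ◁ coequalizer.π u v) :=
  ⟨fun _ _ e => Cofork.IsColimit.hom_ext
    (isColimitOfHasCoequalizerOfPreservesColimit (tensorLeft B) u v) e⟩

theorem exists_whiskerLeft_coequalizer_desc (k : B ⊗ Y ⟶ Z) (hk : B ◁ u ≫ k = B ◁ v ≫ k) :
    ∃ l : B ⊗ coequalizer u v ⟶ Z, B ◁ coequalizer.π u v ≫ l = k :=
  ⟨_, (Cofork.IsColimit.desc'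
    (isColimitOfHasCoequalizerOfPreservesColimit (tensorLeft B) u v) k hk).2⟩

end Coequalizer

variable [HasColimits C] [∀ X : C, PreservesColimits (tensorLeft X)]

/-- The module of differentials of `S`: the quotient of `S ⊗ S` by the Leibniz rule
`a ⊗ x y ∼ a x ⊗ y + a y ⊗ x`. -/
theorem exists_differentials (S : C) [MonObj S] [IsCommMonObj S] :
    ∃ (Ω : C) (K : ModuleCocycle S Ω) (q : S ⊗ S ⟶ Ω), K.coc = 0 ∧
      (∀ {Γ : CommComon C} (a x y : El Γ S),
        ap q (pr a (x * y)) = ap q (pr (a * x) y) + ap q (pr (a * y) x)) ∧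
      (∀ {Γ : CommComon C} (a s x : El Γ S),
        ap K.act (pr a (ap q (pr s x))) = ap q (pr (a * s) x)) ∧
      ∀ {B Z : C} (k : B ⊗ (S ⊗ S) ⟶ Z), (∀ {Γ : CommComon C} (b : El Γ B) (a x y : El Γ S),
        ap k (pr b (pr a (x * y))) = ap k (pr b (pr (a * x) y)) + ap k (pr b (pr (a * y) x))) →
        ∃ l : B ⊗ Ω ⟶ Z, B ◁ q ≫ l = k := by
  -- the two sides of the Leibniz rule, as maps of `a ⊗ x ⊗ y`
  let u : S ⊗ (S ⊗ S) ⟶ S ⊗ S := S ◁ μ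
  let v : S ⊗ (S ⊗ S) ⟶ S ⊗ S := (α_ S S S).inv ≫ μ ▷ S +
    S ◁ (β_ S S).hom ≫ (α_ S S S).inv ≫ μ ▷ S
  have hu : ∀ {Γ : CommComon C} (a x y : El Γ S), ap u (pr a (pr x y)) = pr a (x * y) :=
    fun a x y => by simp [u]
  have hv : ∀ {Γ : CommComon C} (a x y : El Γ S),
      ap v (pr a (pr x y)) = pr (a * x) y + pr (a * y) x :=
    fun a x y => by simp [v, add_ap, ap_comp]
  let q := coequalizer.π u v
  have hq : u ≫ q = v ≫ q := coequalizer.condition u v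
  have hq' : ∀ {Γ : CommComon C} (a x y : El Γ S),
        ap q (pr a (x * y)) = ap q (pr (a * x) y) + ap q (pr (a * y) x) := fun a x y => by
    rw [← hu, ← ap_comp, hq, ap_comp, hv, ap_add]
  have hdesc : ∀ {B Z : C} (k : B ⊗ (S ⊗ S) ⟶ Z),
      (∀ {Γ : CommComon C} (b : El Γ B) (a x y : El Γ S),
        ap k (pr b (pr a (x * y))) = ap k (pr b (pr (a * x) y)) + ap k (pr b (pr (a * y) x))) →
        ∃ l : B ⊗ coequalizer u v ⟶ Z, B ◁ q ≫ l = k := fun k hk => by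
    refine exists_whiskerLeft_coequalizer_desc _ u v k (hom_ext₄ fun Γ b a x y => ?_)
    simp only [ap_comp, ap_whiskerLeft, hu, hv, pr_add_right, ap_add, hk]
  have hepi : ∀ B : C, Epi (B ◁ q) := fun B => epi_whiskerLeft_coequalizer B u v
  obtain ⟨act, hact⟩ := hdesc ((α_ S S S).inv ≫ μ ▷ S ≫ q) fun b a x y => by
    simp [ap_comp, hq', mul_assoc]
  have hact' : ∀ {Γ : CommComon C} (a s x : El Γ S),
        ap act (pr a (ap q (pr s x))) = ap q (pr (a * s) x) := fun a s x => by
    rw [← ap_whiskerLeft, ← ap_comp, hact]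
    simp [ap_comp]
  let K : ModuleCocycle S (coequalizer u v) :=
    { act := act
      coc := 0
      one_act := fun {Γ} m => by
        have e : (λ_ _).inv ≫ η[S] ▷ _ ≫ act = 𝟙 _ := by
          have : Epi q := inferInstanceAs (Epi (coequalizer.π u v))
          rw [← cancel_epi q]
          refine hom_ext₂ fun Γ x y => ?_
          simp [ap_comp, hact']
        have := congrArg (fun f => ap f m) e
        simpa [ap_comp] using this
      mul_act := fun {Γ} x y m => by
        have e : (α_ S S _).inv ≫ μ[S] ▷ _ ≫ act = S ◁ act ≫ act := by
          have := hepi (S ⊗ S)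
          rw [← cancel_epi (α_ S S _).hom, ← cancel_epi ((S ⊗ S) ◁ q)]
          refine hom_ext₂₂ fun Γ x y z w => ?_
          simp [ap_comp, hact', mul_assoc]
        have := congrArg (fun f => ap f (pr x (pr y m))) e
        simpa [ap_comp] using this
      coc_symm := by simp
      one_coc := by simp
      coc_assoc := by simp }
  exact ⟨coequalizer u v, K, q, rfl, hq', hact', hdesc⟩

/-- A family of derivations of a free commutative monoid is determined by its values on the
generators. For families the universal property of `S` does not apply directly, as there is no inner
hom from `B`; the family is factored through the module of differentials instead, where the
universal derivation factors through `S ⊗ h`. -/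
theorem IsParamDer.eq_zero (hj : IsFreeCommMon j) {d : B ⊗ S ⟶ S} (hd : IsParamDer d)
    (h0 : B ◁ j ≫ d = 0) : d = 0 := by
  have h0 : ∀ {Γ : CommComon C} (b : El Γ B) (x : El Γ h), ap d (pr b (ap j x)) = 0 := fun b x => by
    rw [← ap_whiskerLeft, ← ap_comp, h0, zero_ap]
  obtain ⟨Ω, K, q, hK, hq, hact, hdesc⟩ := exists_differentials S
  obtain ⟨D, hD, hDj⟩ := exists_univDer hj
  let δ : S ⟶ Ω := (λ_ S).inv ≫ η[S] ▷ S ≫ q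
  have hδ : ∀ {Γ : CommComon C} (x : El Γ S), ap δ x = ap q (pr 1 x) := fun x => by
    simp [δ, ap_comp]
  have hψ : (freeModule S h).act ≫ S ◁ j ≫ q = S ◁ (S ◁ j ≫ q) ≫ K.act :=
    hom_ext₃ fun Γ a s x => by
      rw [ap_comp, ap_freeModule_act]
      simp [ap_comp, hact]
  -- two derivations `S ⟶ Ω` that agree on the generators
  have key : δ = D ≫ S ◁ j ≫ q := by
    refine (K.existsUnique_isTwisted hj (j ≫ δ)).unique ⟨fun {Γ} x y => ?_, rfl⟩
      ⟨fun {Γ} x y => ?_, hom_ext₁ fun Γ x => ?_⟩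
    · simp [hδ, hq, hact, hK]
    · rw [ap_comp D, ap_comp D, ap_comp D, hD, ap_add, ← ap_comp _ (S ◁ j ≫ q),
        ← ap_comp _ (S ◁ j ≫ q), hψ, ap_comp (_ ◁ _), ap_comp (_ ◁ _), ap_whiskerLeft,
        ap_whiskerLeft, hK, zero_ap, add_zero]
    · rw [ap_comp, ap_comp, hDj, ap_comp, ap_comp, hδ, ap_whiskerLeft]
  obtain ⟨l, hl⟩ := hdesc ((B ◁ (β_ S S).hom) ≫ (α_ B S S).inv ≫ d ▷ S ≫ μ)
    (fun {Γ} b a x y => by simp [ap_comp, hd b x y]; ring)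
  have hl' : ∀ {Γ : CommComon C} (b : El Γ B) (a x : El Γ S),
      ap l (pr b (ap q (pr a x))) = ap d (pr b x) * a := fun b a x => by
    rw [← ap_whiskerLeft, ← ap_comp, hl]
    simp [ap_comp]
  have hl0 : B ◁ (S ◁ j ≫ q) ≫ l = 0 := hom_ext₃ fun Γ b a x => by
    simp [ap_comp, hl', h0]
  refine hom_ext₂ fun Γ b x => ?_
  rw [zero_ap, ← mul_one (ap d (pr b x)), ← hl', ← hδ, key, ap_comp, ← ap_whiskerLeft, ← ap_comp,
    hl0, zero_ap]

end ParamDerivations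

section SecondOrder

open scoped ComonObj MonObj

set_option linter.unusedSectionVars false

variable {C : Type u} [Category.{v} C] [MonoidalCategory C] [SymmetricCategory C]
  [Preadditive C] [MonoidalPreadditive C] [HasBinaryBiproducts C]
  {h S M B X Y Z : C} [MonObj S] [IsCommMonObj S] {j : h ⟶ S} {Γ : CommComon C}

/-! ### Second order operators -/

theorem ap_diffT (f : B ⊗ S ⟶ S) (b : El Γ B) (x y : El Γ S) :
    ap (diffT f) (pr (pr b x) y) = ap f (pr b (x * y)) - x * ap f (pr b y) := by
  simp [diffT, sub_ap, ap_comp]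

/-- The bracket `D(x y) - x D(y) - y D(x)` of an operator with parameters in `B`. -/
def bracket (D : B ⊗ S ⟶ S) (b : El Γ B) (x y : El Γ S) : El Γ S :=
  ap D (pr b (x * y)) - x * ap D (pr b y) - y * ap D (pr b x)

theorem ap_mul_eq_bracket (D : B ⊗ S ⟶ S) (b : El Γ B) (x y : El Γ S) :
    ap D (pr b (x * y)) = x * ap D (pr b y) + y * ap D (pr b x) + bracket D b x y := by
  rw [bracket]; ring

theorem bracket_comm (D : B ⊗ S ⟶ S) (b : El Γ B) (x y : El Γ S) :
    bracket D b x y = bracket D b y x := by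
  rw [bracket, bracket, mul_comm x y]; ring

/-- The bracket of a second order operator that vanishes on the unit is a derivation in its
second argument. -/
theorem IsDiffOp.bracket_mul_right {D : B ⊗ S ⟶ S} (hD : IsDiffOp 2 D) (h1 : B ◁ η ≫ D = 0)
    (b : El Γ B) (x y z : El Γ S) :
    bracket D b x (y * z) = y * bracket D b x z + z * bracket D b x y := by
  have h1' : ap D (pr b (1 : El Γ S)) = 0 := by
    rw [← ap_one, ← ap_whiskerLeft, ← ap_comp, h1, zero_ap]
  have e := congrArg (fun f => ap f (pr (pr (pr (pr b x) y) z) 1)) hD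
  simp only [ap_diffT, zero_ap, mul_one, h1'] at e
  rw [← sub_eq_zero, ← e]
  simp only [bracket, mul_assoc]
  ring

theorem IsDiffOp.bracket_mul_left {D : B ⊗ S ⟶ S} (hD : IsDiffOp 2 D) (h1 : B ◁ η ≫ D = 0)
    (b : El Γ B) (x y z : El Γ S) :
    bracket D b (x * y) z = x * bracket D b y z + y * bracket D b x z := by
  rw [bracket_comm, hD.bracket_mul_right h1, bracket_comm D b z, bracket_comm D b z]

theorem isDiffOp_two_of_bracket {D : B ⊗ S ⟶ S}
    (hD : ∀ {Γ : CommComon C} (b : El Γ B) (x y z : El Γ S),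
      bracket D b x (y * z) = y * bracket D b x z + z * bracket D b x y) : IsDiffOp 2 D := by
  change diffT (diffT (diffT D)) = 0
  have key : ∀ {Γ : CommComon C} (b : El Γ B) (x y z : El Γ S),
      ap (diffT (diffT D)) (pr (pr (pr b x) y) z) = z * bracket D b x y := fun b x y z => by
    rw [ap_diffT, ap_diffT, ap_diffT, ap_mul_eq_bracket D b x (y * z), ap_mul_eq_bracket D b x z,
      hD]
    ring
  refine hom_ext₅ fun Γ b x y z w => ?_
  rw [ap_diffT, key, key, zero_ap]
  ring

/-- The bracket as a morphism. -/
def bracketHom (D : B ⊗ S ⟶ S) : (B ⊗ S) ⊗ S ⟶ S :=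
  (α_ _ _ _).hom ≫ (B ◁ μ ≫ D - B ◁ (β_ _ _).hom ≫ (α_ _ _ _).inv ≫ D ▷ S ≫ μ -
    (α_ _ _ _).inv ≫ D ▷ S ≫ μ)

theorem ap_bracketHom (D : B ⊗ S ⟶ S) (b : El Γ B) (x y : El Γ S) :
    ap (bracketHom D) (pr (pr b x) y) = bracket D b x y := by
  simp [bracketHom, bracket, ap_comp, sub_ap, mul_comm]

section Extension

/-- The `S`-linear extension `(b, (s, x)) ↦ s f(b, x)` of a family of morphisms `X ⟶ S`. -/
def linExt (f : B ⊗ X ⟶ S) : B ⊗ (S ⊗ X) ⟶ S :=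
  B ◁ (β_ S X).hom ≫ (α_ B X S).inv ≫ f ▷ S ≫ μ

theorem ap_linExt (f : B ⊗ X ⟶ S) (b : El Γ B) (s : El Γ S) (x : El Γ X) :
    ap (linExt f) (pr b (pr s x)) = s * ap f (pr b x) := by
  simp [linExt, ap_comp, mul_comm]

theorem ap_linExt_act (f : B ⊗ X ⟶ S) (b : El Γ B) (a : El Γ S) (w : El Γ (S ⊗ X)) :
    ap (linExt f) (pr b (ap (freeModule S X).act (pr a w))) = a * ap (linExt f) (pr b w) := by
  have e : B ◁ (freeModule S X).act ≫ linExt f =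
      (α_ _ _ _).inv ≫ (β_ _ _).hom ▷ _ ≫ (α_ _ _ _).hom ≫ S ◁ linExt f ≫ μ :=
    hom_ext₄ fun Γ b a s x => by
      simp [ap_comp, ap_linExt, ap_freeModule_act, mul_assoc]
  have := congrArg (fun f => ap f (pr b (pr a w))) e
  simpa only [ap_comp, ap_assoc_inv, ap_assoc_hom, ap_whiskerLeft, ap_whiskerRight, ap_braiding,
    ap_mul] using this

/-- Families of derivations of a free commutative monoid can be prescribed on the generators. -/
theorem exists_isParamDer (hj : IsFreeCommMon j) (f : B ⊗ h ⟶ S) :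
    ∃ d : B ⊗ S ⟶ S, IsParamDer d ∧
      ∀ {Γ : CommComon C} (b : El Γ B) (x : El Γ h), ap d (pr b (ap j x)) = ap f (pr b x) := by
  obtain ⟨D, hD, hDj⟩ := exists_univDer hj
  refine ⟨B ◁ D ≫ linExt f, fun b x y => ?_, fun b x => ?_⟩
  · simp only [ap_comp, ap_whiskerLeft, hD, pr_add_right, ap_add, ap_linExt_act]
  · simp only [ap_comp, ap_whiskerLeft, hDj, ap_linExt, one_mul]

variable [HasColimits C] [∀ X : C, PreservesColimits (tensorLeft X)]

/-- Families of symmetric biderivations of a free commutative monoid can be prescribed on the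
generators. -/
theorem exists_biderivation (hj : IsFreeCommMon j) (φ : B ⊗ (h ⊗ h) ⟶ S)
    (hφ : ∀ {Γ : CommComon C} (b : El Γ B) (x y : El Γ h),
      ap φ (pr b (pr x y)) = ap φ (pr b (pr y x))) :
    ∃ d : (B ⊗ S) ⊗ S ⟶ S, IsParamDer d ∧
      (∀ {Γ : CommComon C} (b : El Γ B) (x y : El Γ S),
        ap d (pr (pr b x) y) = ap d (pr (pr b y) x)) ∧
      ∀ {Γ : CommComon C} (b : El Γ B) (x y : El Γ h),
        ap d (pr (pr b (ap j x)) (ap j y)) = ap φ (pr b (pr x y)) := by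
  -- `φ` is extended to a derivation in its second argument, then in its first one
  obtain ⟨d₁, h₁, h₁'⟩ := exists_isParamDer hj ((α_ B h h).hom ≫ φ)
  obtain ⟨d₂, h₂, h₂'⟩ := exists_isParamDer hj
    ((α_ B S h).hom ≫ B ◁ (β_ S h).hom ≫ (α_ B h S).inv ≫ d₁)
  have h₁' : ∀ {Γ : CommComon C} (b : El Γ B) (x y : El Γ h),
      ap d₁ (pr (pr b x) (ap j y)) = ap φ (pr b (pr x y)) := fun b x y => by
    rw [h₁', ap_comp, ap_assoc_hom]
  have h₂' : ∀ {Γ : CommComon C} (b : El Γ B) (y : El Γ S) (x : El Γ h),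
      ap d₂ (pr (pr b y) (ap j x)) = ap d₁ (pr (pr b x) y) := fun b y x => by
    rw [h₂']; simp [ap_comp]
  refine ⟨d₂, h₂, ?_, fun b x y => by rw [h₂', h₁', hφ]⟩
  -- the failure `F` of the Leibniz rule in the other argument is a derivation in the last one and
  -- vanishes on the generators
  have hder : ∀ {Γ : CommComon C} (b : El Γ B) (x y z : El Γ S),
      ap d₂ (pr (pr b (x * y)) z) = x * ap d₂ (pr (pr b y) z) + y * ap d₂ (pr (pr b x) z) := by
    let F : (B ⊗ (S ⊗ S)) ⊗ S ⟶ S := (B ◁ μ) ▷ S ≫ d₂ -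
      ((α_ B S S).inv ≫ (β_ _ _).hom) ▷ S ≫ (α_ S (B ⊗ S) S).hom ≫ S ◁ d₂ ≫ μ -
      (B ◁ (β_ S S).hom ≫ (α_ B S S).inv ≫ (β_ _ _).hom) ▷ S ≫
        (α_ S (B ⊗ S) S).hom ≫ S ◁ d₂ ≫ μ
    have hF : ∀ {Γ : CommComon C} (b : El Γ B) (x y z : El Γ S),
        ap F (pr (pr b (pr x y)) z) = ap d₂ (pr (pr b (x * y)) z) -
          y * ap d₂ (pr (pr b x) z) - x * ap d₂ (pr (pr b y) z) := fun b x y z => by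
      simp [F, ap_comp, sub_ap]
    have hF0 : F = 0 := by
      refine IsParamDer.eq_zero hj ?_ ?_
      · refine IsParamDer.sub (IsParamDer.sub (h₂.comp _) ?_) ?_
        · exact IsParamDer.comp h₂.smul _
        · exact IsParamDer.comp h₂.smul _
      · rw [← cancel_epi ((α_ B S S).hom ▷ h)]
        refine hom_ext₄' fun Γ b x y z => ?_
        simp [ap_comp, hF, h₂', h₁ _ x y]
    intro Γ b x y z
    have := hF b x y z
    rw [hF0, zero_ap] at this
    rw [← sub_eq_zero, this]
    ring
  -- the failure `G` of symmetry vanishes by the same argument, applied to both arguments in turn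
  let G : (B ⊗ S) ⊗ S ⟶ S := d₂ - (α_ B S S).hom ≫ B ◁ (β_ S S).hom ≫ (α_ B S S).inv ≫ d₂
  have hG : ∀ {Γ : CommComon C} (b : El Γ B) (x y : El Γ S),
      ap G (pr (pr b x) y) = ap d₂ (pr (pr b x) y) - ap d₂ (pr (pr b y) x) := fun b x y => by
    simp [G, ap_comp, sub_ap]
  have hG0 : G = 0 := by
    refine IsParamDer.eq_zero hj (IsParamDer.sub h₂ fun {Γ} w x y => ?_) ?_
    · have e : (B ⊗ S) ◁ μ ≫ (α_ B S S).hom ≫ B ◁ (β_ S S).hom ≫ (α_ B S S).inv ≫ d₂ =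
          (B ⊗ S) ◁ (β_ S S).hom ≫ (α_ _ _ _).inv ≫ ((α_ B S S).hom ≫ B ◁ (β_ S S).hom ≫
            (α_ B S S).inv ≫ d₂) ▷ S ≫ μ + (α_ _ _ _).inv ≫ ((α_ B S S).hom ≫ B ◁ (β_ S S).hom ≫
            (α_ B S S).inv ≫ d₂) ▷ S ≫ μ := hom_ext₂₂ fun Γ b x y z => by
        simp [ap_comp, add_ap, hder b]
        ring
      have := congrArg (fun f => ap f (pr w (pr x y))) e
      rw [ap_comp, ap_whiskerLeft, ap_mul] at this
      rw [this, add_ap]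
      simp only [ap_comp (_ ◁ _), ap_comp (_ ▷ _), ap_comp (α_ (B ⊗ S) S S).inv, ap_whiskerLeft,
        ap_braiding, ap_assoc_inv, ap_whiskerRight, ap_mul]
      ring
    · have hH : d₁ - (B ◁ j) ▷ S ≫ d₂ = 0 := by
        refine IsParamDer.eq_zero hj (IsParamDer.sub h₁ (IsParamDer.comp h₂ _)) ?_
        refine hom_ext₃' fun Γ b x y => ?_
        simp [ap_comp, sub_ap, h₁', h₂', hφ b x y]
      refine hom_ext₃' fun Γ b x y => ?_
      have := congrArg (fun f => ap f (pr (pr b y) x)) hH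
      simpa [ap_comp, hG, h₂', sub_ap] using this
  intro Γ b x y
  have := hG b x y
  rw [hG0, zero_ap] at this
  exact (sub_eq_zero.mp this.symm)

end Extension

/-! ### The parity object -/

section Parity

variable (P : ParityStructure C)

/-- The cancellation `π ⊗ (π ⊗ X) ⟶ X`. -/
def piEv (X : C) : P.pi ⊗ (P.pi ⊗ X) ⟶ X :=
  (α_ _ _ _).inv ≫ P.xi.hom ▷ X ≫ (λ_ X).hom

theorem ap_piEv (b c : El Γ P.pi) (x : El Γ X) :
    ap (piEv P X) (pr b (pr c x)) = ap P.xi.hom (pr b c) • x := by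
  simp [piEv, ap_comp]

/-- The isomorphism `ξ` is associative: both contractions of `π ⊗ π ⊗ π` agree. -/
theorem xi_smul_assoc (a b c : El Γ P.pi) :
    ap P.xi.hom (pr a b) • c = ap P.xi.hom (pr b c) • a := by
  have := congrArg (fun f => ap f (pr (pr a b) c)) (ParityStructure.Points.xi_assoc (P := P))
  simpa [ap_comp] using this

/-- The morphism `X ⟶ π ⊗ Y` corresponding to `π ⊗ X ⟶ Y`. -/
def piFlat (F : P.pi ⊗ X ⟶ Y) : X ⟶ P.pi ⊗ Y :=
  (λ_ X).inv ≫ P.xi.inv ▷ X ≫ (α_ _ _ _).hom ≫ P.pi ◁ F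

theorem piFlat_piEv (F : P.pi ⊗ X ⟶ Y) : P.pi ◁ piFlat P F ≫ piEv P Y = F := by
  have h1 : P.pi ◁ ((α_ P.pi P.pi X).hom ≫ P.pi ◁ F) ≫ piEv P Y =
      (α_ _ _ _).inv ≫ ((α_ _ _ _).inv ≫ P.xi.hom ▷ P.pi ≫ (λ_ P.pi).hom) ▷ X ≫ F := by
    rw [← cancel_epi (α_ P.pi (P.pi ⊗ P.pi) X).hom, ← cancel_epi ((α_ P.pi P.pi P.pi).hom ▷ X)]
    refine hom_ext₄' fun Γ a b c x => ?_
    simp [ap_comp, ap_piEv, ap_smul]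
  have h2 : (α_ P.pi P.pi P.pi).inv ≫ P.xi.hom ▷ P.pi ≫ (λ_ P.pi).hom =
      P.pi ◁ P.xi.hom ≫ (ρ_ P.pi).hom := by
    rw [ParityStructure.Points.xi_assoc, Iso.inv_hom_id_assoc]
  rw [piFlat, MonoidalCategory.whiskerLeft_comp, MonoidalCategory.whiskerLeft_comp,
    Category.assoc, Category.assoc, h1, h2, associator_inv_naturality_middle_assoc]
  rw [← comp_whiskerRight_assoc, ← MonoidalCategory.whiskerLeft_comp_assoc, Iso.inv_hom_id]
  simp

theorem piEv_cancel {m m' : X ⟶ P.pi ⊗ Y} (e : P.pi ◁ m ≫ piEv P Y = P.pi ◁ m' ≫ piEv P Y) :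
    m = m' := by
  have e1 : P.pi ◁ m = P.pi ◁ m' := by
    have : IsIso (piEv P Y) := by unfold piEv; infer_instance
    rwa [← cancel_mono (piEv P Y)]
  have key : ∀ m : X ⟶ P.pi ⊗ Y, m = (λ_ X).inv ≫ P.xi.inv ▷ X ≫ (α_ _ _ _).hom ≫
      P.pi ◁ (P.pi ◁ m) ≫ (α_ _ _ _).inv ≫ P.xi.hom ▷ _ ≫ (λ_ _).hom := fun m => by
    rw [← associator_naturality_right_assoc, Iso.hom_inv_id_assoc, whisker_exchange_assoc]
    simp
  rw [key m, key m', e1]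

/-- The module `π ⊗ S`. -/
def piAct (S : C) [MonObj S] : S ⊗ (P.pi ⊗ S) ⟶ P.pi ⊗ S :=
  (α_ _ _ _).inv ≫ (β_ _ _).hom ▷ _ ≫ (α_ _ _ _).hom ≫ P.pi ◁ μ

theorem ap_piAct (a s : El Γ S) (b : El Γ P.pi) :
    ap (piAct P S) (pr a (pr b s)) = pr b (a * s) := by
  simp [piAct, ap_comp]

theorem piEv_piAct (b : El Γ P.pi) (a : El Γ S) (m : El Γ (P.pi ⊗ S)) :
    ap (piEv P S) (pr b (ap (piAct P S) (pr a m))) = a * ap (piEv P S) (pr b m) := by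
  have e : P.pi ◁ piAct P S ≫ piEv P S =
      (α_ _ _ _).inv ≫ (β_ _ _).hom ▷ _ ≫ (α_ _ _ _).hom ≫ S ◁ piEv P S ≫ μ :=
    hom_ext₄ fun Γ b a c x => by
      simp [ap_comp, ap_piEv, ap_piAct]
  have := congrArg (fun f => ap f (pr b (pr a m))) e
  simpa only [ap_comp, ap_assoc_inv, ap_assoc_hom, ap_whiskerLeft, ap_whiskerRight, ap_braiding,
    ap_mul] using this

/-- A symmetric family of biderivations of `S` with parameters in `π`, as a cocycle with values
in `π ⊗ S`. Both arguments being derivations, each side of the cocycle identity is the sum of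
`x c(y, z)`, `y c(x, z)` and `z c(x, y)`. -/
def biderCocycle (d : (P.pi ⊗ S) ⊗ S ⟶ S) (hd : IsParamDer d)
    (hsymm : ∀ {Γ : CommComon C} (b : El Γ P.pi) (x y : El Γ S),
      ap d (pr (pr b x) y) = ap d (pr (pr b y) x)) : ModuleCocycle S (P.pi ⊗ S) where
  act := piAct P S
  coc := piFlat P ((α_ _ _ _).inv ≫ d)
  one_act := fun {Γ} m => by
    have e : (λ_ _).inv ≫ η[S] ▷ _ ≫ piAct P S = 𝟙 _ := hom_ext₂ fun Γ b x => by
      simp only [ap_comp, ap_leftUnitor_inv, ap_whiskerRight, ap_one, ap_piAct, one_mul, ap_id]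
    have := congrArg (fun f => ap f m) e
    simpa only [ap_comp, ap_leftUnitor_inv, ap_whiskerRight, ap_one, ap_id] using this
  mul_act := fun {Γ} x y m => by
    have e : (α_ S S _).inv ≫ μ[S] ▷ _ ≫ piAct P S = S ◁ piAct P S ≫ piAct P S :=
      hom_ext₄ fun Γ x y z w => by simp [ap_comp, ap_piAct, mul_assoc]
    have := congrArg (fun f => ap f (pr x (pr y m))) e
    simpa only [ap_comp, ap_assoc_inv, ap_whiskerRight, ap_whiskerLeft, ap_mul] using this
  coc_symm := fun {Γ} x y => by
    have e : piFlat P ((α_ _ _ _).inv ≫ d) = (β_ S S).hom ≫ piFlat P ((α_ _ _ _).inv ≫ d) := by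
      refine piEv_cancel P ?_
      rw [MonoidalCategory.whiskerLeft_comp, Category.assoc, piFlat_piEv]
      refine hom_ext₃ fun Γ b x y => ?_
      simp [ap_comp, hsymm b x y]
    have := congrArg (fun f => ap f (pr x y)) e
    simpa only [ap_comp, ap_braiding] using this
  one_coc := fun {Γ} x => by
    have e : (λ_ S).inv ≫ η[S] ▷ S ≫ piFlat P ((α_ _ _ _).inv ≫ d) = 0 := by
      refine piEv_cancel P ?_
      rw [MonoidalCategory.whiskerLeft_comp, MonoidalCategory.whiskerLeft_comp, Category.assoc,
        Category.assoc, piFlat_piEv]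
      refine hom_ext₂ fun Γ b x => ?_
      have := hd (pr b x) 1 1
      simp only [one_mul, left_eq_add] at this
      simp [ap_comp, hsymm b 1 x, this]
    have := congrArg (fun f => ap f x) e
    simpa only [ap_comp, ap_leftUnitor_inv, ap_whiskerRight, ap_one, zero_ap] using this
  coc_assoc := fun {Γ} x y z => by
    let c := piFlat P ((α_ P.pi S S).inv ≫ d)
    have hc : ∀ {Γ : CommComon C} (b : El Γ P.pi) (x y : El Γ S),
        ap (piEv P S) (pr b (ap c (pr x y))) = ap d (pr (pr b x) y) := fun b x y => by
      rw [← ap_whiskerLeft, ← ap_comp, piFlat_piEv, ap_comp, ap_assoc_inv]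
    have e : (α_ S S S).inv ≫ (β_ (S ⊗ S) S).hom ≫ S ◁ c ≫ piAct P S +
        (α_ S S S).inv ≫ μ ▷ S ≫ c = S ◁ c ≫ piAct P S + S ◁ μ ≫ c := by
      refine piEv_cancel P (hom_ext₄ fun Γ b x y z => ?_)
      have h1 := hd (pr b z) x y
      simp [ap_comp, add_ap, piEv_piAct, hc, hd (pr b x) y z,
        hsymm b (x * y) z, h1, hsymm b z]
      ring
    have := congrArg (fun f => ap f (pr x (pr y z))) e
    simpa only [ap_comp, add_ap, ap_assoc_inv, ap_whiskerRight, ap_whiskerLeft, ap_mul,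
      ap_braiding] using this

variable [HasColimits C] [∀ X : C, PreservesColimits (tensorLeft X)]

/-- An odd operator of order two on a free commutative monoid that vanishes on the unit and on the
generators can be prescribed on products of two generators. -/
theorem exists_isDiffOp_two (hj : IsFreeCommMon j) (φ : P.pi ⊗ (h ⊗ h) ⟶ S)
    (hφ : ∀ {Γ : CommComon C} (b : El Γ P.pi) (x y : El Γ h),
      ap φ (pr b (pr x y)) = ap φ (pr b (pr y x))) :
    ∃ D : P.pi ⊗ S ⟶ S, IsDiffOp 2 D ∧ P.pi ◁ η ≫ D = 0 ∧ P.pi ◁ j ≫ D = 0 ∧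
      P.pi ◁ ((j ⊗ₘ j) ≫ μ) ≫ D = φ := by
  obtain ⟨d, hd, hsymm, hdφ⟩ := exists_biderivation hj φ hφ
  -- the bracket of `D` is to be `d`, so `D` is a derivation up to the cocycle `d`
  obtain ⟨g, ⟨hg, hjg⟩, -⟩ := (biderCocycle P d hd hsymm).existsUnique_isTwisted hj 0
  let D : P.pi ⊗ S ⟶ S := P.pi ◁ g ≫ piEv P S
  have hD : ∀ {Γ : CommComon C} (b : El Γ P.pi) (x : El Γ S),
      ap D (pr b x) = ap (piEv P S) (pr b (ap g x)) := fun b x => by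
    simp only [D, ap_comp, ap_whiskerLeft]
  have hmul : ∀ {Γ : CommComon C} (b : El Γ P.pi) (x y : El Γ S),
      bracket D b x y = ap d (pr (pr b x) y) := fun b x y => by
    have h1 : ap (piEv P S) (pr b (ap (biderCocycle P d hd hsymm).coc (pr x y))) =
        ap d (pr (pr b x) y) := by
      rw [← ap_whiskerLeft, ← ap_comp]
      simp only [biderCocycle]
      rw [piFlat_piEv, ap_comp, ap_assoc_inv]
    rw [bracket, hD, hg, pr_add_right, pr_add_right, ap_add, ap_add, h1]
    simp only [biderCocycle, piEv_piAct, hD]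
    ring
  have hj0 : ∀ {Γ : CommComon C} (b : El Γ P.pi) (x : El Γ h), ap D (pr b (ap j x)) = 0 :=
    fun b x => by rw [hD, ← ap_comp, hjg]; simp
  refine ⟨D, isDiffOp_two_of_bracket fun b x y z => ?_, ?_, ?_, ?_⟩
  · rw [hmul, hmul, hmul, hd]
  · refine hom_ext₂ fun Γ b s => ?_
    have h1 := hmul b 1 1
    have h2 := hd (pr b 1) (1 : El Γ S) 1
    simp only [one_mul, left_eq_add] at h2
    simp only [h2, bracket, one_mul, sub_self, zero_sub, neg_eq_zero] at h1
    simp [ap_comp, ap_unit, pr_smul_right, ap_smul, h1, smul_zero_el]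
  · exact hom_ext₂ fun Γ b x => by simp [ap_comp, hj0]
  · refine hom_ext₃ fun Γ b x y => ?_
    simp [ap_comp, ap_mul_eq_bracket D, hj0, hmul, hdφ]

/-- An odd operator of order two on a free commutative monoid is determined by its values on the
unit, the generators and products of two generators. -/
theorem eq_of_isDiffOp_two (hj : IsFreeCommMon j) {D D' : B ⊗ S ⟶ S} (hD : IsDiffOp 2 D)
    (hD' : IsDiffOp 2 D') (h1 : B ◁ η ≫ D = 0) (h1' : B ◁ η ≫ D' = 0)
    (h2 : B ◁ j ≫ D = B ◁ j ≫ D')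
    (h3 : B ◁ ((j ⊗ₘ j) ≫ μ) ≫ D = B ◁ ((j ⊗ₘ j) ≫ μ) ≫ D') : D = D' := by
  have e2 : ∀ {Γ : CommComon C} (b : El Γ B) (x : El Γ h),
      ap D (pr b (ap j x)) = ap D' (pr b (ap j x)) := fun b x => by
    rw [← ap_whiskerLeft, ← ap_comp, h2, ap_comp]
  have e3 : ∀ {Γ : CommComon C} (b : El Γ B) (x y : El Γ h),
      ap D (pr b (ap j x * ap j y)) = ap D' (pr b (ap j x * ap j y)) := fun b x y => by
    have := congrArg (fun f => ap f (pr b (pr x y))) h3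
    simpa [ap_comp] using this
  -- the difference of the brackets is a biderivation that vanishes on pairs of generators
  let F := bracketHom D - bracketHom D'
  have hF : ∀ {Γ : CommComon C} (b : El Γ B) (x y : El Γ S),
      ap F (pr (pr b x) y) = bracket D b x y - bracket D' b x y := fun b x y => by
    rw [sub_ap, ap_bracketHom, ap_bracketHom]
  have hFmul : ∀ {Γ : CommComon C} (b : El Γ B) (x y z : El Γ S),
      ap F (pr (pr b x) (y * z)) = y * ap F (pr (pr b x) z) + z * ap F (pr (pr b x) y) :=
    fun b x y z => by
      rw [hF, hF, hF, hD.bracket_mul_right h1, hD'.bracket_mul_right h1']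
      ring
  have hFder : IsParamDer F := fun {Γ} w x y => by
    have e : (B ⊗ S) ◁ μ ≫ F = (B ⊗ S) ◁ (β_ S S).hom ≫ (α_ _ _ _).inv ≫ F ▷ S ≫ μ +
        (α_ _ _ _).inv ≫ F ▷ S ≫ μ := hom_ext₂₂ fun Γ b x y z => by
      simp [ap_comp, add_ap, hFmul]
      ring
    have := congrArg (fun f => ap f (pr w (pr x y))) e
    simp only [ap_comp, add_ap, ap_whiskerLeft, ap_whiskerRight, ap_braiding, ap_assoc_inv,
      ap_mul] at this
    rw [this, mul_comm x, mul_comm y]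
  have hFj : (B ◁ j) ▷ S ≫ F = 0 := by
    refine IsParamDer.eq_zero hj (IsParamDer.comp hFder _) ?_
    refine hom_ext₃' fun Γ b x y => ?_
    simp [ap_comp, hF, bracket, e2, e3]
  have hF0 : F = 0 := by
    refine IsParamDer.eq_zero hj hFder (hom_ext₃' fun Γ b x y => ?_)
    have := congrArg (fun f => ap f (pr (pr b y) x)) hFj
    simp only [ap_comp, ap_whiskerRight, ap_whiskerLeft, hF, zero_ap] at this ⊢
    rw [bracket_comm D, bracket_comm D', this]
  have hbr : ∀ {Γ : CommComon C} (b : El Γ B) (x y : El Γ S),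
      bracket D b x y = bracket D' b x y := fun b x y => by
    rw [← sub_eq_zero, ← hF, hF0, zero_ap]
  -- the brackets agree, so the difference of the operators is a derivation
  rw [← sub_eq_zero]
  refine IsParamDer.eq_zero hj (fun b x y => ?_) (hom_ext₂ fun Γ b x => ?_)
  · simp only [sub_ap, ap_mul_eq_bracket D, ap_mul_eq_bracket D', hbr]
    ring
  · simp [ap_comp, sub_ap, e2]

end Parity

end SecondOrder

section Paths

open scoped ComonObj MonObj
open DualisableWithInvolution

set_option linter.unusedSectionVars false

variable {C : Type u} [Category.{v} C] [Preadditive C] [MonoidalCategory C] [SymmetricCategory C]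
  [MonoidalPreadditive C] [HasBinaryBiproducts C] {P : ParityStructure C} {Γ : CommComon C}

/-! ### Odd involutions -/

theorem pr_pi_swap (b c : El Γ P.pi) : pr b c = -pr c b := by
  rw [← ap_braiding c b, P.braiding_eq, neg_ap, ap_id]

theorem smul_comm_unit (a b : El Γ (𝟙_ C)) : a • b = b • a := by
  rw [← ap_leftUnitor, ← ap_rightUnitor, unitors_equal]

theorem xi_swap (b c : El Γ P.pi) : ap P.xi.hom (pr b c) = -ap P.xi.hom (pr c b) := by
  rw [pr_pi_swap, ap_neg]

/-- The odd involution on elements. -/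
def oddInv (x : DualisableWithInvolution P) (b : El Γ P.pi) (y : El Γ x.obj) : El Γ x.obj :=
  ap x.inv (pr b y)

/-- The dual odd involution on elements. -/
def oddInvDual (x : DualisableWithInvolution P) (b : El Γ P.pi) (y : El Γ x.dual) : El Γ x.dual :=
  ap x.dualInv (pr b y)

variable {Θ : CommComon C}

@[simp] theorem sb_oddInv (σ : Sub Θ Γ) (x : DualisableWithInvolution P) (b : El Γ P.pi)
    (y : El Γ x.obj) : sb σ (oddInv x b y) = oddInv x (sb σ b) (sb σ y) := by
  rw [oddInv, oddInv, sb_ap, sb_pr]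

@[simp] theorem sb_oddInvDual (σ : Sub Θ Γ) (x : DualisableWithInvolution P) (b : El Γ P.pi)
    (y : El Γ x.dual) : sb σ (oddInvDual x b y) = oddInvDual x (sb σ b) (sb σ y) := by
  rw [oddInvDual, oddInvDual, sb_ap, sb_pr]

theorem oddInv_oddInv (x : DualisableWithInvolution P) (b c : El Γ P.pi) (y : El Γ x.obj) :
    oddInv x b (oddInv x c y) = ap P.xi.hom (pr b c) • y := by
  have h := congrArg Prod.fst x.inv_sq
  have h' : (λ_ x.obj).inv ≫ P.xi.inv ▷ x.obj ≫ (α_ P.pi P.pi x.obj).hom ≫ P.pi ◁ x.inv ≫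
      x.inv = 𝟙 x.obj := by simpa [ParityStructure.scomp] using h
  have e : P.pi ◁ x.inv ≫ x.inv = (α_ _ _ _).inv ≫ P.xi.hom ▷ x.obj ≫ (λ_ x.obj).hom := by
    have := congrArg (fun f => (α_ _ _ _).inv ≫ P.xi.hom ▷ x.obj ≫ (λ_ x.obj).hom ≫ f) h'
    simpa using this
  have := congrArg (fun f => ap f (pr b (pr c y))) e
  simpa [oddInv, ap_comp] using this

/-- The dual involution on elements: `y` is evaluated on the involution of a variable running
through the coevaluation. -/
theorem oddInvDual_eq_contr (x : DualisableWithInvolution P) (b : El Γ P.pi) (y : El Γ x.dual) :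
    oddInvDual x b y = contr x (ap x.ev (pr (wk x y) (oddInv x (wk x b) (gen x))) • genDual x) := by
  have e : contr x (pr (pr (wk x y) (wk x b)) (pr (gen x) (genDual x))) =
      pr (pr y b) (ap x.coev 1) := by
    rw [← sb_pr, contr_pr_left, contr_gen]
  have h : ap x.ev (pr (wk x y) (oddInv x (wk x b) (gen x))) • genDual x =
      ap ((α_ x.dual P.pi (x.obj ⊗ x.dual)).hom ≫ x.dual ◁ (α_ P.pi x.obj x.dual).inv ≫
      x.dual ◁ (x.inv ▷ x.dual) ≫ (α_ x.dual x.obj x.dual).inv ≫ x.ev ▷ x.dual ≫ (λ_ x.dual).hom)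
      (pr (pr (wk x y) (wk x b)) (pr (gen x) (genDual x))) := by
    simp [ap_comp, oddInv]
  rw [h, contr_ap, e]
  simp [oddInvDual, dualInv, ap_comp]

/-- The dual involution is adjoint to the involution. -/
theorem ev_oddInvDual (x : DualisableWithInvolution P) (b : El Γ P.pi) (y : El Γ x.dual)
    (z : El Γ x.obj) : ap x.ev (pr (oddInvDual x b y) z) = ap x.ev (pr y (oddInv x b z)) := by
  rw [oddInvDual_eq_contr, ← contr_pr_right, ← contr_ap]
  simp only [pr_smul_left, ap_smul]
  conv_lhs => enter [2]; rw [smul_comm_unit, oddInv, ← ap_smul, ← pr_smul_right, ← ap_smul,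
    ← pr_smul_right]
  rw [contr_ap, contr_pr_left, contr_ap, contr_pr_left, contr_ev_smul_gen, oddInv]

/-- The coevaluation is invariant under moving the involution from one half to the other. -/
theorem contr_oddInv (x : DualisableWithInvolution P) (b : El Γ P.pi) :
    contr x (pr (oddInv x (wk x b) (gen x)) (genDual x)) =
      contr x (pr (gen x) (oddInvDual x (wk x b) (genDual x))) := by
  have e : pr (gen x) (oddInvDual x (wk x b) (genDual x)) = contr (Γ := bindCtx Γ x) x
      (ap x.ev (pr (wk x (genDual x)) (oddInv x (wk x (wk x b)) (gen x))) •
        pr (wk x (gen x)) (genDual x)) := by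
    rw [oddInvDual_eq_contr, ← contr_pr_left]
    simp only [pr_smul_right]
  rw [e, contr_comm]
  congr 1
  simp only [sb_smul, sb_ap, sb_pr, sb_oddInv, sb_exch_wk_wk, sb_exch_wk_gen, sb_exch_wk_genDual,
    sb_exch_gen, sb_exch_genDual]
  rw [← contr_ev_smul_gen x (oddInv x (wk x b) (gen x)), ← contr_pr_right]
  simp only [pr_smul_left, sb_oddInv]

/-- An odd involution can be moved through a contraction. -/
theorem contr_slide (x : DualisableWithInvolution P) {X Y : C} (G : X ⊗ (x.obj ⊗ x.dual) ⟶ Y)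
    (w : El Γ X) (b : El Γ P.pi) :
    contr x (ap G (pr (wk x w) (pr (oddInv x (wk x b) (gen x)) (genDual x)))) =
      contr x (ap G (pr (wk x w) (pr (gen x) (oddInvDual x (wk x b) (genDual x))))) := by
  rw [contr_ap, contr_ap, contr_pr_left, contr_pr_left, contr_oddInv]

end Paths

/-! ### Paths -/

theorem IsPath.append {V E : Type*} {s t : E → V} {i m k : V} {w w' : List (E × Bool)}
    (h : IsPath s t i w m) (h' : IsPath s t m w' k) : IsPath s t i (w ++ w') k := by
  induction w generalizing i with
  | nil => obtain rfl : i = m := h; exact h'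
  | cons a w ih => exact ⟨h.1, ih h.2⟩

theorem IsPath.exists_of_append {V E : Type*} {s t : E → V} {i k : V} {u v : List (E × Bool)}
    (h : IsPath s t i (u ++ v) k) : ∃ m, IsPath s t i u m ∧ IsPath s t m v k := by
  induction u generalizing i with
  | nil => exact ⟨i, rfl, h⟩
  | cons a u ih =>
    obtain ⟨m, h1, h2⟩ := ih h.2
    exact ⟨m, ⟨h.1, h1⟩, h2⟩

theorem IsPath.of_decomp {V E : Type*} {s t : E → V} {i k : V} {u v : List (E × Bool)}
    {a : E × Bool} (h : IsPath s t i (u ++ a :: v) k) :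
    IsPath s t i u (src s t a) ∧ IsPath s t (tgt s t a) v k := by
  obtain ⟨m, h1, rfl, h2⟩ := h.exists_of_append
  exact ⟨h1, h2⟩

section PathElements

open scoped ComonObj MonObj
open DualisableWithInvolution

set_option linter.unusedSectionVars false

variable {C : Type u} [Category.{v} C] [Preadditive C] [MonoidalCategory C] [SymmetricCategory C]
  [MonoidalPreadditive C] [HasBinaryBiproducts C] [HasColimits C]
  {P : ParityStructure C} {Γ Θ : CommComon C}
  {V E : Type*} [Finite E] (s t : E → V) (c : V → DualisableWithInvolution P)
  {S : C} [MonObj S] [IsCommMonObj S] (j : hTilde s t c ⟶ S)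

/-! ### Functions attached to paths -/

/-- The value of the coordinate function of an arrow on elements. -/
noncomputable def coordEl (a : E × Bool) (x : El Γ (c (src s t a)).obj)
    (y : El Γ (c (tgt s t a)).dual) : El Γ S :=
  ap (coord s t c j a) (pr x y)

/-- The value of the function attached to a path on elements. -/
noncomputable def pathEl (i : V) (w : List (E × Bool)) (k : V) (x : El Γ (c i).obj)
    (y : El Γ (c k).dual) : El Γ S :=
  ap (pathMap s t c j i w k) (pr x y)

theorem ap_pathMap (i : V) (w : List (E × Bool)) (k : V) (x : El Γ (c i).obj)
    (y : El Γ (c k).dual) :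
    ap (pathMap s t c j i w k) (pr x y) = pathEl s t c j i w k x y := rfl

@[simp] theorem sb_coordEl (σ : Sub Θ Γ) (a : E × Bool) (x : El Γ (c (src s t a)).obj)
    (y : El Γ (c (tgt s t a)).dual) :
    sb σ (coordEl s t c j a x y) = coordEl s t c j a (sb σ x) (sb σ y) := by
  rw [coordEl, coordEl, sb_ap, sb_pr]

@[simp] theorem sb_pathEl (σ : Sub Θ Γ) (i : V) (w : List (E × Bool)) (k : V)
    (x : El Γ (c i).obj) (y : El Γ (c k).dual) :
    sb σ (pathEl s t c j i w k x y) = pathEl s t c j i w k (sb σ x) (sb σ y) := by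
  rw [pathEl, pathEl, sb_ap, sb_pr]

theorem pathEl_nil (i : V) (x : El Γ (c i).obj) (y : El Γ (c i).dual) :
    pathEl s t c j i [] i x y = ap (c i).ev (pr y x) • 1 := by
  simp [pathEl, pathMap, ap_comp, ap_unit]

theorem pathEl_cons (a : E × Bool) (w : List (E × Bool)) (k : V) (x : El Γ (c (src s t a)).obj)
    (y : El Γ (c k).dual) :
    pathEl s t c j (src s t a) (a :: w) k x y = contr (c (tgt s t a))
      (coordEl s t c j a (wk _ x) (genDual _) *
        pathEl s t c j (tgt s t a) w k (gen _) (wk _ y)) := by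
  have e : coordEl s t c j a (wk (c (tgt s t a)) x) (genDual _) *
        pathEl s t c j (tgt s t a) w k (gen _) (wk _ y) =
      ap ((c (src s t a)).obj ◁ (α_ _ _ _).hom ≫ (α_ _ _ _).inv ≫
        (coord s t c j a ⊗ₘ pathMap s t c j (tgt s t a) w k) ≫ μ)
        (pr (wk (c (tgt s t a)) x) (pr (pr (genDual _) (gen _)) (wk (c (tgt s t a)) y))) := by
    simp [coordEl, pathEl, ap_comp]
  rw [e, contr_ap, contr_pr_left, contr_pr_right, contr_gen_dual]
  simp only [pathEl, pathMap, dite_true, eqToHom_refl, Category.id_comp, split, ap_comp,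
    ap_whiskerLeft, ap_whiskerRight, ap_leftUnitor_inv]

theorem pathEl_append {i m : V} {u : List (E × Bool)} (h : IsPath s t i u m)
    (w : List (E × Bool)) (k : V) (x : El Γ (c i).obj) (y : El Γ (c k).dual) :
    pathEl s t c j i (u ++ w) k x y = contr (c m)
      (pathEl s t c j i u m (wk _ x) (genDual _) * pathEl s t c j m w k (gen _) (wk _ y)) := by
  induction u generalizing i Γ with
  | nil =>
    obtain rfl : i = m := h
    simp only [pathEl_nil, smul_mul_el, one_mul, List.nil_append]
    conv_lhs => rw [← contr_ev_smul_gen (c i) x, pathEl, ← contr_pr_right, ← contr_ap]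
    simp only [pr_smul_left, ap_smul, pathEl]
  | cons a u ih =>
    obtain ⟨rfl, h⟩ := h
    simp only [List.cons_append, pathEl_cons, ih h, ← contr_mul_left, ← contr_mul_right]
    rw [contr_comm]
    simp [mul_assoc]

/-- The defining relation of the coequaliser `h̃_a^∨`. -/
theorem coordEl_oddInv (a : E × Bool) (b : El Γ P.pi) (x : El Γ (c (src s t a)).obj)
    (y : El Γ (c (tgt s t a)).dual) :
    coordEl s t c j a (oddInv _ b x) y = coordEl s t c j a x (oddInvDual _ b y) := by
  have e : invLeft (c (src s t a)) (c (tgt s t a)) ≫ coord s t c j a =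
      invRight (c (src s t a)) (c (tgt s t a)) ≫ coord s t c j a := by
    rw [coord, coequalizer.condition_assoc]
  have := congrArg (fun f => ap f (pr b (pr x y))) e
  simpa [ap_comp, invLeft, invRight, coordEl, oddInv, oddInvDual] using this

/-- An odd involution slides through the contraction of a product of two functions. -/
theorem contr_slide_mul (z : DualisableWithInvolution P) {X Y : C} (f : X ⊗ z.dual ⟶ S)
    (g : z.obj ⊗ Y ⟶ S) (x : El Γ X) (y : El Γ Y) (b : El Γ P.pi) :
    contr z (ap f (pr (wk z x) (genDual z)) * ap g (pr (oddInv z (wk z b) (gen z)) (wk z y))) =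
      contr z (ap f (pr (wk z x) (oddInvDual z (wk z b) (genDual z))) *
        ap g (pr (gen z) (wk z y))) := by
  let G : (X ⊗ Y) ⊗ (z.obj ⊗ z.dual) ⟶ S :=
    (X ⊗ Y) ◁ (β_ _ _).hom ≫ tensorμ X Y z.dual z.obj ≫ (f ⊗ₘ (β_ _ _).hom ≫ g) ≫ μ
  have hG : ∀ {Γ : CommComon C} (x : El Γ X) (y : El Γ Y) (u : El Γ z.obj) (v : El Γ z.dual),
      ap G (pr (pr x y) (pr u v)) = ap f (pr x v) * ap g (pr u y) := fun x y u v => by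
    simp [G, ap_comp, tensorμ]
  have := contr_slide z G (pr x y) b
  simpa only [sb_pr, hG] using this

/-- The function attached to a path is invariant under the odd involutions. -/
theorem pathEl_oddInv (i : V) (w : List (E × Bool)) (k : V) (b : El Γ P.pi)
    (x : El Γ (c i).obj) (y : El Γ (c k).dual) :
    pathEl s t c j i w k (oddInv _ b x) y = pathEl s t c j i w k x (oddInvDual _ b y) := by
  induction w generalizing i Γ with
  | nil =>
    by_cases h : i = k
    · subst h
      rw [pathEl_nil, pathEl_nil, ev_oddInvDual]
    · simp [pathEl, pathMap, h]
  | cons a w ih =>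
    by_cases h : i = src s t a
    · subst h
      simp only [pathEl_cons, sb_oddInv, sb_oddInvDual, coordEl_oddInv, ← ih]
      exact (contr_slide_mul _ _ _ _ _ _).symm
    · simp [pathEl, pathMap, h]

/-- The odd trace of a closed path, evaluated on elements. -/
noncomputable def otrEl (i : V) (w : List (E × Bool)) (b : El Γ P.pi) : El Γ S :=
  contr (c i) (pathEl s t c j i w i (oddInv _ (wk _ b) (gen _)) (genDual _))

/-- The odd trace is invariant under rotation. -/
theorem otrEl_append_comm {i m : V} {u w : List (E × Bool)} (hu : IsPath s t i u m)
    (hw : IsPath s t m w i) (b : El Γ P.pi) :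
    otrEl s t c j i (u ++ w) b = otrEl s t c j m (w ++ u) b := by
  simp only [otrEl, pathEl_append s t c j hu, pathEl_append s t c j hw]
  rw [contr_comm]
  congr 1
  simp only [sb_mul, sb_pathEl, sb_oddInv, sb_oddInvDual, pathEl_oddInv,
    sb_exch_wk_wk, sb_exch_wk_gen, sb_exch_wk_genDual, sb_exch_gen, sb_exch_genDual]
  -- the involution has to pass from the vertex `i` through the path `w` to the vertex `m`
  have h := contr_slide_mul (c i) (pathMap s t c j m w i) (pathMap s t c j i u m)
    (gen (Γ := Γ) (c m)) (genDual (c m)) (wk _ b)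
  simp only [ap_pathMap] at h
  simp only [pathEl_oddInv] at h
  exact (congrArg (contr (c i)) (mul_comm _ _)).trans h

/-- The even trace of a closed path vanishes: written with two odd involutions, one of which slides
around the loop, it changes its sign. -/
theorem contr_pathEl_eq_zero (h2 : ∀ {X Y : C} (f : X ⟶ Y), f = -f → f = 0) (i : V)
    (w : List (E × Bool)) : contr (Γ := Γ) (c i) (pathEl s t c j i w i (gen _) (genDual _)) = 0 := by
  have h : ∀ Γ : CommComon C, contr (Γ := Γ) (c i) (pathEl s t c j i w i (gen _) (genDual _)) =
      ap ((c i).coev ≫ pathMap s t c j i w i) (1 : El Γ (𝟙_ C)) := fun Γ => by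
    simp only [pathEl]
    rw [contr_ap, contr_gen, ap_comp]
  have key : P.xi.hom ≫ (c i).coev ≫ pathMap s t c j i w i = 0 := by
    refine h2 _ (hom_ext₂ fun Γ b b' => ?_)
    have e : ∀ b b' : El Γ P.pi, ap (P.xi.hom ≫ (c i).coev ≫ pathMap s t c j i w i) (pr b b') =
        contr (c i) (pathEl s t c j i w i
          (oddInv _ (wk _ b) (oddInv _ (wk _ b') (gen _))) (genDual _)) := fun b b' => by
      simp only [oddInv_oddInv, pathEl, pr_smul_left, ap_smul]
      rw [← sb_pr, ← sb_ap, contr_smul_left, contr_ap, contr_gen, ← ap_smul, ← ap_smul,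
        smul_comm_unit, one_smul_el, ap_comp, ap_comp]
    -- sliding the inner involution around the loop makes it the outer one
    have e' : contr (c i) (pathEl s t c j i w i
          (oddInv _ (wk _ b) (oddInv _ (wk _ b') (gen _))) (genDual _)) =
        contr (c i) (pathEl s t c j i w i
          (oddInv _ (wk _ b') (oddInv _ (wk _ b) (gen _))) (genDual _)) := by
      have h := contr_slide (c i) ((α_ _ _ _).inv ≫ (c i).inv ▷ (c i).dual ≫
        pathMap s t c j i w i) b' b
      simp only [ap_comp, ap_assoc_inv, ap_whiskerRight] at h
      rw [pathEl_oddInv]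
      exact h.symm
    rw [neg_ap, ← ap_neg, ← pr_pi_swap b' b, e, e', ← e]
  have h0 : (c i).coev ≫ pathMap s t c j i w i = 0 :=
    (cancel_epi P.xi.hom).mp (key.trans comp_zero.symm)
  rw [h, h0, zero_ap]

end PathElements

section Phi

open scoped ComonObj MonObj
open DualisableWithInvolution

set_option linter.unusedSectionVars false

variable {C : Type u} [Category.{v} C] [Preadditive C] [MonoidalCategory C] [SymmetricCategory C]
  [MonoidalPreadditive C] [HasBinaryBiproducts C] [HasColimits C]
  {P : ParityStructure C} {Γ Θ : CommComon C}
  {V E : Type*} [Finite E] (s t : E → V) (c : V → DualisableWithInvolution P)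
  {S : C} [MonObj S] [IsCommMonObj S] (j : hTilde s t c ⟶ S) (σ : Variant)

/-! ### The quadratic map on the representation side -/

/-- The path which `φ^±` inserts between the source of `a` and the target of `b`. -/
def link : Variant → E × Bool → E × Bool → List (E × Bool)
  | .minus, _, _ => []
  | .plus, a, b => [a, b]

theorem isPath_link {s t : E → V} {a b : E × Bool} (h : pairing a b ≠ 0) :
    IsPath s t (src s t a) (link σ a b) (tgt s t b) := by
  have h' : pairing b a ≠ 0 := by rwa [pairing_swap, neg_ne_zero]
  cases σ
  · exact src_eq_tgt_of_pairing_ne_zero s t h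
  · exact ⟨rfl, (src_eq_tgt_of_pairing_ne_zero s t h').symm, rfl⟩

theorem ap_phi (a b : E × Bool) (β : El Γ P.pi) (x : El Γ (c (src s t a)).obj)
    (y : El Γ (c (tgt s t a)).dual) (z : El Γ (c (src s t b)).obj)
    (w : El Γ (c (tgt s t b)).dual) :
    ap (phi s t c j σ a b) (pr β (pr (pr x y) (pr z w))) = pairing a b •
      (pathEl s t c j (src s t a) (link σ a b) (tgt s t b) (oddInv _ β x) w *
          pathEl s t c j (src s t b) (link σ b a) (tgt s t a) z y -
        pathEl s t c j (src s t a) (link σ a b) (tgt s t b) x w *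
          pathEl s t c j (src s t b) (link σ b a) (tgt s t a) z (oddInvDual _ β y)) := by
  cases σ <;>
  simp only [phi, zsmul_ap, ap_comp, ap_assoc_inv, ap_assoc_hom, ap_whiskerRight, ap_whiskerLeft,
    chord, sub_ap, invLeft, invRight, ap_braiding, pr_sub_left, ap_sub, swap₂₄, ap_tensorHom,
    ap_mul, ap_pathMap, link, oddInv, oddInvDual]

/-- Exchanging the odd parameters of two involutions changes the sign. -/
theorem oddInv_mul_oddInv_swap {x y : DualisableWithInvolution P} {X Y : C} (f : x.obj ⊗ X ⟶ S)
    (g : y.obj ⊗ Y ⟶ S) (β β' : El Γ P.pi) (p : El Γ x.obj) (u : El Γ X) (q : El Γ y.obj)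
    (v : El Γ Y) :
    ap f (pr (oddInv x β p) u) * ap g (pr (oddInv y β' q) v) =
      -(ap f (pr (oddInv x β' p) u) * ap g (pr (oddInv y β q) v)) := by
  let G : (P.pi ⊗ P.pi) ⊗ ((x.obj ⊗ X) ⊗ (y.obj ⊗ Y)) ⟶ S :=
    tensorμ _ _ _ _ ≫ (((α_ _ _ _).inv ≫ x.inv ▷ X ≫ f) ⊗ₘ ((α_ _ _ _).inv ≫ y.inv ▷ Y ≫ g)) ≫ μ
  have hG : ∀ β β' : El Γ P.pi, ap G (pr (pr β β') (pr (pr p u) (pr q v))) =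
      ap f (pr (oddInv x β p) u) * ap g (pr (oddInv y β' q) v) := fun β β' => by
    simp [G, tensorμ, ap_comp, oddInv]
  rw [← hG, ← hG, pr_pi_swap, pr_neg_left, ap_neg]

theorem pathEl_oddInv_oddInv (i : V) (w : List (E × Bool)) (k : V) (β β' : El Γ P.pi)
    (x : El Γ (c i).obj) (y : El Γ (c k).dual) :
    pathEl s t c j i w k (oddInv _ β (oddInv _ β' x)) y =
      ap P.xi.hom (pr β β') • pathEl s t c j i w k x y := by
  rw [oddInv_oddInv, pathEl, pr_smul_left, ap_smul, pathEl]

theorem pathEl_oddInv_mul_swap (i k i' k' : V) (w w' : List (E × Bool)) (β β' : El Γ P.pi)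
    (x : El Γ (c i).obj) (y : El Γ (c k).dual) (x' : El Γ (c i').obj) (y' : El Γ (c k').dual) :
    pathEl s t c j i w k (oddInv _ β x) y * pathEl s t c j i' w' k' (oddInv _ β' x') y' =
      -(pathEl s t c j i w k (oddInv _ β' x) y * pathEl s t c j i' w' k' (oddInv _ β x') y') :=
  oddInv_mul_oddInv_swap _ _ _ _ _ _ _ _

/-- `φ^±` is symmetric: the exchange of `a` and `b` changes the sign of the pairing and that of the
odd chord. -/
theorem phi_symm (a b : E × Bool) (β : El Γ P.pi)
    (X : El Γ (hom (c (src s t a)) (c (tgt s t a))))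
    (Y : El Γ (hom (c (src s t b)) (c (tgt s t b)))) :
    ap (phi s t c j σ a b) (pr β (pr X Y)) = ap (phi s t c j σ b a) (pr β (pr Y X)) := by
  have e : phi s t c j σ a b = P.pi ◁ (β_ _ _).hom ≫ phi s t c j σ b a := by
    refine hom_ext₁₂₂ fun Γ β x y z w => ?_
    rw [ap_comp, ap_whiskerLeft, ap_braiding, ap_phi, ap_phi, pairing_swap, neg_smul, ← smul_neg]
    simp only [pathEl_oddInv]
    congr 1
    ring
  rw [e, ap_comp, ap_whiskerLeft, ap_braiding]

/-- `φ^±` is compatible with the odd involutions on its second argument. -/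
theorem whiskerLeft_invLeft_phi (a b : E × Bool) :
    (P.pi ⊗ hom (c (src s t a)) (c (tgt s t a))) ◁ invLeft (c (src s t b)) (c (tgt s t b)) ≫
        (α_ _ _ _).hom ≫ phi s t c j σ a b =
      (P.pi ⊗ hom (c (src s t a)) (c (tgt s t a))) ◁ invRight (c (src s t b)) (c (tgt s t b)) ≫
        (α_ _ _ _).hom ≫ phi s t c j σ a b := by
  refine hom_ext₃₃ fun Γ β x y β' z w => ?_
  have h1 : ap (invLeft (c (src s t b)) (c (tgt s t b))) (pr β' (pr z w)) =
      pr (oddInv _ β' z) w := by simp [invLeft, ap_comp, oddInv]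
  have h2 : ap (invRight (c (src s t b)) (c (tgt s t b))) (pr β' (pr z w)) =
      pr z (oddInvDual _ β' w) := by simp [invRight, ap_comp, oddInvDual]
  simp only [ap_comp, ap_whiskerLeft, h1, h2, ap_assoc_hom, ap_phi]
  congr 1
  simp only [← pathEl_oddInv, pathEl_oddInv_oddInv]
  rw [pathEl_oddInv_mul_swap, xi_swap β β', neg_smul_el, smul_mul_el, mul_neg, mul_smul_el]
  ring

section Descent

variable [∀ X : C, PreservesColimits (tensorLeft X)]

section Coproduct

variable {I : Type*} [Finite I] (F : I → C) {B X : C}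

theorem whiskerLeft_sigma_hom_ext {f g : B ⊗ ∐ F ⟶ X}
    (h : ∀ i, B ◁ Sigma.ι F i ≫ f = B ◁ Sigma.ι F i ≫ g) : f = g :=
  (isColimitOfPreserves (tensorLeft B) (colimit.isColimit (Discrete.functor F))).hom_ext
    fun ⟨i⟩ => h i

theorem exists_whiskerLeft_sigma_desc (f : ∀ i, B ⊗ F i ⟶ X) :
    ∃ g : B ⊗ ∐ F ⟶ X, ∀ i, B ◁ Sigma.ι F i ≫ g = f i :=
  let H := isColimitOfPreserves (tensorLeft B) (colimit.isColimit (Discrete.functor F))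
  ⟨H.desc (Cocone.mk X (Discrete.natTrans fun ⟨i⟩ => f i)), fun i => H.fac _ ⟨i⟩⟩

end Coproduct

/-- The projection `h_a^∨ ⟶ h̃_a^∨`. -/
noncomputable def projTilde (a : E × Bool) :
    hom (c (src s t a)) (c (tgt s t a)) ⟶ hTildeArrow s t c a :=
  coequalizer.π (invLeft (c (src s t a)) (c (tgt s t a)))
      (invRight (c (src s t a)) (c (tgt s t a)))

/-- The morphism `h_a^∨ ⟶ h̃^∨`. -/
noncomputable def toTilde (a : E × Bool) :
    hom (c (src s t a)) (c (tgt s t a)) ⟶ hTilde s t c :=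
  projTilde s t c a ≫ Sigma.ι (fun a : E × Bool => hTildeArrow s t c a) a

theorem toTilde_comp (a : E × Bool) : toTilde s t c a ≫ j = coord s t c j a :=
  Category.assoc _ _ _

theorem hTilde_hom_ext {B X : C} {f g : B ⊗ hTilde s t c ⟶ X}
    (h : ∀ a, B ◁ toTilde s t c a ≫ f = B ◁ toTilde s t c a ≫ g) : f = g := by
  refine whiskerLeft_sigma_hom_ext (fun a : E × Bool => hTildeArrow s t c a) fun a => ?_
  have : Epi (B ◁ projTilde s t c a) := epi_whiskerLeft_coequalizer B _ _
  rw [← cancel_epi (B ◁ projTilde s t c a)]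
  exact (MonoidalCategory.whiskerLeft_comp_assoc _ _ _ _).symm.trans
    ((h a).trans (MonoidalCategory.whiskerLeft_comp_assoc _ _ _ _))

theorem exists_hTilde_desc {B X : C}
    (f : ∀ a : E × Bool, B ⊗ hom (c (src s t a)) (c (tgt s t a)) ⟶ X)
    (hf : ∀ a, B ◁ invLeft (c (src s t a)) (c (tgt s t a)) ≫ f a =
      B ◁ invRight (c (src s t a)) (c (tgt s t a)) ≫ f a) :
    ∃ g : B ⊗ hTilde s t c ⟶ X, ∀ a, B ◁ toTilde s t c a ≫ g = f a := by
  choose l hl using fun a => exists_whiskerLeft_coequalizer_desc B _ _ (f a) (hf a)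
  obtain ⟨g, hg⟩ := exists_whiskerLeft_sigma_desc (fun a : E × Bool => hTildeArrow s t c a) l
  refine ⟨g, fun a => ?_⟩
  rw [← hl a, ← hg a]
  exact MonoidalCategory.whiskerLeft_comp_assoc _ _ _ _

theorem hTilde_hom_ext₂ {B X : C} {f g : B ⊗ (hTilde s t c ⊗ hTilde s t c) ⟶ X}
    (h : ∀ a b, B ◁ (toTilde s t c a ⊗ₘ toTilde s t c b) ≫ f =
      B ◁ (toTilde s t c a ⊗ₘ toTilde s t c b) ≫ g) : f = g := by
  rw [← cancel_epi (α_ _ _ _).hom]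
  refine hTilde_hom_ext s t c fun b => ?_
  rw [← cancel_epi ((α_ B (hom (c (src s t b)) (c (tgt s t b))) (hTilde s t c)).hom ≫
    B ◁ (β_ _ _).hom ≫ (α_ B _ _).inv)]
  refine hTilde_hom_ext s t c fun a => hom_ext₃' fun Γ β x y => ?_
  have := congrArg (fun f => ap f (pr β (pr y x))) (h a b)
  simpa only [ap_comp, ap_whiskerLeft, ap_braiding, ap_assoc_hom, ap_assoc_inv, ap_tensorHom]
    using this

/-- `φ^±` descends to a map on `h̃^∨ ⊗ h̃^∨`. -/
theorem exists_phi_desc : ∃ φ : P.pi ⊗ (hTilde s t c ⊗ hTilde s t c) ⟶ S,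
    (∀ {Γ : CommComon C} (β : El Γ P.pi) (x y : El Γ (hTilde s t c)),
      ap φ (pr β (pr x y)) = ap φ (pr β (pr y x))) ∧
    ∀ a b, P.pi ◁ (toTilde s t c a ⊗ₘ toTilde s t c b) ≫ φ = phi s t c j σ a b := by
  -- descent in the second argument, for each arrow `a` of the first
  choose f hf using fun a => exists_hTilde_desc s t c
    (fun b => (α_ _ _ _).hom ≫ phi s t c j σ a b) (whiskerLeft_invLeft_phi s t c j σ a)
  have hf' : ∀ (a b) {Γ : CommComon C} (β : El Γ P.pi)
      (X : El Γ (hom (c (src s t a)) (c (tgt s t a))))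
      (Y : El Γ (hom (c (src s t b)) (c (tgt s t b)))),
      ap (f a) (pr (pr β X) (ap (toTilde s t c b) Y)) = ap (phi s t c j σ a b) (pr β (pr X Y)) :=
    fun a b Γ β X Y => by
      rw [← ap_whiskerLeft, ← ap_comp, hf, ap_comp, ap_assoc_hom]
  let f' : ∀ a : E × Bool, (P.pi ⊗ hTilde s t c) ⊗ hom (c (src s t a)) (c (tgt s t a)) ⟶ S :=
    fun a => (α_ _ _ _).hom ≫ P.pi ◁ (β_ _ _).hom ≫ (α_ _ _ _).inv ≫ f a
  have hf'' : ∀ (a b) {Γ : CommComon C} (β : El Γ P.pi)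
      (X : El Γ (hom (c (src s t a)) (c (tgt s t a))))
      (Y : El Γ (hom (c (src s t b)) (c (tgt s t b)))),
      ap (f' a) (pr (pr β (ap (toTilde s t c b) Y)) X) = ap (phi s t c j σ b a) (pr β (pr Y X)) :=
    fun a b Γ β X Y => by
      simp only [f', ap_comp, ap_assoc_hom, ap_whiskerLeft, ap_braiding, ap_assoc_inv, hf',
        phi_symm s t c j σ a b]
  -- by symmetry, the result is invariant in the remaining argument
  have hinv : ∀ a, (P.pi ⊗ hTilde s t c) ◁ invLeft (c (src s t a)) (c (tgt s t a)) ≫ f' a =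
      (P.pi ⊗ hTilde s t c) ◁ invRight (c (src s t a)) (c (tgt s t a)) ≫ f' a := fun a => by
    rw [← cancel_epi ((α_ P.pi (P.pi ⊗ hom (c (src s t a)) (c (tgt s t a))) (hTilde s t c)).hom ≫
      P.pi ◁ (β_ _ _).hom ≫ (α_ P.pi _ _).inv)]
    refine hTilde_hom_ext s t c fun b => ?_
    rw [← cancel_epi ((α_ _ _ _).hom ▷ _)]
    refine hom_ext₄' fun Γ β β' X Y => ?_
    have := congrArg (fun f => ap f (pr (pr β Y) (pr β' X))) (whiskerLeft_invLeft_phi s t c j σ b a)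
    simp only [ap_comp, ap_whiskerLeft, ap_assoc_hom] at this
    simp only [ap_comp, ap_whiskerLeft, ap_whiskerRight, ap_braiding, ap_assoc_hom, ap_assoc_inv,
      hf'', this]
  obtain ⟨φ, hφ⟩ := exists_hTilde_desc s t c f' hinv
  have hφ' : ∀ (a b) {Γ : CommComon C} (β : El Γ P.pi)
      (X : El Γ (hom (c (src s t a)) (c (tgt s t a))))
      (Y : El Γ (hom (c (src s t b)) (c (tgt s t b)))),
      ap ((α_ _ _ _).inv ≫ φ) (pr β (pr (ap (toTilde s t c a) X) (ap (toTilde s t c b) Y))) =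
        ap (phi s t c j σ a b) (pr β (pr X Y)) :=
    fun a b Γ β X Y => by
      rw [ap_comp, ap_assoc_inv, ← ap_whiskerLeft, ← ap_comp, hφ, hf'']
  have hsymm : (α_ _ _ _).inv ≫ φ = P.pi ◁ (β_ _ _).hom ≫ (α_ _ _ _).inv ≫ φ := by
    refine hTilde_hom_ext₂ s t c fun a b => hom_ext₃ fun Γ β X Y => ?_
    rw [ap_comp, ap_whiskerLeft, ap_tensorHom, hφ', ap_comp, ap_whiskerLeft, ap_tensorHom,
      ap_comp, ap_whiskerLeft, ap_braiding, hφ', phi_symm]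
  refine ⟨(α_ _ _ _).inv ≫ φ, fun β x y => ?_, fun a b => hom_ext₃ fun Γ β X Y => ?_⟩
  · conv_lhs => rw [hsymm, ap_comp, ap_whiskerLeft, ap_braiding]
  · rw [ap_comp, ap_whiskerLeft, ap_tensorHom, hφ']

variable {s t c j} in
/-- There is a unique odd operator of order two that vanishes on the unit and on `h̃^∨` and is given
by `φ^±` on products of two generators. -/
theorem existsUnique_isRepresentationBV (hj : IsFreeCommMon j) :
    ∃! D : P.pi ⊗ S ⟶ S, IsRepresentationBV s t c j σ D := by
  obtain ⟨φ, hsymm, hφ⟩ := exists_phi_desc s t c j σ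
  have hcoord : ∀ a b, coord s t c j a ⊗ₘ coord s t c j b =
      (toTilde s t c a ⊗ₘ toTilde s t c b) ≫ (j ⊗ₘ j) := fun a b => by
    rw [tensorHom_comp_tensorHom, toTilde_comp, toTilde_comp]
  obtain ⟨D, h1, h2, h3, h4⟩ := exists_isDiffOp_two P hj φ hsymm
  refine ⟨D, ⟨h1, h2, h3, fun a b => ?_⟩, fun D' hD' => ?_⟩
  · rw [hcoord, Category.assoc, MonoidalCategory.whiskerLeft_comp, Category.assoc, h4, hφ]
  · refine eq_of_isDiffOp_two hj hD'.order h1 hD'.unit h2 (hD'.linear.trans h3.symm) ?_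
    refine hTilde_hom_ext₂ s t c fun a b => ?_
    rw [h4, hφ, ← hD'.quadratic a b, hcoord]
    simp only [MonoidalCategory.whiskerLeft_comp, Category.assoc]

end Descent

end Phi

/-! ### Sums over decompositions of a word -/

section DecSum

variable {A M N : Type*} [AddCommMonoid M] [AddCommMonoid N]

/-- The sum over all decompositions `w = u a v` of a word. -/
def decSum : List A → (List A → A → List A → M) → M
  | [], _ => 0
  | a :: w, f => f [] a w + decSum w fun u b v => f (a :: u) b v

theorem decSum_congr {w : List A} {f g : List A → A → List A → M}
    (h : ∀ u a v, w = u ++ a :: v → f u a v = g u a v) : decSum w f = decSum w g := by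
  induction w generalizing f g with
  | nil => rfl
  | cons a w ih =>
    rw [decSum, decSum, h [] a w rfl, ih fun u b v e => h _ _ _ (by simp [e])]

theorem map_decSum (F : M →+ N) (w : List A) (f : List A → A → List A → M) :
    F (decSum w f) = decSum w fun u a v => F (f u a v) := by
  induction w generalizing f with
  | nil => exact map_zero F
  | cons a w ih => rw [decSum, decSum, map_add, ih]

theorem decSum_add (w : List A) (f g : List A → A → List A → M) :
    (decSum w fun u a v => f u a v + g u a v) = decSum w f + decSum w g := by
  induction w generalizing f g with
  | nil => exact (add_zero 0).symm
  | cons a w ih => rw [decSum, decSum, decSum, ih, add_add_add_comm]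

theorem decSum_zero (w : List A) : (decSum w fun _ _ _ => (0 : M)) = 0 := by
  induction w with
  | nil => rfl
  | cons a w ih => rw [decSum, ih, zero_add]

theorem decSum_append (w w' : List A) (f : List A → A → List A → M) :
    decSum (w ++ w') f = (decSum w fun u a v => f u a (v ++ w')) +
      decSum w' fun u a v => f (w ++ u) a v := by
  induction w generalizing f with
  | nil => simp [decSum]
  | cons a w ih => simp [decSum, ih, add_assoc]

end DecSum

section Brackets

open scoped ComonObj MonObj
open DualisableWithInvolution

set_option linter.unusedSectionVars false

variable {C : Type u} [Category.{v} C] [Preadditive C] [MonoidalCategory C] [SymmetricCategory C]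
  [MonoidalPreadditive C] [HasBinaryBiproducts C] [HasColimits C]
  [∀ X : C, PreservesColimits (tensorLeft X)]
  {P : ParityStructure C} {Γ Θ : CommComon C}
  {V E : Type*} [Finite E] {s t : E → V} {c : V → DualisableWithInvolution P}
  {S : C} [MonObj S] [IsCommMonObj S] {j : hTilde s t c ⟶ S} {σ : Variant}

/-! ### Brackets of paths -/

section General

variable {B : C} (D : B ⊗ S ⟶ S)

theorem bracket_contr_right (x : DualisableWithInvolution P) (b : El Γ B) (y : El Γ S)
    (Φ : El (bindCtx Γ x) S) :
    bracket D b y (contr x Φ) = contr x (bracket D (wk x b) (wk x y) Φ) := by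
  rw [← ap_bracketHom, ← ap_bracketHom, contr_ap, ← sb_pr, contr_pr_left]

theorem bracket_contr_left (x : DualisableWithInvolution P) (b : El Γ B) (y : El Γ S)
    (Φ : El (bindCtx Γ x) S) :
    bracket D b (contr x Φ) y = contr x (bracket D (wk x b) Φ (wk x y)) := by
  rw [bracket_comm, bracket_contr_right]
  simp only [bracket_comm]

theorem bracket_smul_right (b : El Γ B) (y z : El Γ S) (a : El Γ (𝟙_ C)) :
    bracket D b y (a • z) = a • bracket D b y z := by
  rw [← ap_bracketHom, ← ap_bracketHom, pr_smul_right, ap_smul]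

variable {D}

theorem IsDiffOp.bracket_one_right (hD : IsDiffOp 2 D) (h1 : B ◁ η ≫ D = 0) (b : El Γ B)
    (y : El Γ S) : bracket D b y 1 = 0 := by
  simpa using hD.bracket_mul_right h1 b y 1 1

end General

variable {D : P.pi ⊗ S ⟶ S} (hD : IsRepresentationBV s t c j σ D)
include hD

theorem IsRepresentationBV.ap_coordEl (a : E × Bool) (β : El Γ P.pi)
    (x : El Γ (c (src s t a)).obj) (y : El Γ (c (tgt s t a)).dual) :
    ap D (pr β (coordEl s t c j a x y)) = 0 := by
  have := hD.linear
  rw [coordEl, ← toTilde_comp, ap_comp, ← ap_whiskerLeft, ← ap_comp, this, zero_ap]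

theorem IsRepresentationBV.bracket_coordEl (a b : E × Bool) (β : El Γ P.pi)
    (x : El Γ (c (src s t a)).obj) (y : El Γ (c (tgt s t a)).dual) (z : El Γ (c (src s t b)).obj)
    (w : El Γ (c (tgt s t b)).dual) :
    bracket D β (coordEl s t c j a x y) (coordEl s t c j b z w) = pairing a b •
      (pathEl s t c j (src s t a) (link σ a b) (tgt s t b) (oddInv _ β x) w *
          pathEl s t c j (src s t b) (link σ b a) (tgt s t a) z y -
        pathEl s t c j (src s t a) (link σ a b) (tgt s t b) x w *
          pathEl s t c j (src s t b) (link σ b a) (tgt s t a) z (oddInvDual _ β y)) := by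
  rw [bracket, hD.ap_coordEl, hD.ap_coordEl, mul_zero, mul_zero, sub_zero, sub_zero, ← ap_phi,
    ← hD.quadratic]
  simp [ap_comp, coordEl]

/-- The bracket of a coordinate with a path: at every arrow `a` of the path, the two paths are cut
and reconnected crosswise. -/
theorem IsRepresentationBV.bracket_coordEl_pathEl (b : E × Bool) (β : El Γ P.pi)
    (x : El Γ (c (src s t b)).obj) (y : El Γ (c (tgt s t b)).dual) {i k : V}
    {w : List (E × Bool)} (hw : IsPath s t i w k) (z : El Γ (c i).obj) (z' : El Γ (c k).dual) :
    bracket D β (coordEl s t c j b x y) (pathEl s t c j i w k z z') =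
      decSum w fun u a v => pairing b a •
        (pathEl s t c j (src s t b) (link σ b a ++ v) k (oddInv _ β x) z' *
            pathEl s t c j i (u ++ link σ a b) (tgt s t b) z y -
          pathEl s t c j (src s t b) (link σ b a ++ v) k x z' *
            pathEl s t c j i (u ++ link σ a b) (tgt s t b) z (oddInvDual _ β y)) := by
  induction w generalizing i Γ with
  | nil =>
    obtain rfl : i = k := hw
    rw [pathEl_nil, bracket_smul_right, hD.order.bracket_one_right hD.unit, smul_zero_el, decSum]
  | cons a w ih =>
    obtain ⟨rfl, hw⟩ := hw
    rw [pathEl_cons, bracket_contr_right, hD.order.bracket_mul_right hD.unit]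
    simp only [sb_coordEl]
    rw [ih _ _ _ hw, hD.bracket_coordEl, contr_add, decSum, add_comm]
    congr 1
    · by_cases h0 : pairing b a = 0
      · simp [h0]
      rw [pathEl_append s t c j (isPath_link σ h0), pathEl_append s t c j (isPath_link σ h0),
        ← contr_mul_right, ← contr_mul_right, ← contr_sub, ← contr_zsmul]
      congr 1
      simp only [sb_pathEl, sb_oddInv, sb_oddInvDual, List.nil_append]
      rw [mul_smul_comm]
      congr 1
      ring
    · have hm : ∀ (X : El (bindCtx Γ (c (tgt s t a))) S) (f : List (E × Bool) → E × Bool →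
          List (E × Bool) → El (bindCtx Γ (c (tgt s t a))) S),
          contr _ (X * decSum w f) = decSum w fun u a v => contr _ (X * f u a v) := fun X f =>
        map_decSum ((contrHom _).comp (AddMonoidHom.mulLeft X)) w f
      rw [hm]
      refine decSum_congr fun u a' v _ => ?_
      rw [mul_smul_comm, contr_zsmul, mul_sub, contr_sub]
      simp only [List.cons_append, pathEl_cons s t c j a, ← contr_mul_left]
      congr 3 <;> simp only [sb_pathEl, sb_oddInv, sb_oddInvDual] <;> ring

end Brackets

/-! ### Brackets of odd traces -/

section DecSum

variable {A M : Type*}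

theorem smul_decSum {K : Type*} [AddCommMonoid M] [Monoid K] [DistribMulAction K M] (r : K)
    (w : List A) (f : List A → A → List A → M) :
    r • decSum w f = decSum w fun u a v => r • f u a v :=
  map_decSum (DistribSMul.toAddMonoidHom M r) w f

theorem decSum_neg [AddCommGroup M] (w : List A) (f : List A → A → List A → M) :
    (decSum w fun u a v => -f u a v) = -decSum w f :=
  (map_decSum (negAddMonoidHom : M →+ M) w f).symm

end DecSum

section TraceBrackets

open scoped ComonObj MonObj
open DualisableWithInvolution

set_option linter.unusedSectionVars false

variable {C : Type u} [Category.{v} C] [Preadditive C] [MonoidalCategory C] [SymmetricCategory C]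
  [MonoidalPreadditive C] [HasBinaryBiproducts C] [HasColimits C]
  [∀ X : C, PreservesColimits (tensorLeft X)]
  {P : ParityStructure C} {Γ Θ : CommComon C}
  {V E : Type*} [Finite E] {s t : E → V} {c : V → DualisableWithInvolution P}
  {S : C} [MonObj S] [IsCommMonObj S] {j : hTilde s t c ⟶ S} {σ : Variant}

theorem contr_decSum {A : Type*} {X : C} (x : DualisableWithInvolution P) (w : List A)
    (f : List A → A → List A → El (bindCtx Γ x) X) :
    contr x (decSum w f) = decSum w fun u a v => contr x (f u a v) :=
  map_decSum (contrHom x) w f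

theorem smul_decSum_el {A : Type*} {X : C} (r : El Γ (𝟙_ C)) (w : List A)
    (f : List A → A → List A → El Γ X) :
    r • decSum w f = decSum w fun u a v => r • f u a v :=
  map_decSum (AddMonoidHom.mk' (fun x : El Γ X => r • x) (smul_add_el r)) w f

theorem mul_decSum {A : Type*} (x : El Γ S) (w : List A) (f : List A → A → List A → El Γ S) :
    x * decSum w f = decSum w fun u a v => x * f u a v :=
  map_decSum (AddMonoidHom.mulLeft x) w f

/-- An odd involution inserted at an inner vertex of a path can be moved to its start. -/
theorem contr_pathEl_mul_oddInv {p i q : V} {w : List (E × Bool)} (hw : IsPath s t p w i)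
    (w' : List (E × Bool)) (x : El Γ (c p).obj) (y : El Γ (c q).dual) (β : El Γ P.pi) :
    contr (c i) (pathEl s t c j p w i (wk _ x) (genDual _) *
        pathEl s t c j i w' q (oddInv _ (wk _ β) (gen _)) (wk _ y)) =
      pathEl s t c j p (w ++ w') q (oddInv _ β x) y := by
  have h := contr_slide_mul (c i) (pathMap s t c j p w i) (pathMap s t c j i w' q) x y β
  simp only [ap_pathMap, ← pathEl_oddInv] at h
  rw [h, pathEl_append s t c j hw]
  simp only [sb_oddInv]

theorem otrEl_eq_ap (i : V) (w : List (E × Bool)) (β : El Γ P.pi) :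
    otrEl s t c j i w β = ap (oddTrace s t c j i w).odd (pr β 1) := by
  have h : otrEl s t c j i w β = contr (c i) (ap (invLeft (c i) (c i) ≫ pathMap s t c j i w i)
      (pr (wk _ β) (pr (gen _) (genDual _)))) := by
    simp [otrEl, pathEl, invLeft, ap_comp, oddInv]
  rw [h, contr_ap, contr_pr_left, contr_gen, ← ap_whiskerLeft, ← ap_comp]
  rfl

@[simp] theorem sb_otrEl (τ : Sub Θ Γ) (i : V) (w : List (E × Bool)) (β : El Γ P.pi) :
    sb τ (otrEl s t c j i w β) = otrEl s t c j i w (sb τ β) := by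
  rw [otrEl_eq_ap, otrEl_eq_ap, sb_ap, sb_pr, sb_unit]

/-- The odd parameter of an odd trace can be exchanged with one in a value of `ξ`. -/
theorem xi_smul_otrEl (i : V) (w : List (E × Bool)) (β β₁ β₂ : El Γ P.pi) :
    ap P.xi.hom (pr β β₁) • otrEl s t c j i w β₂ = ap P.xi.hom (pr β₁ β₂) • otrEl s t c j i w β := by
  rw [otrEl_eq_ap, otrEl_eq_ap, ← ap_smul, ← ap_smul, ← pr_smul_left, ← pr_smul_left,
    xi_smul_assoc]

variable {D : P.pi ⊗ S ⟶ S} (hD : IsRepresentationBV s t c j σ D)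
include hD

/-- The bracket of a coordinate with an odd trace opens up the closed path. The two terms of `φ`
carry the same path and the values `ξ(β', β)` and `-ξ(β, β')`, hence the factor two. -/
theorem IsRepresentationBV.bracket_coordEl_otrEl (b : E × Bool) (β β' : El Γ P.pi)
    (x : El Γ (c (src s t b)).obj) (y : El Γ (c (tgt s t b)).dual) {i : V}
    {w : List (E × Bool)} (hw : IsPath s t i w i) :
    bracket D β (coordEl s t c j b x y) (otrEl s t c j i w β') =
      ap P.xi.hom (pr β β') • decSum w fun u a v => (2 * pairing a b) •
        pathEl s t c j (src s t b) (link σ b a ++ (v ++ u) ++ link σ a b) (tgt s t b) x y := by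
  rw [otrEl, bracket_contr_right]
  simp only [sb_coordEl]
  rw [hD.bracket_coordEl_pathEl b _ _ _ hw, contr_decSum, smul_decSum_el]
  refine decSum_congr fun u a v e => ?_
  subst e
  obtain ⟨h1, h2⟩ := hw.of_decomp
  rw [pairing_swap a b]
  by_cases h0 : pairing b a = 0
  · simp [pairing_swap b a, h0, smul_zero_el]
  have hp := (isPath_link σ h0).append h2
  rw [contr_zsmul, contr_sub]
  -- the closed path is opened at `a`; its base point becomes an inner vertex, and the involution
  -- there is moved to the start
  have e1 := contr_pathEl_mul_oddInv (j := j) hp (u ++ link σ a b) (oddInv _ β x) y β'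
  have e2 := contr_pathEl_mul_oddInv (j := j) hp (u ++ link σ a b) x (oddInvDual _ β y) β'
  simp only [sb_oddInv] at e1
  simp only [sb_oddInvDual] at e2
  rw [e1, e2, ← pathEl_oddInv, pathEl_oddInv_oddInv, pathEl_oddInv_oddInv, xi_swap β' β,
    smul_zsmul_el, neg_smul_el]
  simp only [List.append_assoc]
  generalize ap P.xi.hom (pr β β') • (_ : El Γ S) = T
  module

/-- The bracket of a path with an odd trace inserts the opened closed path at all positions. -/
theorem IsRepresentationBV.bracket_pathEl_otrEl (β β' : El Γ P.pi) {i k : V}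
    {w : List (E × Bool)} (hw : IsPath s t i w k) (z : El Γ (c i).obj) (z' : El Γ (c k).dual)
    {i' : V} {w' : List (E × Bool)} (hw' : IsPath s t i' w' i') :
    bracket D β (pathEl s t c j i w k z z') (otrEl s t c j i' w' β') =
      ap P.xi.hom (pr β β') • decSum w fun u b v => decSum w' fun u' a v' => (2 * pairing a b) •
        pathEl s t c j i (u ++ (link σ b a ++ (v' ++ u') ++ link σ a b ++ v)) k z z' := by
  induction w generalizing i Γ with
  | nil =>
    obtain rfl : i = k := hw
    rw [pathEl_nil, bracket_comm, bracket_smul_right, hD.order.bracket_one_right hD.unit,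
      smul_zero_el, decSum, smul_zero_el]
  | cons b w ih =>
    obtain ⟨rfl, hw⟩ := hw
    rw [pathEl_cons, bracket_contr_left, hD.order.bracket_mul_left hD.unit]
    simp only [sb_otrEl]
    rw [hD.bracket_coordEl_otrEl b _ _ _ _ hw', ih _ _ hw, contr_add, decSum, smul_add_el, add_comm]
    congr 1
    · rw [mul_smul_el, ← sb_pr, ← sb_ap, contr_smul_left, mul_decSum, contr_decSum]
      congr 1
      refine decSum_congr fun u' a v' e => ?_
      subst e
      obtain ⟨h1, h2⟩ := hw'.of_decomp
      by_cases h0 : pairing a b = 0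
      · simp [h0]
      have hp := ((isPath_link σ (by rwa [pairing_swap, neg_ne_zero])).append (h2.append h1)).append
        (isPath_link σ h0)
      rw [mul_smul_comm, contr_zsmul, List.nil_append, pathEl_append s t c j hp,
        mul_comm (pathEl s t c j _ _ k _ _)]
    · rw [mul_smul_el, ← sb_pr, ← sb_ap, contr_smul_left, mul_decSum, contr_decSum]
      congr 1
      refine decSum_congr fun u a v _ => ?_
      rw [mul_decSum, contr_decSum]
      refine decSum_congr fun u' a' v' _ => ?_
      rw [mul_smul_comm, contr_zsmul, List.cons_append, pathEl_cons]

/-- The bracket of two odd traces. -/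
theorem IsRepresentationBV.bracket_otrEl (β β₁ β₂ : El Γ P.pi) {i : V} {w : List (E × Bool)}
    (hw : IsPath s t i w i) {i' : V} {w' : List (E × Bool)} (hw' : IsPath s t i' w' i') :
    bracket D β (otrEl s t c j i w β₁) (otrEl s t c j i' w' β₂) =
      ap P.xi.hom (pr β β₁) • decSum w fun u b v => decSum w' fun u' a v' => (2 * pairing b a) •
        otrEl s t c j (tgt s t b) (v ++ u ++ link σ b a ++ (v' ++ u') ++ link σ a b) β₂ := by
  rw [otrEl, bracket_contr_left]
  simp only [sb_otrEl]
  rw [hD.bracket_pathEl_otrEl _ _ hw _ _ hw', ← sb_pr, ← sb_ap, contr_smul_left, contr_decSum,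
    smul_decSum_el, smul_decSum_el]
  refine decSum_congr fun u b v e => ?_
  rw [contr_decSum, smul_decSum_el, smul_decSum_el]
  refine decSum_congr fun u' a v' e' => ?_
  subst e e'
  obtain ⟨h1, h2⟩ := hw.of_decomp
  obtain ⟨h1', h2'⟩ := hw'.of_decomp
  rw [contr_zsmul]
  by_cases h0 : pairing a b = 0
  · simp [h0, pairing_swap a b, smul_zero_el]
  have hp := ((isPath_link σ (by rwa [pairing_swap, neg_ne_zero])).append (h2'.append h1')).append
    (isPath_link σ h0)
  -- the remaining closed path is rotated so as to start behind `b`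
  have e := otrEl_append_comm s t c j h1 (hp.append h2) β₁
  have e' := otrEl_append_comm s t c j (h2.append h1) hp β₁
  have e'' : contr (c i) (pathEl s t c j i
      (u ++ (link σ b a ++ (v' ++ u') ++ link σ a b ++ v)) i (oddInv _ (wk _ β₁) (gen _))
      (genDual _)) = otrEl s t c j (tgt s t b)
        (v ++ u ++ link σ b a ++ (v' ++ u') ++ link σ a b) β₁ := by
    refine e.trans ?_
    simp only [List.append_assoc] at e' ⊢
    exact e'.symm
  rw [e'', smul_zsmul_el, smul_zsmul_el, xi_swap β β₁, neg_smul_el, xi_smul_otrEl _ _ β₁ β β₂,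
    pairing_swap b a]
  generalize ap P.xi.hom (pr β β₂) • (_ : El Γ S) = T
  module

/-- The value of the operator on the function of a path: every pair of arrows of the path splits off
the odd trace of the closed path between them. -/
theorem IsRepresentationBV.ap_pathEl (h2 : ∀ {X Y : C} (f : X ⟶ Y), f = -f → f = 0)
    (β : El Γ P.pi) {i k : V} {w : List (E × Bool)} (hw : IsPath s t i w k) (x : El Γ (c i).obj)
    (z : El Γ (c k).dual) :
    ap D (pr β (pathEl s t c j i w k x z)) =
      -decSum w fun u a r => decSum r fun m b n => pairing a b •
        (otrEl s t c j (tgt s t a) (m ++ link σ b a) β *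
          pathEl s t c j i (u ++ link σ a b ++ n) k x z) := by
  induction w generalizing i Γ with
  | nil =>
    obtain rfl : i = k := hw
    have h1 : ap D (pr β (1 : El Γ S)) = 0 := by
      rw [← ap_one, ← ap_whiskerLeft, ← ap_comp, hD.unit, zero_ap]
    rw [pathEl_nil, pr_smul_right, ap_smul, h1, smul_zero_el, decSum, neg_zero]
  | cons a w ih =>
    obtain ⟨rfl, hw⟩ := hw
    rw [pathEl_cons, ← contr_pr_left, ← contr_ap, ap_mul_eq_bracket, hD.ap_coordEl, mul_zero,
      add_zero, ih _ hw, hD.bracket_coordEl_pathEl _ _ _ _ hw, mul_neg, decSum, neg_add, contr_add,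
      contr_neg, add_comm, contr_decSum]
    congr 1
    · rw [← decSum_neg]
      refine decSum_congr fun m b n _ => ?_
      rw [contr_zsmul, contr_sub]
      simp only [← sb_oddInv, ← sb_pathEl, contr_mul_left, ← pathEl_oddInv]
      -- in one of the two terms of the bracket an even trace splits off
      rw [contr_pathEl_eq_zero s t c j h2, mul_zero, zero_sub, smul_neg, mul_comm]
      rfl
    · rw [mul_decSum, contr_decSum]
      congr 1
      refine decSum_congr fun u a' r _ => ?_
      rw [mul_decSum, contr_decSum]
      refine decSum_congr fun m b n _ => ?_
      rw [mul_smul_comm, contr_zsmul, mul_left_comm]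
      simp only [← sb_otrEl]
      rw [contr_mul_left, List.cons_append, List.cons_append, pathEl_cons]

/-- The value of the operator on an odd trace. -/
theorem IsRepresentationBV.ap_otrEl (h2 : ∀ {X Y : C} (f : X ⟶ Y), f = -f → f = 0)
    (β β' : El Γ P.pi) {i : V} {w : List (E × Bool)} (hw : IsPath s t i w i) :
    ap D (pr β (otrEl s t c j i w β')) =
      -decSum w fun u a r => decSum r fun m b n => pairing a b •
        (otrEl s t c j (tgt s t a) (m ++ link σ b a) β *
          otrEl s t c j (tgt s t b) (n ++ u ++ link σ a b) β') := by
  rw [otrEl, ← contr_pr_left, ← contr_ap, hD.ap_pathEl h2 _ hw, contr_neg, contr_decSum]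
  congr 1
  refine decSum_congr fun u a r e => ?_
  rw [contr_decSum]
  refine decSum_congr fun m b n e' => ?_
  subst e e'
  obtain ⟨h1, h3⟩ := hw.of_decomp
  obtain ⟨h4, h5⟩ := h3.of_decomp
  rw [contr_zsmul]
  by_cases h0 : pairing a b = 0
  · simp [h0]
  have e := otrEl_append_comm s t c j (h1.append (isPath_link σ h0)) h5 β'
  simp only [← sb_otrEl]
  rw [contr_mul_left, List.append_assoc n u, ← e]
  rfl

end TraceBrackets

/-! ### Sums over the positions of a cyclic word -/

section Rotations

variable {A M : Type*} [AddCommMonoid M]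

/-- The general prefix `p` is needed for the induction; with `p = []` the lists on the left are the
rotations of `w`, with `w` itself occurring twice. -/
theorem zipWith_tails_inits (w p : List A) :
    ((List.zipWith (fun x y => x ++ (p ++ y)) w.tails w.inits : List (List A)) :
      Multiset (List A)) = decSum w (fun u a v => {a :: (v ++ (p ++ u))}) + {p ++ w} := by
  induction w generalizing p with
  | nil => simp [decSum]
  | cons a w ih =>
    have h := ih (p ++ [a])
    simp only [List.append_assoc, List.singleton_append] at h
    simp only [List.tails_cons, List.inits_cons, List.zipWith_cons_cons, List.zipWith_map_right,
      decSum, List.append_nil, add_assoc]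
    rw [← h, Multiset.singleton_add, Multiset.cons_coe]
    rfl

/-- The rotations of a word, with multiplicities, correspond to its positions. -/
theorem lists_coe {w : List A} (hw : w ≠ []) :
    (w : Cycle A).lists = decSum w (fun u a v => ({a :: (v ++ u)} : Multiset (List A))) := by
  have h := zipWith_tails_inits w []
  simp only [List.nil_append] at h
  have hne : List.zipWith (· ++ ·) w.tails w.inits ≠ [] := by
    cases w <;> simp_all
  have hl : (List.zipWith (· ++ ·) w.tails w.inits).getLast hne = w := by
    simp [List.getLast_eq_getElem]
  have h' : ((List.zipWith (· ++ ·) w.tails w.inits : List (List A)) : Multiset (List A)) =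
      ((w.cyclicPermutations : List (List A)) : Multiset (List A)) + {w} := by
    rw [List.cyclicPermutations_of_ne_nil w hw]
    conv_lhs => rw [← List.dropLast_append_getLast hne, hl]
    rfl
  rw [Cycle.lists_coe]
  exact add_right_cancel (h'.symm.trans h)

theorem sum_map_lists (w : List A) (g : List A → M) (hg : g [] = 0) :
    ((w : Cycle A).lists.map g).sum = decSum w fun u a v => g (a :: (v ++ u)) := by
  by_cases hw : w = []
  · subst hw
    simp [decSum, hg]
  · have := map_decSum ((Multiset.sumAddMonoidHom : Multiset M →+ M).comp
      (Multiset.mapAddMonoidHom g)) w (fun u a v => {a :: (v ++ u)})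
    rw [← lists_coe hw] at this
    simpa using this

theorem sum_fin_eq_decSum (w : List A) (f : List A → A → List A → M) :
    ∑ k : Fin w.length, f (w.take k) w[k] (w.drop (k + 1)) = decSum w f := by
  induction w generalizing f with
  | nil => rfl
  | cons a w ih =>
    rw [decSum, ← ih]
    exact Fin.sum_univ_succ _

theorem decSum_decSum_comm (w : List A) (f : List A → A → List A → A → List A → M) :
    (decSum w fun u a v => decSum u fun m b n => f m b n a v) =
      decSum w fun m b r => decSum r fun n a v => f m b n a v := by
  induction w generalizing f with
  | nil => rfl
  | cons a w ih =>
    simp only [decSum, zero_add, decSum_add]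
    rw [ih fun m => f (a :: m)]

/-- A sum over pairs of distinct positions of a cyclic word is a sum over pairs of positions in
increasing order. -/
theorem decSum_decSum_append (w : List A) (f : A → List A → A → List A → M) :
    (decSum w fun u a v => decSum (v ++ u) fun m b n => f a m b n) =
      decSum w fun u a r => decSum r fun m b n => f a m b (n ++ u) + f b (n ++ u) a m := by
  simp only [decSum_append, decSum_add]
  congr 1
  exact decSum_decSum_comm w fun m b n a v => f a (v ++ m) b n

end Rotations

/-! ### Necklace operations on representatives -/

section Quiver

variable {V E : Type*} (R : Type*) [CommRing R] (s t : E → V) (σ : Variant)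

theorem brWord_cons (a b : E × Bool) (u v : List (E × Bool)) :
    brWord R s t σ (a :: u) (b :: v) =
      pairing a b • cyc R s t (tgt s t a) (u ++ link σ a b ++ v ++ link σ b a) := by
  cases σ
  · simp [brWord, link]
  · rw [brWord]
    congr 1
    refine cyc_congr R s t ?_ (by simp)
    have : (a :: u ++ [a] ++ (b :: v ++ [b])) = [a] ++ (u ++ [a, b] ++ v ++ [b]) := by simp
    rw [this, Cycle.coe_eq_coe]
    refine List.isRotated_append.trans ?_
    simp only [link, List.append_assoc, List.cons_append, List.nil_append]
    exact List.IsRotated.refl _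

theorem cobrWord_cons (a : E × Bool) (u : List (E × Bool)) :
    cobrWord R s t σ (a :: u) = decSum u fun m b n => pairing a b •
      (cyc R s t (tgt s t a) (m ++ link σ b a) ⊗ₜ[R] cyc R s t (tgt s t b) (n ++ link σ a b)) := by
  rw [← sum_fin_eq_decSum]
  cases σ
  · simp [cobrWord, link]
  · rw [cobrWord]
    refine Finset.sum_congr rfl fun k _ => ?_
    have h : ∀ (x y : E × Bool) (l : List (E × Bool)),
        cyc R s t (src s t x) (x :: l ++ [y]) = cyc R s t (tgt s t x) (l ++ [y, x]) :=
      fun x y l => cyc_congr R s t (Cycle.coe_eq_coe.mpr (by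
        simpa using List.isRotated_append (l := [x]) (l' := l ++ [y]))) (by simp)
    rw [h, h]
    rfl

theorem brCyclic_of_word {p q : CyclicPath s t} {w w' : List (E × Bool)} (hp : p.word = w)
    (hq : q.word = w') :
    brCyclic R s t σ p q = decSum w fun u a v => decSum w' fun u' b v' => pairing a b •
      cyc R s t (tgt s t a) (v ++ u ++ link σ a b ++ (v' ++ u') ++ link σ b a) := by
  have h0 : ∀ l, brWord R s t σ l [] = 0 := fun l => by cases l <;> cases σ <;> rfl
  have h0' : ∀ l, brWord R s t σ [] l = 0 := fun l => by cases l <;> cases σ <;> rfl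
  rw [brCyclic, hp, hq, sum_map_lists]
  · simp only [sum_map_lists w' _ (h0 _), brWord_cons]
  · simp [h0']

/-- The factor one half in the cobracket is absorbed by summing over pairs of positions in
increasing order: exchanging the two positions changes the sign of the pairing and that of the
product. -/
theorem shiftedCobr_cobr_single [Invertible (2 : R)] {p : CyclicPath s t} {w : List (E × Bool)}
    (hp : p.word = w) :
    shiftedCobr (cobr R s t σ) (Finsupp.single p 1) =
      decSum w fun u a r => decSum r fun m b n => pairing a b •
        (ExteriorAlgebra.ι R (cyc R s t (tgt s t a) (m ++ link σ b a)) *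
          ExteriorAlgebra.ι R (cyc R s t (tgt s t b) (n ++ u ++ link σ a b))) := by
  have h0 : cobrWord R s t σ [] = 0 := by cases σ <;> rfl
  have hsw : ∀ x y : NecklaceModule R s t, ExteriorAlgebra.ι R x * ExteriorAlgebra.ι R y =
      -(ExteriorAlgebra.ι R y * ExteriorAlgebra.ι R x) := fun x y =>
    eq_neg_of_add_eq_zero_left (ExteriorAlgebra.ι_add_mul_swap x y)
  let F : NecklaceModule R s t ⊗[R] NecklaceModule R s t →ₗ[R] _ :=
    TensorProduct.lift ((LinearMap.mul R (ExteriorAlgebra R (NecklaceModule R s t))).compl₁₂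
      (ExteriorAlgebra.ι R) (ExteriorAlgebra.ι R))
  have hF : ∀ x y, F (x ⊗ₜ y) = ExteriorAlgebra.ι R x * ExteriorAlgebra.ι R y := fun _ _ => rfl
  have e : shiftedCobr (cobr R s t σ) (Finsupp.single p 1) = ⅟(2 : R) • decSum w fun u a v =>
      decSum (v ++ u) fun m b n => F (pairing a b •
      (cyc R s t (tgt s t a) (m ++ link σ b a) ⊗ₜ[R] cyc R s t (tgt s t b) (n ++ link σ a b))) := by
    change F (cobr R s t σ (Finsupp.single p 1)) = _
    rw [cobr, Finsupp.linearCombination_single, one_smul, map_smul, hp, sum_map_lists w _ h0]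
    congr 1
    rw [← LinearMap.toAddMonoidHom_coe, map_decSum]
    simp only [cobrWord_cons]
    simp only [map_decSum]
  rw [e, decSum_decSum_append w fun a m b n => F (pairing a b •
      (cyc R s t (tgt s t a) (m ++ link σ b a) ⊗ₜ[R] cyc R s t (tgt s t b) (n ++ link σ a b)))]
  rw [smul_decSum]
  refine decSum_congr fun u a r _ => ?_
  rw [smul_decSum]
  refine decSum_congr fun m b n _ => ?_
  rw [map_zsmul, map_zsmul, hF, hF, pairing_swap a b, hsw (cyc R s t (tgt s t b) _), neg_smul,
    smul_neg, neg_neg, ← two_smul R, invOf_smul_smul]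

variable {s t} in
theorem isChain_iff_isPath (a b : E × Bool) (u : List (E × Bool)) :
    List.IsChain (fun a b => tgt s t a = src s t b) (a :: (u ++ [b])) ↔
      IsPath s t (tgt s t a) u (src s t b) := by
  induction u generalizing a with
  | nil => simp [IsPath]
  | cons c u ih => rw [List.cons_append, List.isChain_cons_cons, ih, IsPath]

variable {s t} in
/-- The closed path with word `w` based at `i` represents the cyclic path `p`. -/
def CyclicPath.IsRep (p : CyclicPath s t) (i : V) (w : List (E × Bool)) : Prop :=
  IsPath s t i w i ∧ p.word = w ∧ ∀ k, p = .const k → i = k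

theorem exists_isRep_of_isPath {i : V} {w : List (E × Bool)} (h : IsPath s t i w i) :
    ∃ p : CyclicPath s t, p.IsRep i w ∧ cyc R s t i w = Finsupp.single p 1 := by
  rcases w with _ | ⟨a, u⟩
  · exact ⟨.const i, ⟨rfl, rfl, fun k hk => by injection hk⟩, dif_pos rfl⟩
  · have hi := h.1
    subst hi
    have hc : Cycle.Chain (fun a b => tgt s t a = src s t b) (a :: u : List (E × Bool)) :=
      (isChain_iff_isPath a a u).mpr h.2
    have hne : ((a :: u : List (E × Bool)) : Cycle (E × Bool)) ≠ Cycle.nil := by simp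
    exact ⟨.loop _ hne hc, ⟨h, rfl, fun k hk => by injection hk⟩,
      by rw [cyc, dif_neg hne, dif_pos hc]⟩

theorem CyclicPath.exists_isRep (p : CyclicPath s t) : ∃ (i : V) (w : List (E × Bool)),
    p.IsRep i w ∧ cyc R s t i w = Finsupp.single p 1 := by
  rcases p with i | ⟨w, hne, hc⟩
  · exact ⟨i, [], ⟨rfl, rfl, fun k hk => by injection hk⟩, dif_pos rfl⟩
  · induction w using Quotient.inductionOn' with | h w => ?_
    rcases w with _ | ⟨a, u⟩
    · exact absurd rfl hne
    · exact ⟨src s t a, a :: u, ⟨⟨rfl, (isChain_iff_isPath a a u).mp hc⟩, rfl,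
        fun k hk => by injection hk⟩, (dif_neg hne).trans (dif_pos hc)⟩

variable {s t} in
theorem IsPath.start_eq {i i' k k' : V} {w : List (E × Bool)} (hw : w ≠ [])
    (h : IsPath s t i w k) (h' : IsPath s t i' w k') : i = i' := by
  cases w with
  | nil => exact absurd rfl hw
  | cons a w => exact h.1.trans h'.1.symm

variable {s t} in
/-- Two closed paths representing the same cyclic path are rotations of each other. -/
theorem CyclicPath.IsRep.exists_rotation {p : CyclicPath s t} {i i' : V} {w w' : List (E × Bool)}
    (h : p.IsRep i w) (h' : p.IsRep i' w') :
    ∃ u v, w = u ++ v ∧ w' = v ++ u ∧ IsPath s t i u i' ∧ IsPath s t i' v i := by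
  obtain ⟨n, hn⟩ := Cycle.coe_eq_coe.mp (h.2.1.symm.trans h'.2.1)
  rw [List.rotate_eq_drop_append_take_mod] at hn
  generalize n % w.length = r at hn
  have hw : w = w.take r ++ w.drop r := (List.take_append_drop r w).symm
  refine ⟨w.take r, w.drop r, hw, hn.symm, ?_⟩
  have h1 := h.1
  rw [hw] at h1
  obtain ⟨m, h2, h3⟩ := h1.exists_of_append
  suffices i' = m by subst this; exact ⟨h2, h3⟩
  by_cases h0 : w' = []
  · have hi : i = i' := by
      rcases p with k | ⟨c, hne, hc⟩
      · rw [h.2.2 k rfl, h'.2.2 k rfl]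
      · exact absurd (h'.2.1.trans (by rw [h0]; rfl)) hne
    rw [h0] at hn
    rw [(List.append_eq_nil_iff.mp hn).2] at h2
    exact hi.symm.trans h2
  · exact h'.1.start_eq h0 (by rw [← hn]; exact h3.append h2)

end Quiver

section PointElements

open scoped ComonObj MonObj

set_option linter.unusedSectionVars false

variable {C : Type u} [Category.{v} C] [Preadditive C] [MonoidalCategory C] [SymmetricCategory C]
  [MonoidalPreadditive C] [HasBinaryBiproducts C]
  {P : ParityStructure C} {Γ Θ : CommComon C} {S X Y : C} [MonObj S] [IsCommMonObj S]

/-! ### Points as odd and even elements -/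

/-- Odd parameters can be exchanged with those in a value of `ξ`. -/
theorem xi_smul_ap (G : P.pi ⊗ X ⟶ Y) (β β₁ β₂ : El Γ P.pi) (x : El Γ X) :
    ap P.xi.hom (pr β β₁) • ap G (pr β₂ x) = ap P.xi.hom (pr β₁ β₂) • ap G (pr β x) := by
  rw [← ap_smul, ← ap_smul, ← pr_smul_left, ← pr_smul_left, xi_smul_assoc]

/-- Exchanging the odd parameters of two odd functions changes the sign of their product. -/
theorem ap_mul_ap_swap (f : P.pi ⊗ X ⟶ S) (g : P.pi ⊗ Y ⟶ S) (β β' : El Γ P.pi) (x : El Γ X)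
    (y : El Γ Y) :
    ap f (pr β x) * ap g (pr β' y) = -(ap f (pr β' x) * ap g (pr β y)) := by
  have hG : ∀ β β' : El Γ P.pi, ap (tensorμ _ _ _ _ ≫ (f ⊗ₘ g) ≫ μ) (pr (pr β β') (pr x y)) =
      ap f (pr β x) * ap g (pr β' y) := fun β β' => by simp [tensorμ, ap_comp]
  rw [← hG, ← hG, pr_pi_swap, pr_neg_left, ap_neg]

/-- Multiplication by the values of `ξ` is faithful. -/
theorem eq_of_xi_smul {f g : X ⟶ Y} (h : ∀ (Γ : CommComon C) (β β' : El Γ P.pi) (x : El Γ X),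
    ap P.xi.hom (pr β β') • ap f x = ap P.xi.hom (pr β β') • ap g x) : f = g := by
  have e : P.xi.hom ▷ X ≫ (λ_ X).hom ≫ f = P.xi.hom ▷ X ≫ (λ_ X).hom ≫ g :=
    hom_ext₃' fun Γ β β' x => by simpa [ap_comp, ap_smul] using h Γ β β' x
  rwa [cancel_epi, cancel_epi] at e

theorem eq_of_xi_smul_xi_smul {f g : X ⟶ Y}
    (h : ∀ (Γ : CommComon C) (β₁ β₂ β₃ β₄ : El Γ P.pi) (x : El Γ X),
      ap P.xi.hom (pr β₁ β₂) • ap P.xi.hom (pr β₃ β₄) • ap f x =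
        ap P.xi.hom (pr β₁ β₂) • ap P.xi.hom (pr β₃ β₄) • ap g x) : f = g := by
  have e : P.xi.hom ▷ P.pi ▷ P.pi ▷ X ≫ (λ_ P.pi).hom ▷ P.pi ▷ X ≫ P.xi.hom ▷ X ≫ (λ_ X).hom ≫ f =
      P.xi.hom ▷ P.pi ▷ P.pi ▷ X ≫ (λ_ P.pi).hom ▷ P.pi ▷ X ≫ P.xi.hom ▷ X ≫ (λ_ X).hom ≫ g :=
    hom_ext₅ fun Γ β₁ β₂ β₃ β₄ x => by
      simpa [ap_comp, ap_smul, pr_smul_left, smul_smul_el] using h Γ β₁ β₂ β₃ β₄ x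
  rwa [cancel_epi, cancel_epi, cancel_epi, cancel_epi] at e

/-- The even part of a point, as an element. -/
def evEl (f : P.Points S) : El Γ S := ap f.even 1

/-- The odd part of a point, as a function on elements of `π`. -/
def oddEl (f : P.Points S) (β : El Γ P.pi) : El Γ S := ap f.odd (pr β 1)

theorem ap_unit_eq (f : 𝟙_ C ⟶ X) (a : El Γ (𝟙_ C)) : ap f a = a • ap f 1 := by
  rw [← ap_smul, smul_comm_unit, one_smul_el]

theorem ap_pr_unit_eq (f : X ⊗ 𝟙_ C ⟶ Y) (x : El Γ X) (a : El Γ (𝟙_ C)) :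
    ap f (pr x a) = a • ap f (pr x 1) := by
  rw [← ap_smul, ← pr_smul_right, smul_comm_unit, one_smul_el]

/-- Points are equal if they have the same elements, up to values of `ξ`. -/
theorem points_ext {f g : P.Points S}
    (h0 : ∀ (Γ : CommComon C) (β₁ β₂ β₃ β₄ : El Γ P.pi),
      ap P.xi.hom (pr β₁ β₂) • ap P.xi.hom (pr β₃ β₄) • evEl (Γ := Γ) f =
        ap P.xi.hom (pr β₁ β₂) • ap P.xi.hom (pr β₃ β₄) • evEl g)
    (h1 : ∀ (Γ : CommComon C) (β₁ β₂ β₃ : El Γ P.pi),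
      ap P.xi.hom (pr β₁ β₂) • oddEl f β₃ = ap P.xi.hom (pr β₁ β₂) • oddEl g β₃) : f = g := by
  refine ParityStructure.Points.ext
    (eq_of_xi_smul_xi_smul (P := P) fun Γ β₁ β₂ β₃ β₄ x => ?_) (hom_ext₂ fun Γ β x => ?_)
  · rw [ap_unit_eq, ap_unit_eq g.even, smul_smul_comm _ x, smul_smul_comm _ x, smul_smul_comm _ x,
      smul_smul_comm _ x]
    exact congrArg (x • ·) (h0 Γ β₁ β₂ β₃ β₄)
  · rw [ap_pr_unit_eq, ap_pr_unit_eq g.odd]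
    refine congrArg (x • ·) ?_
    have e : (ρ_ P.pi).inv ≫ f.odd = (ρ_ P.pi).inv ≫ g.odd :=
      eq_of_xi_smul fun Γ β₁ β₂ β₃ => by simpa [ap_comp, oddEl] using h1 Γ β₁ β₂ β₃
    rw [(cancel_epi _).mp e]

theorem evEl_add (f g : P.Points S) : evEl (Γ := Γ) (f + g) = evEl f + evEl g := add_ap _ _ _

theorem oddEl_add (f g : P.Points S) (β : El Γ P.pi) : oddEl (f + g) β = oddEl f β + oddEl g β :=
  add_ap _ _ _

theorem evEl_sub (f g : P.Points S) : evEl (Γ := Γ) (f - g) = evEl f - evEl g := sub_ap _ _ _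

theorem oddEl_sub (f g : P.Points S) (β : El Γ P.pi) : oddEl (f - g) β = oddEl f β - oddEl g β :=
  sub_ap _ _ _

theorem evEl_eq_zero {f : P.Points S} (h : f.even = 0) : evEl (Γ := Γ) f = 0 := by
  rw [evEl, h, zero_ap]

theorem oddEl_mul (f g : P.Points S) (β : El Γ P.pi) :
    oddEl (f * g) β = evEl f * oddEl g β + oddEl f β * evEl g := by
  simp [oddEl, evEl, ParityStructure.Points.odd_mul, add_ap, ap_comp]

theorem pr_one_eq (a : El Γ (𝟙_ C)) : pr (1 : El Γ (𝟙_ C)) a = pr a 1 := by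
  rw [← ap_leftUnitor_inv, ← ap_rightUnitor_inv, unitors_inv_equal]

theorem xi_smul_evEl_mul (f g : P.Points S) (β β' : El Γ P.pi) :
    ap P.xi.hom (pr β β') • evEl (f * g) =
      ap P.xi.hom (pr β β') • (evEl f * evEl g) + oddEl f β * oddEl g β' := by
  have h1 : ap P.xi.hom (pr β β') • evEl (f * g) = ap (f * g).even (ap P.xi.hom (pr β β')) :=
    (ap_unit_eq _ _).symm
  have h2 : ap P.xi.hom (pr β β') • (evEl f * evEl g) =
      ap f.even (ap P.xi.hom (pr β β')) * ap g.even 1 := by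
    rw [ap_unit_eq f.even, smul_mul_el]; rfl
  rw [h1, h2, ParityStructure.Points.even_mul, add_ap]
  congr 1
  · simp [ap_comp, pr_one_eq]
  · simp [ap_comp, oddEl]

/-- The operator on points given by an odd morphism. -/
def opPoints (D : P.pi ⊗ S ⟶ S) (f : P.Points S) : P.Points S :=
  P.scomp ((0, D) : P.SHom S S) f

variable (D : P.pi ⊗ S ⟶ S)

theorem oddEl_opPoints (f : P.Points S) (β : El Γ P.pi) :
    oddEl (opPoints D f) β = ap D (pr β (evEl f)) := by
  have : (opPoints D f).odd = P.pi ◁ f.even ≫ D + f.odd ≫ 0 := rfl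
  rw [oddEl, this, add_ap, ap_comp, ap_whiskerLeft, comp_zero, zero_ap, add_zero, evEl]

theorem xi_smul_evEl_opPoints (f : P.Points S) (β β' : El Γ P.pi) :
    ap P.xi.hom (pr β β') • evEl (opPoints D f) = ap D (pr β (oddEl f β')) := by
  have : (opPoints D f).even = f.even ≫ 0 + (λ_ (𝟙_ C)).inv ≫ P.xi.inv ▷ 𝟙_ C ≫
    (α_ P.pi P.pi (𝟙_ C)).hom ≫ P.pi ◁ f.odd ≫ D := rfl
  rw [evEl, ← ap_unit_eq, this, comp_zero, zero_add]
  simp only [ap_comp, ap_leftUnitor_inv, pr_one_eq, ap_whiskerRight, ap_hom_inv, ap_assoc_hom,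
    ap_whiskerLeft, oddEl]

theorem opPoints_add (f g : P.Points S) :
    opPoints D (f + g) = opPoints D f + opPoints D g := by
  refine points_ext (fun Γ _ _ β β' => congrArg _ ?_) fun Γ _ _ β => congrArg _ ?_
  · rw [xi_smul_evEl_opPoints, evEl_add, smul_add_el, xi_smul_evEl_opPoints, xi_smul_evEl_opPoints,
      oddEl_add, pr_add_right, ap_add]
  · rw [oddEl_opPoints, oddEl_add, oddEl_opPoints, oddEl_opPoints, evEl_add, pr_add_right, ap_add]

/-- The bracket `D(f g) - D(f) g + f D(g)` of the operator on points, with the sign for an odd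
point `f`. -/
def pointBracket (f g : P.Points S) : P.Points S :=
  opPoints D (f * g) - opPoints D f * g + f * opPoints D g

variable {f : P.Points S} (hf : f.even = 0)
include hf

theorem xi_smul_evEl_pointBracket (g : P.Points S) (β β' : El Γ P.pi) :
    ap P.xi.hom (pr β β') • evEl (pointBracket D f g) = bracket D β (oddEl f β') (evEl g) := by
  rw [pointBracket, evEl_add, evEl_sub, smul_add_el, smul_sub_el, xi_smul_evEl_opPoints,
    xi_smul_evEl_mul, xi_smul_evEl_mul, ← smul_mul_el, xi_smul_evEl_opPoints, oddEl_opPoints,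
    oddEl_opPoints, oddEl_mul, evEl_eq_zero hf, zero_mul, zero_add, zero_mul, smul_zero_el,
    zero_add, pr_zero_right, ap_zero, zero_mul, add_zero, bracket, oddEl, oddEl, ap_mul_ap_swap]
  ring

theorem xi_smul_oddEl_pointBracket (g : P.Points S) (β β' β'' : El Γ P.pi) :
    ap P.xi.hom (pr β β') • oddEl (pointBracket D f g) β'' =
      bracket D β (oddEl f β') (oddEl g β'') := by
  have h1 : ap P.xi.hom (pr β β') • ap D (pr β'' (evEl (f * g))) =
      ap D (pr β (oddEl f β' * oddEl g β'')) := by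
    rw [xi_smul_ap, ← ap_smul, ← pr_smul_right, xi_smul_evEl_mul, evEl_eq_zero hf, zero_mul,
      smul_zero_el, zero_add]
  have h2 : ap P.xi.hom (pr β β') • (oddEl f β'' * evEl (opPoints D g)) =
      -(oddEl f β' * ap D (pr β (oddEl g β''))) := by
    rw [oddEl, ← smul_mul_el, xi_smul_ap, smul_mul_el, ← mul_smul_el, xi_smul_evEl_opPoints,
      ap_mul_ap_swap]
    rfl
  rw [pointBracket, oddEl_add, oddEl_sub, oddEl_opPoints, oddEl_mul, oddEl_mul, oddEl_opPoints,
    evEl_eq_zero hf, pr_zero_right, ap_zero, zero_mul, add_zero, zero_mul, zero_add, smul_add_el,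
    smul_sub_el, h1, h2, ← smul_mul_el, xi_smul_evEl_opPoints, bracket]
  ring

variable {D} [HasColimits C] [∀ X : C, PreservesColimits (tensorLeft X)]

/-- The bracket with an odd point `f` is a derivation. -/
theorem IsDiffOp.pointBracket_mul (hD : IsDiffOp 2 D) (hu : P.pi ◁ η ≫ D = 0)
    {h k : P.Points S} (hh : h.even = 0) (hk : k.even = 0)
    (hb : ∀ (Γ : CommComon C) (β β' β'' : El Γ P.pi), bracket D β (oddEl f β') (oddEl h β'') =
      ap P.xi.hom (pr β β') • oddEl k β'') (g : P.Points S) :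
    pointBracket D f (h * g) = k * g + h * pointBracket D f g := by
  refine points_ext (fun Γ β β' γ' δ => ?_) fun Γ β β' γ' => ?_
  · rw [smul_smul_comm, xi_smul_evEl_pointBracket D hf, ← bracket_smul_right, xi_smul_evEl_mul,
      evEl_eq_zero hh, zero_mul, smul_zero_el, zero_add, hD.bracket_mul_right hu, hb, evEl_add,
      smul_add_el, xi_smul_evEl_mul, xi_smul_evEl_mul, evEl_eq_zero hk, evEl_eq_zero hh, zero_mul,
      smul_zero_el, zero_add, zero_mul, smul_zero_el, zero_add, smul_add_el,
      ← mul_smul_el _ (oddEl h γ'), xi_smul_oddEl_pointBracket D hf, mul_smul_el,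
      mul_comm (oddEl g δ), add_comm]
  · rw [xi_smul_oddEl_pointBracket D hf, oddEl_mul, evEl_eq_zero hh, zero_mul, zero_add,
      hD.bracket_mul_right hu, hb, oddEl_add, oddEl_mul, oddEl_mul, evEl_eq_zero hk,
      evEl_eq_zero hh, zero_mul, zero_mul, zero_add, zero_add, smul_add_el,
      ← mul_smul_el _ (oddEl h γ'),
      xi_smul_evEl_pointBracket D hf, mul_smul_el, mul_comm (evEl g), add_comm]

end PointElements

section Trace

open scoped ComonObj MonObj

set_option linter.unusedSectionVars false

variable {R : Type*} [CommRing R] {C : Type u} [Category.{v} C] [Preadditive C] [Linear R C]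
  [MonoidalCategory C] [SymmetricCategory C] [MonoidalPreadditive C] [MonoidalLinear R C]
  [HasBinaryBiproducts C] [HasColimits C] [∀ X : C, PreservesColimits (tensorLeft X)]
  {P : ParityStructure C} {Γ : CommComon C}
  {V E : Type*} [Finite E] (s t : E → V) (c : V → DualisableWithInvolution P)
  {S : C} [MonObj S] [IsCommMonObj S] (j : hTilde s t c ⟶ S) {σ : Variant}

/-! ### The odd trace on the necklace module -/

theorem oddTrace_even (i : V) (w : List (E × Bool)) : (oddTrace s t c j i w).even = 0 := rfl

theorem oddEl_oddTrace (i : V) (w : List (E × Bool)) (β : El Γ P.pi) :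
    oddEl (oddTrace s t c j i w) β = otrEl s t c j i w β :=
  (otrEl_eq_ap i w β).symm

variable {s t} in
/-- The odd trace of a closed path only depends on the cyclic path that it represents. -/
theorem CyclicPath.IsRep.oddTrace_eq {p : CyclicPath s t} {i i' : V} {w w' : List (E × Bool)}
    (h : p.IsRep i w) (h' : p.IsRep i' w') :
    oddTrace s t c j i w = oddTrace s t c j i' w' := by
  obtain ⟨u, v, rfl, rfl, hu, hv⟩ := h.exists_rotation h'
  refine points_ext (fun Γ _ _ _ _ => ?_) fun Γ _ _ β => ?_
  · rw [evEl_eq_zero (oddTrace_even s t c j _ _), evEl_eq_zero (oddTrace_even s t c j _ _)]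
  · rw [oddEl_oddTrace, oddEl_oddTrace, otrEl_append_comm s t c j hu hv]

variable (R) in
/-- The linear extension of the odd trace to the module of cyclic paths. -/
noncomputable def traceMap : NecklaceModule R s t →ₗ[R] P.Points S :=
  Finsupp.linearCombination R fun p =>
    oddTrace s t c j (p.exists_isRep R s t).choose (p.exists_isRep R s t).choose_spec.choose

theorem traceMap_single {p : CyclicPath s t} {i : V} {w : List (E × Bool)} (h : p.IsRep i w) :
    traceMap R s t c j (Finsupp.single p 1) = oddTrace s t c j i w := by
  rw [traceMap, Finsupp.linearCombination_single, one_smul]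
  exact (p.exists_isRep R s t).choose_spec.choose_spec.1.oddTrace_eq c j h

theorem traceMap_cyc {i : V} {w : List (E × Bool)} (h : IsPath s t i w i) :
    traceMap R s t c j (cyc R s t i w) = oddTrace s t c j i w := by
  obtain ⟨p, hp, e⟩ := exists_isRep_of_isPath R s t h
  rw [e, traceMap_single s t c j hp]

theorem traceMap_even (m : NecklaceModule R s t) : (traceMap R s t c j m).even = 0 := by
  induction m using Finsupp.induction_linear with
  | zero => rw [map_zero]; rfl
  | add m n hm hn => rw [map_add, ParityStructure.Points.even_add, hm, hn, add_zero]
  | single p r =>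
    rw [traceMap, Finsupp.linearCombination_single, ParityStructure.Points.even_smul,
      oddTrace_even, smul_zero]

/-- Odd points have square zero, as they anticommute with themselves. -/
theorem traceMap_sq (h2 : ∀ {X Y : C} (f : X ⟶ Y), f = -f → f = 0) (m : NecklaceModule R s t) :
    traceMap R s t c j m * traceMap R s t c j m = 0 := by
  have h0 := traceMap_even s t c j m
  generalize traceMap R s t c j m = f at h0
  have e : f * f = -(f * f) := by
    rw [← zero_sub]
    refine points_ext (fun Γ _ _ β β' => congrArg _ ?_) fun Γ _ _ β => ?_
    · have e := ap_mul_ap_swap f.odd f.odd β β' 1 1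
      rw [mul_comm (ap f.odd (pr β' 1))] at e
      rw [evEl_sub, smul_sub_el, xi_smul_evEl_mul, evEl_eq_zero h0, zero_mul, smul_zero_el,
        zero_add, evEl_eq_zero rfl, smul_zero_el, zero_sub]
      exact e
    · rw [oddEl_sub, oddEl_mul, evEl_eq_zero h0, zero_mul, mul_zero, zero_add, sub_zero, oddEl,
        ParityStructure.Points.odd_zero, zero_ap]
  exact ParityStructure.Points.ext (h2 _ (congrArg ParityStructure.Points.even e))
    (h2 _ (congrArg ParityStructure.Points.odd e))

/-- The algebra map `S Π 𝒩 → C̲(1, S)` given by the odd traces. -/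
noncomputable def otrHom (h2 : ∀ {X Y : C} (f : X ⟶ Y), f = -f → f = 0) :
    ExteriorAlgebra R (NecklaceModule R s t) →ₐ[R] P.Points S :=
  ExteriorAlgebra.lift R ⟨traceMap R s t c j, traceMap_sq s t c j h2⟩

theorem otrHom_ι (h2 : ∀ {X Y : C} (f : X ⟶ Y), f = -f → f = 0) (m : NecklaceModule R s t) :
    otrHom s t c j h2 (ExteriorAlgebra.ι R m) = traceMap R s t c j m :=
  ExteriorAlgebra.lift_ι_apply R _ _ m

/-- The odd part as a homomorphism. -/
def oddElHom (β : El Γ P.pi) : P.Points S →+ El Γ S :=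
  AddMonoidHom.mk' (fun f => oddEl f β) fun f g => oddEl_add f g β

/-- The even part as a homomorphism. -/
def evElHom : P.Points S →+ El Γ S :=
  AddMonoidHom.mk' evEl evEl_add

variable (R) in
/-- The operator on points as a linear map. -/
def opPointsHom (D : P.pi ⊗ S ⟶ S) : P.Points S →ₗ[R] P.Points S where
  toFun := opPoints D
  map_add' := opPoints_add D
  map_smul' r f := by
    refine ParityStructure.Points.ext ?_ ?_
    · have (f : P.Points S) : (opPoints D f).even = f.even ≫ 0 + (λ_ (𝟙_ C)).inv ≫
        P.xi.inv ▷ 𝟙_ C ≫ (α_ P.pi P.pi (𝟙_ C)).hom ≫ P.pi ◁ f.odd ≫ D := rfl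
      simp [this, ParityStructure.Points.even_smul, ParityStructure.Points.odd_smul]
    · have (f : P.Points S) : (opPoints D f).odd = P.pi ◁ f.even ≫ D + f.odd ≫ 0 := rfl
      simp [this, ParityStructure.Points.even_smul, ParityStructure.Points.odd_smul]

theorem pointBracket_add_left (D : P.pi ⊗ S ⟶ S) (f f' g : P.Points S) :
    pointBracket D (f + f') g = pointBracket D f g + pointBracket D f' g := by
  simp only [pointBracket, add_mul, opPoints_add]; abel

theorem pointBracket_add_right (D : P.pi ⊗ S ⟶ S) (f g g' : P.Points S) :
    pointBracket D f (g + g') = pointBracket D f g + pointBracket D f g' := by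
  simp only [pointBracket, mul_add, opPoints_add]; abel

theorem opPoints_smul (D : P.pi ⊗ S ⟶ S) (r : R) (f : P.Points S) :
    opPoints D (r • f) = r • opPoints D f :=
  (opPointsHom R D).map_smul r f

theorem pointBracket_smul_left (D : P.pi ⊗ S ⟶ S) (r : R) (f g : P.Points S) :
    pointBracket D (r • f) g = r • pointBracket D f g := by
  simp only [pointBracket, smul_mul_assoc, smul_add, smul_sub, opPoints_smul]

theorem pointBracket_smul_right (D : P.pi ⊗ S ⟶ S) (r : R) (f g : P.Points S) :
    pointBracket D f (r • g) = r • pointBracket D f g := by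
  simp only [pointBracket, mul_smul_comm, smul_add, smul_sub, opPoints_smul]

variable {s t c j}
variable {D : P.pi ⊗ S ⟶ S} (hD : IsRepresentationBV s t c j σ D)
include hD

theorem IsRepresentationBV.opPoints_one : opPoints D (1 : P.Points S) = 0 := by
  refine points_ext (fun Γ _ _ β β' => congrArg _ ?_) fun Γ _ _ β => congrArg _ ?_
  · rw [xi_smul_evEl_opPoints, oddEl, ParityStructure.Points.odd_one, zero_ap, pr_zero_right,
      ap_zero, evEl_eq_zero rfl, smul_zero_el]
  · rw [oddEl_opPoints, evEl, ParityStructure.Points.even_one, ← ap_whiskerLeft, ← ap_comp, hD.unit,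
      zero_ap, oddEl, ParityStructure.Points.odd_zero, zero_ap]

/-- The operators agree on single cyclic paths; the necklace bracket does not contribute there. -/
theorem IsRepresentationBV.opPoints_traceMap [Invertible (2 : R)]
    (h2 : ∀ {X Y : C} (f : X ⟶ Y), f = -f → f = 0) (m : NecklaceModule R s t) :
    opPoints D (traceMap R s t c j m) =
      -otrHom s t c j h2 (shiftedCobr (cobr R s t σ) m) := by
  suffices h : opPointsHom R D ∘ₗ traceMap R s t c j =
      -((otrHom s t c j h2).toLinearMap ∘ₗ shiftedCobr (cobr R s t σ)) from
    LinearMap.congr_fun h m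
  refine Finsupp.lhom_ext' fun p => LinearMap.ext_ring ?_
  obtain ⟨i, w, hp, -⟩ := p.exists_isRep R s t
  change opPoints D (traceMap R s t c j (Finsupp.single p 1)) =
    -otrHom s t c j h2 (shiftedCobr (cobr R s t σ) (Finsupp.single p 1))
  have e : otrHom s t c j h2 (shiftedCobr (cobr R s t σ) (Finsupp.single p 1)) =
      decSum w fun u a r => decSum r fun m b n => pairing a b •
        (oddTrace s t c j (tgt s t a) (m ++ link σ b a) *
          oddTrace s t c j (tgt s t b) (n ++ u ++ link σ a b)) := by
    rw [shiftedCobr_cobr_single R s t σ hp.2.1]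
    refine (map_decSum (otrHom (R := R) s t c j h2).toLinearMap.toAddMonoidHom _ _).trans ?_
    refine decSum_congr fun u a r h =>
      (map_decSum (otrHom (R := R) s t c j h2).toLinearMap.toAddMonoidHom _ _).trans ?_
    refine decSum_congr fun m b n h' => ?_
    subst h h'
    obtain ⟨h3, h4⟩ := hp.1.of_decomp
    obtain ⟨h5, h6⟩ := h4.of_decomp
    by_cases h0 : pairing a b = 0
    · simp [h0]
    have h0' : pairing b a ≠ 0 := by rwa [pairing_swap, neg_ne_zero]
    have hΦ : ∀ y, (otrHom (R := R) s t c j h2).toLinearMap.toAddMonoidHom y =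
      otrHom s t c j h2 y := fun _ => rfl
    rw [hΦ, map_zsmul, map_mul]
    rw [otrHom_ι, otrHom_ι, traceMap_cyc s t c j (h5.append (isPath_link σ h0')),
      traceMap_cyc s t c j ((h6.append h3).append (isPath_link σ h0))]
  rw [traceMap_single s t c j hp, e, ← zero_sub]
  refine points_ext (fun Γ _ _ β β' => congrArg _ ?_) fun Γ _ _ β => congrArg _ ?_
  · rw [xi_smul_evEl_opPoints, oddEl_oddTrace, hD.ap_otrEl h2 _ _ hp.1, evEl_sub,
      evEl_eq_zero rfl, zero_sub, smul_neg_el]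
    congr 1
    change _ = _ • evElHom _
    rw [map_decSum, smul_decSum_el]
    refine decSum_congr fun u a r _ => ?_
    rw [map_decSum, smul_decSum_el]
    refine decSum_congr fun m b n _ => ?_
    rw [map_zsmul, smul_zsmul_el]
    congr 1
    change _ = _ • evEl _
    rw [xi_smul_evEl_mul, oddEl_oddTrace, oddEl_oddTrace, evEl_eq_zero (oddTrace_even s t c j _ _),
      zero_mul, smul_zero_el, zero_add]
  · rw [oddEl_opPoints, evEl_eq_zero (oddTrace_even s t c j _ _), pr_zero_right, ap_zero, oddEl_sub]
    change _ = oddEl 0 β - oddElHom β _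
    rw [map_decSum, oddEl, ParityStructure.Points.odd_zero, zero_ap, zero_sub, ← neg_zero]
    congr 1
    rw [← decSum_zero w]
    refine decSum_congr fun u a r _ => ?_
    rw [map_decSum, ← decSum_zero r]
    refine decSum_congr fun m b n _ => ?_
    rw [map_zsmul]
    change _ = _ • oddEl _ β
    rw [oddEl_mul, evEl_eq_zero (oddTrace_even s t c j _ _),
      evEl_eq_zero (oddTrace_even s t c j _ _), zero_mul, mul_zero, add_zero, smul_zero]

/-- The bracket with the odd trace of a cyclic path is a derivation given by the necklace
bracket. -/
theorem IsRepresentationBV.pointBracket_traceMap (m n : NecklaceModule R s t) (g : P.Points S) :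
    pointBracket D (traceMap R s t c j m) (traceMap R s t c j n * g) =
      (2 : R) • traceMap R s t c j (br R s t σ m n) * g +
        traceMap R s t c j n * pointBracket D (traceMap R s t c j m) g := by
  have h0 : ∀ g : P.Points S, pointBracket D 0 g = 0 := fun g => by
    simpa using pointBracket_smul_left D (0 : R) 0 g
  have h0' : ∀ g : P.Points S, pointBracket D g 0 = 0 := fun g => by
    simpa using pointBracket_smul_right D (0 : R) g 0
  induction m using Finsupp.induction_linear with
  | zero => simp [h0]
  | add m m' hm hm' =>
    simp only [map_add, pointBracket_add_left, hm, hm', LinearMap.add_apply, smul_add, add_mul,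
      mul_add]
    abel
  | single p r =>
  induction n using Finsupp.induction_linear with
  | zero => simp [h0']
  | add m m' hm hm' =>
    simp only [map_add, pointBracket_add_right, hm, hm', smul_add, add_mul]; abel
  | single q r' =>
  rw [← Finsupp.smul_single_one p r, ← Finsupp.smul_single_one q r']
  simp only [map_smul, LinearMap.smul_apply, pointBracket_smul_left, smul_mul_assoc,
    pointBracket_smul_right, mul_smul_comm,
    smul_comm (2 : R)]
  rw [smul_comm r r', ← smul_add, ← smul_add]
  congr 2
  obtain ⟨i, w, hp, -⟩ := p.exists_isRep R s t
  obtain ⟨i', w', hq, -⟩ := q.exists_isRep R s t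
  have hbr : br R s t σ (Finsupp.single p 1) (Finsupp.single q 1) = brCyclic R s t σ p q := by
    simp [br]
  rw [← smul_mul_assoc, ← map_smul, hbr, traceMap_single (R := R) s t c j hp,
    traceMap_single (R := R) s t c j hq]
  refine hD.order.pointBracket_mul (oddTrace_even s t c j _ _) hD.unit
    (oddTrace_even s t c j _ _) (traceMap_even (R := R) s t c j _) (fun Γ β β' β'' => ?_) g
  rw [oddEl_oddTrace, oddEl_oddTrace, hD.bracket_otrEl _ _ _ hp.1 hq.1]
  congr 1
  rw [two_smul, ← two_smul ℤ, map_zsmul]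
  change _ = oddElHom β'' _
  rw [map_zsmul]
  change _ = (2 : ℤ) • ((oddElHom β'').comp (traceMap R s t c j).toAddMonoidHom) _
  rw [brCyclic_of_word R s t σ hp.2.1 hq.2.1, map_decSum, smul_decSum]
  refine decSum_congr fun u a v h => ?_
  rw [map_decSum, smul_decSum]
  refine decSum_congr fun u' b v' h' => ?_
  rw [map_zsmul, mul_smul]
  congr 1
  subst h h'
  by_cases h0 : pairing a b = 0
  · simp [h0]
  have h0' : pairing b a ≠ 0 := by rwa [pairing_swap, neg_ne_zero]
  obtain ⟨h3, h4⟩ := hp.1.of_decomp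
  obtain ⟨h5, h6⟩ := hq.1.of_decomp
  congr 1
  change _ = oddEl (traceMap R s t c j (cyc _ _ _ _ _)) β''
  rw [traceMap_cyc s t c j, oddEl_oddTrace]
  exact (((h4.append h3).append (isPath_link σ h0)).append (h6.append h5)).append
    (isPath_link σ h0')

/-- The odd trace intertwines the operators: on both sides the value on a product with an odd factor
is given by the bracket and the cobracket of that factor. -/
theorem IsRepresentationBV.otrHom_necklaceBV [Invertible (2 : R)]
    (h2 : ∀ {X Y : C} (f : X ⟶ Y), f = -f → f = 0)
    (x : ExteriorAlgebra R (NecklaceModule R s t)) :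
    otrHom s t c j h2 (necklaceBV R s t σ x) = opPoints D (otrHom s t c j h2 x) := by
  have hι : ∀ m, otrHom s t c j h2 (ExteriorAlgebra.ι R m) = traceMap R s t c j m :=
    otrHom_ι s t c j h2
  have hbr : ∀ (m : NecklaceModule R s t) (x : ExteriorAlgebra R (NecklaceModule R s t)),
      pointBracket D (traceMap R s t c j m) (otrHom s t c j h2 x) =
        (2 : R) • otrHom s t c j h2 (adOp (br R s t σ) m x) := fun m x => by
    induction x using CliffordAlgebra.left_induction with
    | algebraMap r =>
      rw [Algebra.algebraMap_eq_smul_one, map_smul, map_smul, map_smul, map_one, adOp_one,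
        map_zero, smul_zero, smul_zero, pointBracket_smul_right, pointBracket, mul_one, mul_one,
        sub_self, zero_add, hD.opPoints_one, mul_zero, smul_zero]
    | add x y hx hy => rw [map_add, pointBracket_add_right, hx, hy, map_add, map_add, smul_add]
    | ι_mul x n hx =>
      have e := adOp_ι_mul (br R s t σ) m n x
      have e' := hι n
      simp only [ExteriorAlgebra.ι] at e e'
      rw [e, map_mul, map_add, map_mul, map_mul, e', hD.pointBracket_traceMap, hx, smul_add,
        smul_mul_assoc, mul_smul_comm]
      congr 3
      exact (hι _).symm
  induction x using CliffordAlgebra.left_induction with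
  | algebraMap r =>
    rw [Algebra.algebraMap_eq_smul_one, map_smul, map_smul, map_smul,
      map_one (otrHom (R := R) s t c j h2), opPoints_smul, hD.opPoints_one, necklaceBV,
      LinearMap.sub_apply, LinearMap.smul_apply, brOp_one, cobrOp_one, smul_zero, sub_zero, map_zero]
  | add x y hx hy => rw [map_add, map_add, hx, hy, map_add, opPoints_add]
  | ι_mul x m hx =>
    have e1 : opPoints D (traceMap R s t c j m * otrHom s t c j h2 x) =
        pointBracket D (traceMap R s t c j m) (otrHom s t c j h2 x) +
          opPoints D (traceMap R s t c j m) * otrHom s t c j h2 x -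
            traceMap R s t c j m * opPoints D (otrHom s t c j h2 x) := by
      rw [pointBracket]; abel
    have e2 : necklaceBV R s t σ (ExteriorAlgebra.ι R m * x) =
        (2 : R) • adOp (br R s t σ) m x - ExteriorAlgebra.ι R m * necklaceBV R s t σ x -
          shiftedCobr (cobr R s t σ) m * x := by
      simp only [necklaceBV, LinearMap.sub_apply, LinearMap.smul_apply, brOp_ι_mul, cobrOp_ι_mul,
        smul_sub, mul_sub, mul_smul_comm]
      abel
    change otrHom s t c j h2 (necklaceBV R s t σ (ExteriorAlgebra.ι R m * x)) =
      opPoints D (otrHom s t c j h2 (ExteriorAlgebra.ι R m * x))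
    rw [map_mul (otrHom (R := R) s t c j h2), hι, e1, e2, hbr, hD.opPoints_traceMap h2,
      ← hx, map_sub, map_sub, map_smul, map_mul, map_mul, hι]
    noncomm_ring

end Trace

section Parity

open ParityStructure.Points

variable {R : Type*} [CommRing R] {C : Type u} [Category.{v} C] [Preadditive C] [Linear R C]
  [MonoidalCategory C] [SymmetricCategory C] [MonoidalPreadditive C] [MonoidalLinear R C]
  {P : ParityStructure C} {S : C} [MonObj S] {M : Type*} [AddCommGroup M] [Module R M]

/-! ### Parity -/

theorem even_mul_of_odd {f g : P.Points S} (hf : f.odd = 0) (hg : g.even = 0) :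
    (f * g).even = 0 := by
  simp [even_mul, hf, hg]

theorem odd_mul_of_odd {f g : P.Points S} (hf : f.odd = 0) (hg : g.odd = 0) :
    (f * g).odd = 0 := by
  simp [odd_mul, hf, hg]

theorem odd_mul_of_even {f g : P.Points S} (hf : f.even = 0) (hg : g.even = 0) :
    (f * g).odd = 0 := by
  simp [odd_mul, hf, hg]

theorem odd_eq_zero_of_mem_evenOdd_zero (F : ExteriorAlgebra R M →ₐ[R] P.Points S)
    (hF : ∀ m, (F (ExteriorAlgebra.ι R m)).even = 0) (x : ExteriorAlgebra R M)
    (hx : x ∈ CliffordAlgebra.evenOdd (0 : QuadraticForm R M) 0) : (F x).odd = 0 := by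
  induction x, hx using CliffordAlgebra.even_induction with
  | algebraMap r =>
    have e : F (algebraMap R (CliffordAlgebra (0 : QuadraticForm R M)) r) = r • 1 :=
      (F.commutes r).trans (Algebra.algebraMap_eq_smul_one r)
    rw [e, odd_smul, ParityStructure.Points.odd_one, smul_zero]
  | add x y _ _ hx hy => rw [map_add, odd_add, hx, hy, add_zero]
  | ι_mul_ι_mul m n x _ hx =>
    rw [map_mul F, map_mul F]
    exact odd_mul_of_odd (odd_mul_of_even (hF m) (hF n)) hx

theorem even_eq_zero_of_mem_evenOdd_one (F : ExteriorAlgebra R M →ₐ[R] P.Points S)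
    (hF : ∀ m, (F (ExteriorAlgebra.ι R m)).even = 0) (x : ExteriorAlgebra R M)
    (hx : x ∈ CliffordAlgebra.evenOdd (0 : QuadraticForm R M) 1) : (F x).even = 0 := by
  induction x, hx using CliffordAlgebra.odd_induction with
  | ι m => exact hF m
  | add x y _ _ hx hy => rw [map_add, even_add, hx, hy, add_zero]
  | ι_mul_ι_mul m n x _ hx =>
    rw [map_mul F, map_mul F]
    exact even_mul_of_odd (odd_mul_of_even (hF m) (hF n)) hx

end Parity

theorem eq_zero_of_eq_neg (R : Type*) [CommRing R] [Invertible (2 : R)] {M : Type*}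
    [AddCommGroup M] [Module R M] {x : M} (h : x = -x) : x = 0 := by
  have h' : (2 : R) • x = 0 := by rw [two_smul]; exact add_eq_zero_iff_eq_neg.mpr h
  simpa using congrArg (⅟(2 : R) • ·) h'

end Necklace
theorem mainTheorem4 {R : Type*} [CommRing R] [Invertible (2 : R)]
    {C : Type u} [Category.{v} C] [Preadditive C] [Linear R C]
    [MonoidalCategory C] [SymmetricCategory C] [MonoidalPreadditive C] [MonoidalLinear R C]
    [HasColimits C] [∀ X : C, PreservesColimits (tensorLeft X)]
    [∀ X : C, PreservesColimits (tensorRight X)]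
    (P : Necklace.ParityStructure C)
    {V : Type*} {E : Type*} [Finite V] [Finite E] (s t : E → V)
    (c : V → Necklace.DualisableWithInvolution P)
    (S : C) [MonObj S] [IsCommMonObj S]
    (j : Necklace.hTilde s t c ⟶ S) (hj : Necklace.IsFreeCommMon j) :
    ∃ otr : ExteriorAlgebra R (Necklace.NecklaceModule R s t) →ₐ[R] P.Points S,
      -- `otr` is the unique algebra map with the prescribed values on closed paths
      (∀ (i : V) (w : List (E × Bool)), Necklace.IsPath s t i w i →
        otr (ExteriorAlgebra.ι R (Necklace.cyc R s t i w)) = Necklace.oddTrace s t c j i w) ∧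
      (∀ otr' : ExteriorAlgebra R (Necklace.NecklaceModule R s t) →ₐ[R] P.Points S,
        (∀ (i : V) (w : List (E × Bool)), Necklace.IsPath s t i w i →
          otr' (ExteriorAlgebra.ι R (Necklace.cyc R s t i w)) =
            Necklace.oddTrace s t c j i w) → otr' = otr) ∧
      -- `otr` preserves parity
      (∀ x ∈ CliffordAlgebra.evenOdd (0 : QuadraticForm R (Necklace.NecklaceModule R s t)) 0,
        (otr x).odd = 0) ∧
      (∀ x ∈ CliffordAlgebra.evenOdd (0 : QuadraticForm R (Necklace.NecklaceModule R s t)) 1,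
        (otr x).even = 0) ∧
      -- `otr` intertwines the operators on both sides
      ∀ σ : Necklace.Variant, ∃ D : P.pi ⊗ S ⟶ S,
        Necklace.IsRepresentationBV s t c j σ D ∧
        (∀ D' : P.pi ⊗ S ⟶ S, Necklace.IsRepresentationBV s t c j σ D' → D' = D) ∧
        ∀ x : ExteriorAlgebra R (Necklace.NecklaceModule R s t),
          otr (Necklace.necklaceBV R s t σ x) =
            P.scomp ((0, D) : P.SHom S S) (otr x) := by
  have h2 : ∀ {X Y : C} (f : X ⟶ Y), f = -f → f = 0 :=
    fun _ h => Necklace.eq_zero_of_eq_neg R h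
  have : HasBinaryBiproducts C := HasBinaryBiproducts.of_hasBinaryCoproducts
  have hF : ∀ m, (Necklace.otrHom s t c j h2 (ExteriorAlgebra.ι R m)).even = 0 := fun m => by
    rw [Necklace.otrHom_ι]
    exact Necklace.traceMap_even s t c j m
  refine ⟨Necklace.otrHom s t c j h2, fun i w h => ?_, fun otr' h => ?_,
    Necklace.odd_eq_zero_of_mem_evenOdd_zero _ hF,
    Necklace.even_eq_zero_of_mem_evenOdd_one _ hF, fun σ => ?_⟩
  · rw [Necklace.otrHom_ι, Necklace.traceMap_cyc s t c j h]
  · refine ExteriorAlgebra.hom_ext (Finsupp.lhom_ext' fun p => LinearMap.ext_ring ?_)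
    obtain ⟨i, w, hp, e⟩ := p.exists_isRep R s t
    change otr' (ExteriorAlgebra.ι R (Finsupp.single p 1)) =
      Necklace.otrHom s t c j h2 (ExteriorAlgebra.ι R (Finsupp.single p 1))
    rw [← e, h i w hp.1, Necklace.otrHom_ι, Necklace.traceMap_cyc s t c j hp.1]
  · obtain ⟨D, hD, hu⟩ := Necklace.existsUnique_isRepresentationBV σ hj
    exact ⟨D, hD, hu, hD.otrHom_necklaceBV h2⟩
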